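/- Let $n\ge 2$, $G=\mathrm{GL}(n,\mathbb{C})$, $K=\mathrm{U}(n)$, $\lambda\in\mathbb{R}$, $k\in\mathbb{Z}$. Let $P\subset G$ be the standard maximal parabolic subgroup of block upper triangular matrices $\begin{pmatrix} w & x\\ 0& g\end{pmatrix}$ with $w\in\mathbb{C}^\times$, $g\in\mathrm{GL}(n-1,\mathbb{C})$ and $x$ a row vector, and let $\chi_{i\lambda,k}$ be the character of $P$ that maps this matrix to $|w|^{i\lambda}\left(\frac{w}{|w|}\right)^{k}$. Let $\pi^G_{i\lambda,k}=\mathrm{Ind}_P^G(\chi_{i\lambda,k})$ be the unitary principal series representation (normalized parabolic induction): the Hilbert space is the completion, with respect to the norm $\left(\int_K|F(u)|^2\,du\right)^{1/2}$, of the space of continuous functions $F:G\to\mathbb{C}$ with $F(hp)=\chi_{i\lambda,k}(p)^{-1}\delta_P(p)^{-1/2}F(h)$ for $h\in G$, $p\in P$, where $\delta_P(p)^{1/2}=|w|^{n-1}|\det g|^{-1}$, and $G$ acts by left translation. For $\alpha,\beta\ge 0$ let $\mathcal{H}^{\alpha,\beta}(\mathbb{C}^n)$ be the space of harmonic polynomials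 on $\mathbb{C}^n\cong\mathbb{R}^{2n}$ that are homogeneous of degree $\alpha$ in $z$ and homogeneous of degree $\beta$ in $\overline z$, with the inner product of $L^2(S^{2n-1})$ for the invariant probability measure and the action $(u\cdot f)(z)=f(u^{-1}z)$ of $K$. Then there is a $K$-equivariant unitary isomorphism $$\pi^G_{i\lambda,k}\big|_K\;\cong\;\widehat{\bigoplus_{\substack{\alpha,\beta\ge 0\\ \alpha-\beta=-k}}}\mathcal{H}^{\alpha,\beta}(\mathbb{C}^n)$$ onto the Hilbert space direct sum. Moreover, for all $\alpha,\beta\ge0$ with $\alpha-\beta=-k$ the representation $\mathcal{H}^{\alpha,\beta}(\mathbb{C}^n)$ of $K$ is irreducible and occurs in $\pi^G_{i\lambda,k}|_K$ with multiplicity one, i.e. $\dim\mathrm{Hom}_K\big(\mathcal{H}^{\alpha,\beta}(\mathbb{C}^n),\pi^G_{i\lambda,k}|_K\big)=1$. -/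

import Mathlib

noncomputable section

open MeasureTheory Matrix
open scoped ComplexConjugate ENNReal

namespace GLBranching

/-- The group `GL(n,ℂ)`. -/
abbrev G (n : ℕ) : Type := Matrix.GeneralLinearGroup (Fin n) ℂ

/-- The maximal compact subgroup `U(n)`. -/
abbrev K (n : ℕ) : Type := Matrix.unitaryGroup (Fin n) ℂ

/-- The Hermitian space `ℂⁿ`. -/
abbrev Cn (n : ℕ) : Type := EuclideanSpace ℂ (Fin n)

/-- The inclusion `U(n) → GL(n,ℂ)`. -/
def incl (n : ℕ) : K n →* G n := Unitary.toUnits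

/-- The linear action of matrices on `ℂⁿ`. -/
def act {n : ℕ} (A : Matrix (Fin n) (Fin n) ℂ) : Cn n →L[ℂ] Cn n :=
  Matrix.toEuclideanCLM (n := Fin n) (𝕜 := ℂ) A

theorem incl_coe {n : ℕ} (u : K n) : (incl n u).1 = u.1 := rfl

theorem act_apply {n : ℕ} (A : Matrix (Fin n) (Fin n) ℂ) (z : Cn n) (i : Fin n) :
    act A z i = ∑ j, A i j * z j := rfl

theorem act_mul {n : ℕ} (A B : Matrix (Fin n) (Fin n) ℂ) (z : Cn n) :
    act (A * B) z = act A (act B z) := by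
  simp [act]

theorem act_one {n : ℕ} (z : Cn n) : act (1 : Matrix (Fin n) (Fin n) ℂ) z = z := by
  simp [act]

theorem norm_act_unitary {n : ℕ} (u : K n) (z : Cn n) : ‖act u.1 z‖ = ‖z‖ := by
  have h : (Matrix.toEuclideanCLM (n := Fin n) (𝕜 := ℂ) u.1) ∈ unitary (Cn n →L[ℂ] Cn n) :=
    Unitary.map_mem _ u.2
  exact ContinuousLinearMap.norm_map_of_mem_unitary h z

theorem continuous_incl (n : ℕ) : Continuous (incl n) := by
  rw [Units.continuous_iff]
  constructor
  · exact continuous_subtype_val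
  · have : (fun x : K n => ((incl n x)⁻¹ : G n).1) = fun x : K n => star x.1 := rfl
    change Continuous (fun x : K n => ((incl n x)⁻¹ : G n).1)
    rw [this]
    exact continuous_star.comp continuous_subtype_val

instance compactSpace_K (n : ℕ) : CompactSpace (K n) := by
  refine isCompact_iff_compactSpace.mp (?_ : IsCompact {A : Matrix (Fin n) (Fin n) ℂ | A ∈ Matrix.unitaryGroup (Fin n) ℂ})
  have h1 : IsCompact (Set.pi Set.univ fun _ : Fin n => Set.pi Set.univ fun _ : Fin n =>
      Metric.closedBall (0 : ℂ) 1) :=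
    isCompact_univ_pi fun _ => isCompact_univ_pi fun _ => isCompact_closedBall _ _
  have h2 : IsClosed {A : Matrix (Fin n) (Fin n) ℂ | A ∈ Matrix.unitaryGroup (Fin n) ℂ} := by
    simp only [Matrix.mem_unitaryGroup_iff]
    exact isClosed_eq (by fun_prop) continuous_const
  refine h1.of_isClosed_subset h2 ?_
  intro A hA i _ j _
  simpa using entry_norm_bound_of_unitary hA i j

instance measurableSpace_K (n : ℕ) : MeasurableSpace (K n) := borel _

instance borelSpace_K (n : ℕ) : BorelSpace (K n) := ⟨rfl⟩

/-- The normalized Haar measure of `U(n)`. -/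
def haarK (n : ℕ) : Measure (K n) := Measure.haarMeasure ⊤

instance isHaarMeasure_haarK (n : ℕ) : (haarK n).IsHaarMeasure := by
  unfold haarK; infer_instance

instance isProbabilityMeasure_haarK (n : ℕ) : IsProbabilityMeasure (haarK n) :=
  ⟨by simpa [haarK] using Measure.haarMeasure_self (K₀ := (⊤ : TopologicalSpace.PositiveCompacts (K n)))⟩


instance isMulRightInvariant_haarK (n : ℕ) : (haarK n).IsMulRightInvariant := by
  constructor
  intro g
  have : IsProbabilityMeasure ((haarK n).map (· * g)) :=
    Measure.isProbabilityMeasure_map (by fun_prop)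
  exact Measure.isHaarMeasure_eq_of_isProbabilityMeasure _ _

instance secondCountable_K (n : ℕ) : SecondCountableTopology (K n) := by
  have : SecondCountableTopology (Matrix (Fin n) (Fin n) ℂ) :=
    inferInstanceAs (SecondCountableTopology (Fin n → Fin n → ℂ))
  exact TopologicalSpace.Subtype.secondCountableTopology
    (fun A : Matrix (Fin n) (Fin n) ℂ => A ∈ Matrix.unitaryGroup (Fin n) ℂ)

theorem det_ne_zero {n : ℕ} (g : G n) : g.1.det ≠ 0 := by
  have := (Matrix.isUnit_iff_isUnit_det _).mp g.isUnit
  exact this.ne_zero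

section Parabolic

variable {n : ℕ} [NeZero n]

theorem mem_aux (g : G n) (h : ∀ i, i ≠ 0 → g.1 i 0 = 0) :
    g.1 0 0 ≠ 0 ∧ ∀ i, i ≠ 0 → (g⁻¹ : G n).1 i 0 = 0 := by
  have key : ∀ i, (g⁻¹ : G n).1 i 0 * g.1 0 0 = (1 : Matrix (Fin n) (Fin n) ℂ) i 0 := by
    intro i
    have h1 : ((g⁻¹ : G n).1 * g.1) i 0 = (1 : Matrix (Fin n) (Fin n) ℂ) i 0 := by
      rw [← Units.val_mul, inv_mul_cancel, Units.val_one]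
    rw [Matrix.mul_apply, Finset.sum_eq_single 0] at h1
    · exact h1
    · intro j _ hj
      rw [h j hj, mul_zero]
    · simp
  have h0 : g.1 0 0 ≠ 0 := by
    intro h0
    have := key 0
    rw [h0] at this
    simp at this
  refine ⟨h0, fun i hi => ?_⟩
  have := key i
  rw [Matrix.one_apply_ne hi] at this
  exact (mul_eq_zero.mp this).resolve_right h0

variable (n) in
/-- The standard maximal parabolic subgroup `P` of `GL(n,ℂ)` of type `(1, n-1)`: the block upper
triangular matrices with blocks `w` of size `1`, `g` of size `n - 1` and an arbitrary row vector
in the upper right corner. -/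
def parabolic : Subgroup (G n) where
  carrier := {p | ∀ i, i ≠ 0 → p.1 i 0 = 0}
  one_mem' := by
    intro i hi
    simp [hi]
  mul_mem' := by
    intro a b ha hb i hi
    rw [Units.val_mul, Matrix.mul_apply]
    refine Finset.sum_eq_zero fun j _ => ?_
    by_cases hj : j = 0
    · rw [hj, ha i hi, zero_mul]
    · rw [hb j hj, mul_zero]
  inv_mem' := by
    intro a ha
    exact (mem_aux a ha).2

/-- The upper left entry `w` of an element of `P`. -/
def topEntry (p : parabolic n) : ℂ := p.1.1 0 0

/-- The lower right block `g` (of size `n - 1`) of an element of `P`. -/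
def lowerBlock (p : parabolic n) : Matrix {i : Fin n // i ≠ 0} {i : Fin n // i ≠ 0} ℂ :=
  p.1.1.submatrix Subtype.val Subtype.val

/-- The character `χ_{t,k}` of `P`, namely `|w|^t (w / |w|)^k`, trivial on the unipotent radical. -/
def chi (t : ℂ) (k : ℤ) (p : parabolic n) : ℂ :=
  (‖topEntry p‖ : ℂ) ^ t * (topEntry p / (‖topEntry p‖ : ℂ)) ^ k

/-- The square root of the modular function `p ↦ |det_ℝ (Ad p | 𝔫)|` of `P`. Here `𝔫` is the space
of row vectors `x` of length `n - 1`, on which `p` acts by `x ↦ w x g⁻¹`, so that the real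
determinant is `|w| ^ (2 (n - 1)) |det g| ^ (-2)`. -/
def rhoChar (p : parabolic n) : ℝ :=
  ‖topEntry p‖ ^ (n - 1) / ‖(lowerBlock p).det‖

variable (n) in
/-- The space of continuous functions `F` on `G = GL(n,ℂ)` with
`F(g p) = χ_{t,k}(p)⁻¹ δ_P(p)^{-1/2} F(g)` for `p ∈ P`, i.e. the continuous sections that underlie
the normalized induced representation `Ind_P^G(χ_{t,k})`. -/
def inducedSections (t : ℂ) (k : ℤ) : Submodule ℂ (G n → ℂ) where
  carrier := {F | Continuous F ∧ ∀ (g : G n) (p : parabolic n),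
    F (g * p.1) = (chi t k p)⁻¹ * (rhoChar p : ℂ)⁻¹ * F g}
  add_mem' := by
    rintro F₁ F₂ ⟨h1, h1'⟩ ⟨h2, h2'⟩
    refine ⟨h1.add h2, fun g p => ?_⟩
    simp only [Pi.add_apply, h1', h2', mul_add]
  zero_mem' := ⟨continuous_zero, fun g p => by simp⟩
  smul_mem' := by
    rintro c F ⟨h1, h1'⟩
    refine ⟨h1.const_smul c, fun g p => ?_⟩
    simp only [Pi.smul_apply, h1', smul_eq_mul]
    ring

theorem topEntry_ne_zero (p : parabolic n) : topEntry p ≠ 0 := (mem_aux p.1 p.2).1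

theorem det_parabolic (p : parabolic n) : p.1.1.det = topEntry p * (lowerBlock p).det := by
  rw [Matrix.twoBlockTriangular_det p.1.1 (fun i => i = 0)
    (fun i hi j hj => by rw [hj]; exact p.2 i hi)]
  congr 1
  have hs : Subsingleton {i : Fin n // i = 0} := ⟨fun a b => Subtype.ext (a.2.trans b.2.symm)⟩
  convert! Matrix.det_eq_elem_of_subsingleton (toSquareBlockProp p.1.1 fun i => i = 0) ⟨0, rfl⟩

theorem rhoChar_eq (p : parabolic n) : rhoChar p = ‖topEntry p‖ ^ n / ‖p.1.1.det‖ := by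
  have h1 := topEntry_ne_zero p
  have h2 := det_ne_zero p.1
  rw [det_parabolic] at h2 ⊢
  have h3 : (lowerBlock p).det ≠ 0 := right_ne_zero_of_mul h2
  obtain ⟨m, rfl⟩ : ∃ m, n = m + 1 := ⟨n - 1, (Nat.succ_pred_eq_of_ne_zero (NeZero.ne n)).symm⟩
  rw [rhoChar, norm_mul]
  have := norm_ne_zero_iff.mpr h1
  have := norm_ne_zero_iff.mpr h3
  simp only [Nat.add_sub_cancel, pow_succ]
  field_simp

theorem norm_chi (lam : ℝ) (k : ℤ) (p : parabolic n) : ‖chi (Complex.I * lam) k p‖ = 1 := by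
  have h1 := topEntry_ne_zero p
  have h2 : 0 < ‖topEntry p‖ := norm_pos_iff.mpr h1
  rw [chi, norm_mul, norm_zpow, norm_div, Complex.norm_cpow_eq_rpow_re_of_pos h2]
  simp [h2.ne']

variable (n) in
/-- The first standard basis vector of `ℂⁿ`. -/
def e0 : Cn n := EuclideanSpace.single 0 1

theorem act_e0 (A : Matrix (Fin n) (Fin n) ℂ) (i : Fin n) : act A (e0 n) i = A i 0 := by
  rw [act_apply]
  simp [e0]

theorem norm_e0 : ‖e0 n‖ = 1 := by simp [e0]

theorem exists_unitary {w : Cn n} (hw : ‖w‖ = 1) : ∃ u : K n, act u.1 (e0 n) = w := by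
  have ho : Orthonormal ℂ (Set.domRestrict {(0 : Fin n)} (fun _ : Fin n => w)) := by
    rw [orthonormal_iff_ite]
    rintro ⟨i, hi⟩ ⟨j, hj⟩
    simp only [Set.mem_singleton_iff] at hi hj
    subst hi hj
    simp [Set.domRestrict, inner_self_eq_norm_sq_to_K, hw]
  obtain ⟨b, hb⟩ := ho.exists_orthonormalBasis_extension_of_card_eq (by simp)
  let u : Matrix (Fin n) (Fin n) ℂ := (EuclideanSpace.basisFun (Fin n) ℂ).toBasis.toMatrix b
  refine ⟨⟨u, OrthonormalBasis.toMatrix_orthonormalBasis_mem_unitary _ _⟩, ?_⟩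
  ext i
  rw [act_e0]
  simp [u, Module.Basis.toMatrix_apply, hb 0 rfl]

theorem exists_parabolic {g g' : G n} {c : ℂ} (h : act g'.1 (e0 n) = c • act g.1 (e0 n)) :
    ∃ p : parabolic n, g' = g * p.1 ∧ topEntry p = c := by
  have h1 : act (g⁻¹ * g' : G n).1 (e0 n) = c • e0 n := by
    rw [Units.val_mul, act_mul, h, map_smul, ← act_mul, ← Units.val_mul, inv_mul_cancel,
      Units.val_one, act_one]
  have h2 : ∀ i, (g⁻¹ * g' : G n).1 i 0 = c * e0 n i := by
    intro i
    have h3 := act_e0 (g⁻¹ * g' : G n).1 i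
    rw [h1] at h3
    exact h3.symm
  refine ⟨⟨g⁻¹ * g', fun i hi => ?_⟩, ?_, ?_⟩
  · rw [h2]; simp [e0, hi]
  · simp
  · rw [topEntry, h2]; simp [e0]

/-- Iwasawa decomposition. -/
theorem exists_unitary_mul_parabolic (g : G n) : ∃ (u : K n) (p : parabolic n),
    g = incl n u * p.1 := by
  have hz : act g.1 (e0 n) ≠ 0 := by
    intro h
    have : act (g⁻¹ * g).1 (e0 n) = 0 := by rw [Units.val_mul, act_mul, h, map_zero]
    rw [inv_mul_cancel, Units.val_one, act_one] at this
    have h2 := norm_e0 (n := n)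
    rw [this] at h2
    simp at h2
  set z := act g.1 (e0 n)
  obtain ⟨u, hu⟩ := exists_unitary (w := ((‖z‖⁻¹ : ℝ) : ℂ) • z) (by
    rw [norm_smul]; simp [hz])
  obtain ⟨p, hp, -⟩ := exists_parabolic (g := incl n u) (g' := g) (c := (‖z‖ : ℂ)) (by
    rw [incl_coe, hu, smul_smul]
    simp [hz, z])
  exact ⟨u, p, hp⟩

theorem norm_section {lam : ℝ} {k : ℤ} (F : inducedSections n (Complex.I * lam) k) {g g' : G n}
    {c : ℂ} (h : act g'.1 (e0 n) = c • act g.1 (e0 n)) :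
    ‖F.1 g'‖ / ‖g'.1.det‖ = (‖c‖ ^ n)⁻¹ * (‖F.1 g‖ / ‖g.1.det‖) := by
  obtain ⟨p, rfl, rfl⟩ := exists_parabolic h
  have h1 := norm_ne_zero_iff.mpr (topEntry_ne_zero p)
  have h2 := norm_ne_zero_iff.mpr (det_ne_zero p.1)
  have h3 := norm_ne_zero_iff.mpr (det_ne_zero g)
  rw [F.2.2, norm_mul, norm_mul, norm_inv, norm_inv, norm_chi, Units.val_mul, Matrix.det_mul,
    norm_mul, Complex.norm_real, rhoChar_eq, Real.norm_eq_abs,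
    abs_of_nonneg (by positivity)]
  field_simp

end Parabolic


section ChangeOfVariables

variable {n : ℕ}

theorem lintegral_act (g : G n) (f : Cn n → ℝ≥0∞) (hf : Measurable f) :
    ∫⁻ z, f (act g.1 z) = (ENNReal.ofReal (‖g.1.det‖ ^ 2))⁻¹ * ∫⁻ z, f z := by
  set L : Cn n →ₗ[ℝ] Cn n := (act g.1 : Cn n →ₗ[ℂ] Cn n).restrictScalars ℝ with hL
  have hdet : LinearMap.det L = ‖g.1.det‖ ^ 2 := by
    rw [hL, LinearMap.det_restrictScalars]
    have : LinearMap.det (act g.1 : Cn n →ₗ[ℂ] Cn n) = g.1.det := by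
      change LinearMap.det (Matrix.toEuclideanCLM (n := Fin n) (𝕜 := ℂ) g.1 : Cn n →ₗ[ℂ] Cn n) = _
      rw [Matrix.coe_toEuclideanCLM_eq_toEuclideanLin, Matrix.toEuclideanLin_eq_toLin_orthonormal,
        LinearMap.det_toLin]
    rw [this, Algebra.norm_complex_apply, Complex.normSq_eq_norm_sq]
  have hpos : 0 < ‖g.1.det‖ ^ 2 := by
    have := norm_pos_iff.mpr (det_ne_zero g)
    positivity
  have hmap := Measure.map_linearMap_addHaar_eq_smul_addHaar (volume : Measure (Cn n)) (f := L)
    (by rw [hdet]; exact hpos.ne')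
  have hLm : Measurable L := (act g.1).continuous.measurable
  have h1 : ∫⁻ z, f (act g.1 z) = ∫⁻ z, f z ∂(Measure.map L volume) := by
    rw [lintegral_map hf hLm]
    rfl
  rw [h1, hmap, lintegral_smul_measure, hdet, abs_of_pos (inv_pos.mpr hpos),
    ENNReal.ofReal_inv_of_pos hpos, smul_eq_mul]

theorem act_smul_one (c : ℂ) (z : Cn n) :
    act (c • (1 : Matrix (Fin n) (Fin n) ℂ)) z = c • z := by
  simp [act]

theorem lintegral_smul {c : ℝ} (hc : 0 < c) (f : Cn n → ℝ≥0∞) (hf : Measurable f) :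
    ∫⁻ z, f ((c : ℂ) • z) = (ENNReal.ofReal ((c ^ n) ^ 2))⁻¹ * ∫⁻ z, f z := by
  have hd : ((c : ℂ) • (1 : Matrix (Fin n) (Fin n) ℂ)).det ≠ 0 := by
    simp [hc.ne']
  have := lintegral_act (Matrix.GeneralLinearGroup.mkOfDetNeZero _ hd) f hf
  have h1 : (Matrix.GeneralLinearGroup.mkOfDetNeZero _ hd).1 =
    (c : ℂ) • (1 : Matrix (Fin n) (Fin n) ℂ) := rfl
  rw [h1] at this
  simp only [act_smul_one] at this
  rw [this]
  simp [abs_of_pos hc]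

theorem lintegral_unitary (u : K n) (f : Cn n → ℝ≥0∞) (hf : Measurable f) :
    ∫⁻ z, f (act u.1 z) = ∫⁻ z, f z := by
  have h1 : ‖u.1.det‖ = 1 := by
    have := Matrix.det_of_mem_unitary u.2
    exact CStarRing.norm_of_mem_unitary this
  have := lintegral_act (incl n u) f hf
  rw [incl_coe, h1] at this
  simpa using this

/-- Integrals of a density of degree `-2n` against weights of total logarithmic mass one along
every ray do not depend on the weight. -/
theorem lintegral_weight_eq (ψ h h' : Cn n → ℝ≥0∞) (hψ : Measurable ψ) (hh : Measurable h)
    (hh' : Measurable h')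
    (hom : ∀ (c : ℝ), 0 < c → ∀ z, ψ ((c : ℂ) • z) = (ENNReal.ofReal ((c ^ n) ^ 2))⁻¹ * ψ z)
    (h0 : ψ 0 = 0)
    (H : ∀ z, z ≠ 0 → ∫⁻ s : ℝ, h (((Real.exp s : ℝ) : ℂ) • z) = 1)
    (H' : ∀ z, z ≠ 0 → ∫⁻ s : ℝ, h' (((Real.exp s : ℝ) : ℂ) • z) = 1) :
    ∫⁻ z, ψ z * h z = ∫⁻ z, ψ z * h' z := by
  have hsm : Measurable fun q : ℝ × Cn n => ((Real.exp q.1 : ℝ) : ℂ) • q.2 := by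
    apply Continuous.measurable; fun_prop
  have hsm' : Measurable fun q : ℝ × Cn n => ((Real.exp (-q.1) : ℝ) : ℂ) • q.2 := by
    apply Continuous.measurable; fun_prop
  have hsz : ∀ z : Cn n, Measurable fun s : ℝ => ((Real.exp s : ℝ) : ℂ) • z := by
    intro z; apply Continuous.measurable; fun_prop
  have hzs : ∀ s : ℝ, Measurable fun z : Cn n => ((Real.exp s : ℝ) : ℂ) • z := by
    intro z; apply Continuous.measurable; fun_prop
  calc ∫⁻ z, ψ z * h z
      = ∫⁻ z, ∫⁻ s : ℝ, ψ z * h z * h' (((Real.exp s : ℝ) : ℂ) • z) := by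
        refine lintegral_congr fun z => ?_
        have hm' : Measurable fun s : ℝ => h' (((Real.exp s : ℝ) : ℂ) • z) := hh'.comp (hsz z)
        rw [lintegral_const_mul _ hm']
        by_cases hz : z = 0
        · simp [hz, h0]
        · rw [H' z hz, mul_one]
    _ = ∫⁻ s : ℝ, ∫⁻ z, ψ z * h z * h' (((Real.exp s : ℝ) : ℂ) • z) := by
        refine lintegral_lintegral_swap (f := fun z s => ψ z * h z * h' (((Real.exp s : ℝ) : ℂ) • z)) ?_
        refine Measurable.aemeasurable ?_
        exact ((hψ.comp measurable_fst).mul (hh.comp measurable_fst)).mul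
          (hh'.comp (hsm.comp measurable_swap))
    _ = ∫⁻ s : ℝ, ∫⁻ z, ψ z * h (((Real.exp (-s) : ℝ) : ℂ) • z) * h' z := by
        refine lintegral_congr fun s => ?_
        have hpos : 0 < ((Real.exp s ^ n) ^ 2) := by positivity
        have key := lintegral_smul (Real.exp_pos s)
          (fun z => ψ z * h (((Real.exp (-s) : ℝ) : ℂ) • z) * h' z)
          ((hψ.mul (hh.comp (hzs _))).mul hh')
        have e1 : ∀ z : Cn n, ((Real.exp (-s) : ℝ) : ℂ) • ((Real.exp s : ℝ) : ℂ) • z = z := by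
          intro z
          rw [smul_smul, ← Complex.ofReal_mul, ← Real.exp_add]
          simp
        simp only [e1, hom _ (Real.exp_pos s), mul_assoc] at key
        have hm' : Measurable fun z : Cn n => ψ z * (h z * h' (((Real.exp s : ℝ) : ℂ) • z)) :=
          hψ.mul (hh.mul (hh'.comp (hzs _)))
        rw [lintegral_const_mul _ hm'] at key
        have hne : (ENNReal.ofReal ((Real.exp s ^ n) ^ 2))⁻¹ ≠ 0 := by simp
        have hne' : (ENNReal.ofReal ((Real.exp s ^ n) ^ 2))⁻¹ ≠ ⊤ := by
          simp
        have := (ENNReal.mul_right_inj hne hne').mp key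
        simpa only [mul_assoc] using this
    _ = ∫⁻ z, ∫⁻ s : ℝ, ψ z * h (((Real.exp (-s) : ℝ) : ℂ) • z) * h' z := by
        refine (lintegral_lintegral_swap
          (f := fun z s => ψ z * h (((Real.exp (-s) : ℝ) : ℂ) • z) * h' z) ?_).symm
        refine Measurable.aemeasurable ?_
        exact ((hψ.comp measurable_fst).mul
          (hh.comp (hsm'.comp measurable_swap))).mul (hh'.comp measurable_fst)
    _ = ∫⁻ z, ψ z * h' z := by
        refine lintegral_congr fun z => ?_
        have hm : Measurable fun s : ℝ => h (((Real.exp s : ℝ) : ℂ) • z) := hh.comp (hsz z)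
        have h2 : ∫⁻ s : ℝ, h (((Real.exp (-s) : ℝ) : ℂ) • z)
            = ∫⁻ s : ℝ, h (((Real.exp s : ℝ) : ℂ) • z) :=
          lintegral_neg_eq_self (fun s : ℝ => h (((Real.exp s : ℝ) : ℂ) • z))
        have hm' : Measurable fun s : ℝ => h (((Real.exp (-s) : ℝ) : ℂ) • z) :=
          hm.comp measurable_neg
        rw [lintegral_mul_const _ (hm'.const_mul _), lintegral_const_mul _ hm', h2]
        by_cases hz : z = 0
        · simp [hz, h0]
        · rw [H z hz, mul_one]

/-- The indicator function of the annulus `1 ≤ ‖z‖ ≤ e`. -/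
def annulus (n : ℕ) : Cn n → ℝ≥0∞ :=
  Set.indicator {z | 1 ≤ ‖z‖ ∧ ‖z‖ ≤ Real.exp 1} 1

theorem measurableSet_annulus : MeasurableSet {z : Cn n | 1 ≤ ‖z‖ ∧ ‖z‖ ≤ Real.exp 1} :=
  (measurableSet_le measurable_const measurable_norm).inter
    (measurableSet_le measurable_norm measurable_const)

theorem measurable_annulus : Measurable (annulus n) :=
  measurable_one.indicator measurableSet_annulus

theorem annulus_of_mem {z : Cn n} (h1 : 1 ≤ ‖z‖) (h2 : ‖z‖ ≤ Real.exp 1) : annulus n z = 1 :=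
  Set.indicator_of_mem (s := {z : Cn n | 1 ≤ ‖z‖ ∧ ‖z‖ ≤ Real.exp 1}) ⟨h1, h2⟩ 1

theorem annulus_of_notMem {z : Cn n} (h : ¬ (1 ≤ ‖z‖ ∧ ‖z‖ ≤ Real.exp 1)) : annulus n z = 0 :=
  Set.indicator_of_notMem (s := {z : Cn n | 1 ≤ ‖z‖ ∧ ‖z‖ ≤ Real.exp 1}) h 1

theorem annulus_congr {z w : Cn n} (h : ‖z‖ = ‖w‖) : annulus n z = annulus n w := by
  by_cases hz : 1 ≤ ‖z‖ ∧ ‖z‖ ≤ Real.exp 1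
  · rw [annulus_of_mem hz.1 hz.2, annulus_of_mem (h ▸ hz.1) (h ▸ hz.2)]
  · rw [annulus_of_notMem hz, annulus_of_notMem (h ▸ hz)]

theorem annulus_mass (z : Cn n) (hz : z ≠ 0) :
    ∫⁻ s : ℝ, annulus n (((Real.exp s : ℝ) : ℂ) • z) = 1 := by
  have hz' : 0 < ‖z‖ := norm_pos_iff.mpr hz
  have h1 : (fun s : ℝ => annulus n (((Real.exp s : ℝ) : ℂ) • z)) =
      Set.indicator (Set.Icc (-Real.log ‖z‖) (1 - Real.log ‖z‖)) 1 := by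
    funext s
    have h2 : ‖((Real.exp s : ℝ) : ℂ) • z‖ = Real.exp (s + Real.log ‖z‖) := by
      rw [norm_smul, Complex.norm_real, Real.exp_add, Real.exp_log hz']
      simp
    have h3 : (((Real.exp s : ℝ) : ℂ) • z ∈ {z : Cn n | 1 ≤ ‖z‖ ∧ ‖z‖ ≤ Real.exp 1}) ↔
        s ∈ Set.Icc (-Real.log ‖z‖) (1 - Real.log ‖z‖) := by
      simp only [Set.mem_ofPred_eq, h2, Real.exp_le_exp, Real.one_le_exp_iff, Set.mem_Icc]
      constructor <;> rintro ⟨_, _⟩ <;> constructor <;> linarith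
    by_cases h4 : s ∈ Set.Icc (-Real.log ‖z‖) (1 - Real.log ‖z‖)
    · rw [annulus, Set.indicator_of_mem (h3.mpr h4), Set.indicator_of_mem h4]; rfl
    · rw [annulus, Set.indicator_of_notMem (fun h => h4 (h3.mp h)), Set.indicator_of_notMem h4]
  rw [h1, lintegral_indicator_one measurableSet_Icc, Real.volume_Icc]
  simp

end ChangeOfVariables

section Mass

variable {n : ℕ}

variable (n) in
/-- The total mass of the standard density, an auxiliary constant. -/
def massConst : ℝ≥0∞ := ∫⁻ z : Cn n, annulus n z * (ENNReal.ofReal ((‖z‖ ^ n) ^ 2))⁻¹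

theorem measurable_weight :
    Measurable fun z : Cn n => annulus n z * (ENNReal.ofReal ((‖z‖ ^ n) ^ 2))⁻¹ :=
  measurable_annulus.mul (by fun_prop)

theorem massConst_ne_top : massConst n ≠ ⊤ := by
    rw [massConst]
    refine ne_top_of_le_ne_top (b := ∫⁻ z : Cn n, annulus n z) ?_ (lintegral_mono fun z => ?_)
    · unfold annulus
      rw [lintegral_indicator_one measurableSet_annulus]
      refine ((measure_mono (fun z hz => ?_)).trans_lt
        (measure_closedBall_lt_top (x := (0 : Cn n)) (r := Real.exp 1))).ne
      simpa using hz.2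
    · by_cases hz : z ∈ {z : Cn n | 1 ≤ ‖z‖ ∧ ‖z‖ ≤ Real.exp 1}
      · refine (mul_le_mul' le_rfl ?_).trans_eq (mul_one _)
        rw [ENNReal.inv_le_one]
        rw [← ENNReal.ofReal_one]
        exact ENNReal.ofReal_le_ofReal (one_le_pow₀ (one_le_pow₀ hz.1))
      · have : annulus n z = 0 := Set.indicator_of_notMem hz 1
        simp [this]

theorem measurable_act (A : Matrix (Fin n) (Fin n) ℂ) : Measurable (act A) :=
  (act A).continuous.measurable

theorem measurable_act_act (g : G n) :
    Measurable fun q : K n × Cn n => act g.1 (act q.1.1 q.2) := by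
  have : Continuous fun q : K n × Cn n => act q.1.1 q.2 := by
    have h : Continuous fun q : K n × Cn n => q.1.1 *ᵥ (q.2 : Fin n → ℂ) :=
      Continuous.matrix_mulVec (continuous_subtype_val.comp continuous_fst)
        ((PiLp.continuous_ofLp 2 _).comp continuous_snd)
    exact (PiLp.continuous_toLp 2 _).comp h
  exact ((act g.1).continuous.comp this).measurable

end Mass

section Invariance

variable {n : ℕ} [NeZero n] {lam : ℝ} {k : ℤ}

theorem exists_act_eq {z : Cn n} (hz : z ≠ 0) : ∃ g : G n, act g.1 (e0 n) = z := by
  obtain ⟨u, hu⟩ := exists_unitary (w := ((‖z‖⁻¹ : ℝ) : ℂ) • z) (by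
    rw [norm_smul]; simp [hz])
  have hd : ((‖z‖ : ℂ) • (1 : Matrix (Fin n) (Fin n) ℂ)).det ≠ 0 := by simp [hz]
  refine ⟨Matrix.GeneralLinearGroup.mkOfDetNeZero _ hd * incl n u, ?_⟩
  rw [Units.val_mul, act_mul, incl_coe, hu]
  change act ((‖z‖ : ℂ) • (1 : Matrix (Fin n) (Fin n) ℂ)) _ = z
  rw [act_smul_one, smul_smul]
  simp [hz]

theorem act_e0_ne_zero (g : G n) : act g.1 (e0 n) ≠ 0 := by
  intro h
  have : act (g⁻¹ * g : G n).1 (e0 n) = 0 := by rw [Units.val_mul, act_mul, h, map_zero]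
  rw [inv_mul_cancel, Units.val_one, act_one] at this
  have h2 := norm_e0 (n := n)
  rw [this] at h2
  simp at h2

open Classical in
/-- The density of degree `-2n` on `ℂⁿ` that belongs to `|F|²`. -/
def density (F : G n → ℂ) (z : Cn n) : ℝ :=
  if h : ∃ g : G n, act g.1 (e0 n) = z then (‖F h.choose‖ / ‖h.choose.1.det‖) ^ 2 else 0

theorem density_zero (F : G n → ℂ) : density F 0 = 0 := by
  rw [density, dif_neg]
  rintro ⟨g, hg⟩
  exact act_e0_ne_zero g hg

theorem density_act (F : inducedSections n (Complex.I * lam) k) (g : G n) :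
    density F.1 (act g.1 (e0 n)) = (‖F.1 g‖ / ‖g.1.det‖) ^ 2 := by
  have h : ∃ g' : G n, act g'.1 (e0 n) = act g.1 (e0 n) := ⟨g, rfl⟩
  rw [density, dif_pos h, norm_section F (c := 1) (g := g) (by rw [h.choose_spec, one_smul])]
  simp

theorem density_smul (F : inducedSections n (Complex.I * lam) k) {c : ℂ} (hc : c ≠ 0) (z : Cn n) :
    density F.1 (c • z) = ((‖c‖ ^ n) ^ 2)⁻¹ * density F.1 z := by
  by_cases hz : z = 0
  · simp [hz, density_zero]
  · obtain ⟨g, rfl⟩ := exists_act_eq hz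
    obtain ⟨g', hg'⟩ := exists_act_eq (smul_ne_zero hc hz)
    rw [density_act, ← hg', density_act, norm_section F hg', mul_pow, inv_pow]

theorem continuousAt_density (F : inducedSections n (Complex.I * lam) k) {z : Cn n} (hz : z ≠ 0) :
    ContinuousAt (density F.1) z := by
  classical
  obtain ⟨g, rfl⟩ := exists_act_eq hz
  let _ : NormedRing (Matrix (Fin n) (Fin n) ℂ) := Matrix.instL2OpNormedRing
  let _ : NormedAlgebra ℂ (Matrix (Fin n) (Fin n) ℂ) := Matrix.instL2OpNormedAlgebra
  have : CompleteSpace (Matrix (Fin n) (Fin n) ℂ) := FiniteDimensional.complete ℂ _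
  -- extend `F` to all matrices
  let F' : Matrix (Fin n) (Fin n) ℂ → ℂ := fun A =>
    if h : A.det ≠ 0 then F.1 (Matrix.GeneralLinearGroup.mkOfDetNeZero A h) else 0
  have hF' : ∀ g : G n, F' g.1 = F.1 g := by
    intro g
    simp only [F']
    rw [dif_pos (det_ne_zero g)]
    exact congrArg F.1 (Units.ext rfl)
  have hcF' : ContinuousAt F' g.1 := by
    have h1 := (Units.isOpenEmbedding_val (R := Matrix (Fin n) (Fin n) ℂ)).continuousAt_iff
      (g := F') (x := g)
    refine h1.mp ?_
    have : F' ∘ (Units.val : G n → _) = F.1 := funext hF'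
    rw [this]
    exact F.2.1.continuousAt
  let S : Cn n → Matrix (Fin n) (Fin n) ℂ := fun z =>
    g.1 * Matrix.updateCol 1 0 (act (g⁻¹ : G n).1 z)
  have hS0 : S (act g.1 (e0 n)) = g.1 := by
    simp only [S]
    rw [← act_mul, ← Units.val_mul, inv_mul_cancel, Units.val_one, act_one]
    have : Matrix.updateCol (1 : Matrix (Fin n) (Fin n) ℂ) 0 (e0 n) = 1 := by
      ext i j
      by_cases hj : j = 0
      · subst hj
        simp [e0, Matrix.one_apply, Pi.single_apply]
      · simp [hj]
    rw [this, mul_one]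
  have hSc : Continuous S := by
    refine continuous_const.mul (Continuous.matrix_updateCol 0 continuous_const ?_)
    exact (PiLp.continuous_ofLp 2 _).comp (act _).continuous
  have hSe : ∀ z, act (S z) (e0 n) = z := by
    intro z
    simp only [S]
    rw [act_mul]
    have : act (Matrix.updateCol (1 : Matrix (Fin n) (Fin n) ℂ) 0 (act (g⁻¹ : G n).1 z)) (e0 n)
        = act (g⁻¹ : G n).1 z := by
      ext i
      rw [act_e0]
      simp
    rw [this, ← act_mul, ← Units.val_mul, mul_inv_cancel, Units.val_one, act_one]
  have hdet : ContinuousAt (fun z => (S z).det) (act g.1 (e0 n)) :=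
    hSc.matrix_det.continuousAt
  have hdet0 : (S (act g.1 (e0 n))).det ≠ 0 := by rw [hS0]; exact det_ne_zero g
  have hev : (fun z => (‖F' (S z)‖ / ‖(S z).det‖) ^ 2) =ᶠ[nhds (act g.1 (e0 n))] density F.1 := by
    filter_upwards [hdet.eventually_ne hdet0] with z hz'
    have h2 := density_act F (Matrix.GeneralLinearGroup.mkOfDetNeZero (S z) hz')
    have h3 := hF' (Matrix.GeneralLinearGroup.mkOfDetNeZero (S z) hz')
    have h4 : (Matrix.GeneralLinearGroup.mkOfDetNeZero (S z) hz').1 = S z := rfl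
    rw [h4] at h2 h3
    rw [hSe] at h2
    rw [h2, h3]
  refine ContinuousAt.congr ?_ hev
  refine ContinuousAt.pow (ContinuousAt.div ?_ hdet.norm (norm_ne_zero_iff.mpr hdet0)) 2
  refine ContinuousAt.norm ?_
  refine ContinuousAt.comp (g := F') ?_ hSc.continuousAt
  rw [hS0]
  exact hcF'

theorem measurable_density (F : inducedSections n (Complex.I * lam) k) :
    Measurable (density F.1) := by
  refine measurable_of_continuousOn_compl_singleton 0 ?_
  intro z hz
  exact (continuousAt_density F hz).continuousWithinAt

theorem massConst_ne_zero : massConst n ≠ 0 := by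
    rw [massConst]
    intro h
    rw [lintegral_eq_zero_iff measurable_weight] at h
    have hopen : IsOpen {z : Cn n | 1 < ‖z‖ ∧ ‖z‖ < Real.exp 1} :=
      (isOpen_lt continuous_const continuous_norm).inter
        (isOpen_lt continuous_norm continuous_const)
    have hne : {z : Cn n | 1 < ‖z‖ ∧ ‖z‖ < Real.exp 1}.Nonempty := by
      refine ⟨((Real.exp (1 / 2) : ℝ) : ℂ) • e0 n, ?_⟩
      have : ‖((Real.exp (1 / 2) : ℝ) : ℂ) • e0 n‖ = Real.exp (1 / 2) := by
        rw [norm_smul, norm_e0, Complex.norm_real]; simp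
      constructor
      · rw [this]; exact Real.one_lt_exp_iff.mpr (by norm_num)
      · rw [this]; exact Real.exp_lt_exp.mpr (by norm_num)
    refine (hopen.measure_pos volume hne).ne' (measure_mono_null ?_ h)
    rintro z ⟨h1, h2⟩
    simp [annulus_of_mem h1.le h2.le]


/-- The density as a function with values in `[0, ∞]`. -/
def edensity (F : G n → ℂ) (z : Cn n) : ℝ≥0∞ := ENNReal.ofReal (density F z)

theorem edensity_zero (F : G n → ℂ) : edensity F 0 = 0 := by simp [edensity, density_zero]

theorem measurable_edensity (F : inducedSections n (Complex.I * lam) k) :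
    Measurable (edensity F.1) := (measurable_density F).ennreal_ofReal

theorem edensity_smul (F : inducedSections n (Complex.I * lam) k) (c : ℝ) (hc : 0 < c) (z : Cn n) :
    edensity F.1 ((c : ℂ) • z) = (ENNReal.ofReal ((c ^ n) ^ 2))⁻¹ * edensity F.1 z := by
  have : (0 : ℝ) < (c ^ n) ^ 2 := by positivity
  rw [edensity, edensity, density_smul F (by exact_mod_cast hc.ne'),
    ENNReal.ofReal_mul (by positivity),
    Complex.norm_real, Real.norm_eq_abs, abs_of_pos hc, ENNReal.ofReal_inv_of_pos this]

theorem first_evaluation (F : inducedSections n (Complex.I * lam) k) (g : G n) :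
    ∫⁻ z, edensity F.1 (act g.1 z) * annulus n z =
      (ENNReal.ofReal (‖g.1.det‖ ^ 2))⁻¹ * ∫⁻ z, edensity F.1 z * annulus n z := by
  have h1 := lintegral_act g (fun z => edensity F.1 z * annulus n (act (g⁻¹ : G n).1 z))
    ((measurable_edensity F).mul (measurable_annulus.comp (measurable_act _)))
  have e1 : ∀ z : Cn n, act (g⁻¹ : G n).1 (act g.1 z) = z := by
    intro z
    rw [← act_mul, ← Units.val_mul, inv_mul_cancel, Units.val_one, act_one]
  have e2 : ∀ z : Cn n, act g.1 (act (g⁻¹ : G n).1 z) = z := by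
    intro z
    rw [← act_mul, ← Units.val_mul, mul_inv_cancel, Units.val_one, act_one]
  simp only [e1] at h1
  rw [h1]
  congr 1
  refine lintegral_weight_eq (edensity F.1) _ _ (measurable_edensity F)
    (measurable_annulus.comp (measurable_act _)) measurable_annulus
    (edensity_smul F) (edensity_zero F.1) ?_ annulus_mass
  intro z hz
  have : act (g⁻¹ : G n).1 z ≠ 0 := by
    intro h
    apply hz
    rw [← e2 z, h, map_zero]
  simp only [map_smul]
  exact annulus_mass _ this

theorem measurable_orbit (F : inducedSections n (Complex.I * lam) k) (g : G n) (z : Cn n) :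
    Measurable fun u : K n => edensity F.1 (act g.1 (act u.1 z)) := by
  have h : Measurable fun u : K n => (u, z) := measurable_id.prodMk measurable_const
  have h2 := (measurable_act_act g).comp h
  exact (measurable_edensity F).comp h2

theorem orbit_evaluation (F : inducedSections n (Complex.I * lam) k) (g : G n) {z : Cn n}
    (hz : z ≠ 0) :
    ∫⁻ u, edensity F.1 (act g.1 (act u.1 z)) ∂(haarK n) = (ENNReal.ofReal ((‖z‖ ^ n) ^ 2))⁻¹ *
      ∫⁻ u, edensity F.1 (act g.1 (act u.1 (e0 n))) ∂(haarK n) := by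
  have hz' : 0 < ‖z‖ := norm_pos_iff.mpr hz
  obtain ⟨v, hv⟩ := exists_unitary (w := ((‖z‖⁻¹ : ℝ) : ℂ) • z) (by
    rw [norm_smul]; simp [hz])
  have hzv : z = (‖z‖ : ℂ) • act v.1 (e0 n) := by
    rw [hv, smul_smul]; simp [hz]
  have hm1 := measurable_orbit F g (e0 n)
  have hm2 : Measurable fun u : K n => edensity F.1 (act g.1 (act (u * v).1 (e0 n))) :=
    hm1.comp (measurable_mul_const v)
  calc ∫⁻ u, edensity F.1 (act g.1 (act u.1 z)) ∂(haarK n)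
      = ∫⁻ u, (ENNReal.ofReal ((‖z‖ ^ n) ^ 2))⁻¹ *
          edensity F.1 (act g.1 (act (u * v).1 (e0 n))) ∂(haarK n) := by
        refine lintegral_congr fun u => ?_
        have h1 : act g.1 (act u.1 z) = (‖z‖ : ℂ) • act g.1 (act (u * v).1 (e0 n)) := by
          conv_lhs => rw [hzv]
          rw [map_smul, map_smul, ← act_mul u.1 v.1]
          rfl
        rw [h1, edensity_smul F _ hz']
    _ = (ENNReal.ofReal ((‖z‖ ^ n) ^ 2))⁻¹ *
          ∫⁻ u, edensity F.1 (act g.1 (act (u * v).1 (e0 n))) ∂(haarK n) :=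
        lintegral_const_mul _ hm2
    _ = _ := by
        rw [lintegral_mul_right_eq_self
          (fun u : K n => edensity F.1 (act g.1 (act u.1 (e0 n)))) v]

theorem sphere_evaluation (F : inducedSections n (Complex.I * lam) k) (g : G n) :
    ∫⁻ u, edensity F.1 (act g.1 (act u.1 (e0 n))) ∂(haarK n) =
      (ENNReal.ofReal (‖g.1.det‖ ^ 2))⁻¹ *
        ∫⁻ u, ENNReal.ofReal (‖F.1 (g * incl n u)‖ ^ 2) ∂(haarK n) := by
  have hd : 0 < ‖g.1.det‖ ^ 2 := by
    have := norm_pos_iff.mpr (det_ne_zero g)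
    positivity
  rw [← lintegral_const_mul' _ _ (by simpa using det_ne_zero g)]
  refine lintegral_congr fun u => ?_
  have h1 : ‖u.1.det‖ = 1 := CStarRing.norm_of_mem_unitary (Matrix.det_of_mem_unitary u.2)
  have h2 := density_act F (g * incl n u)
  rw [Units.val_mul, act_mul, incl_coe, Matrix.det_mul, norm_mul, h1, mul_one, div_pow] at h2
  rw [edensity, h2, div_eq_inv_mul, ENNReal.ofReal_mul (by positivity),
    ENNReal.ofReal_inv_of_pos hd]

theorem second_evaluation (F : inducedSections n (Complex.I * lam) k) (g : G n) :
    ∫⁻ z, edensity F.1 (act g.1 z) * annulus n z =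
      massConst n * ((ENNReal.ofReal (‖g.1.det‖ ^ 2))⁻¹ *
        ∫⁻ u, ENNReal.ofReal (‖F.1 (g * incl n u)‖ ^ 2) ∂(haarK n)) := by
  have s1 : ∀ u : K n, ∫⁻ z, edensity F.1 (act g.1 (act u.1 z)) * annulus n z =
      ∫⁻ z, edensity F.1 (act g.1 z) * annulus n z := by
    intro u
    have := lintegral_unitary u (fun z => edensity F.1 (act g.1 z) * annulus n z)
      (((measurable_edensity F).comp (measurable_act _)).mul measurable_annulus)
    simpa only [fun z => annulus_congr (norm_act_unitary u z)] using this
  calc ∫⁻ z, edensity F.1 (act g.1 z) * annulus n z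
      = ∫⁻ _u : K n, ∫⁻ z, edensity F.1 (act g.1 z) * annulus n z
          ∂(volume : Measure (Cn n)) ∂(haarK n) := by
        rw [lintegral_const, measure_univ, mul_one]
    _ = ∫⁻ u : K n, (∫⁻ z : Cn n, edensity F.1 (act g.1 (act u.1 z)) * annulus n z)
          ∂(haarK n) := by
        simp only [s1]
    _ = ∫⁻ z : Cn n, (∫⁻ u : K n, edensity F.1 (act g.1 (act u.1 z)) * annulus n z ∂(haarK n)) := by
        refine lintegral_lintegral_swap
          (f := fun (u : K n) (z : Cn n) => edensity F.1 (act g.1 (act u.1 z)) * annulus n z) ?_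
        exact (((measurable_edensity F).comp (measurable_act_act g)).mul
          (measurable_annulus.comp measurable_snd)).aemeasurable
    _ = ∫⁻ z, annulus n z * (ENNReal.ofReal ((‖z‖ ^ n) ^ 2))⁻¹ *
          ∫⁻ u, edensity F.1 (act g.1 (act u.1 (e0 n))) ∂(haarK n) := by
        refine lintegral_congr fun z => ?_
        have hm1 := measurable_orbit F g z
        rw [lintegral_mul_const _ hm1]
        by_cases hz : z = 0
        · have : annulus n z = 0 := by
            refine annulus_of_notMem ?_
            simp [hz]
          simp [this]
        · rw [orbit_evaluation F g hz]; ring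
    _ = massConst n * ∫⁻ u, edensity F.1 (act g.1 (act u.1 (e0 n))) ∂(haarK n) := by
        rw [lintegral_mul_const _ measurable_weight, massConst]
    _ = _ := by rw [sphere_evaluation F g]

/-- The `L²` norm over `U(n)` of an element of the induced representation is invariant under left
translation by `GL(n,ℂ)`. -/
theorem lintegral_translate (F : inducedSections n (Complex.I * lam) k) (g : G n) :
    ∫⁻ u, ENNReal.ofReal (‖F.1 (g * incl n u)‖ ^ 2) ∂(haarK n) =
      ∫⁻ u, ENNReal.ofReal (‖F.1 (incl n u)‖ ^ 2) ∂(haarK n) := by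
  have key : ∀ g : G n, massConst n * ∫⁻ u, ENNReal.ofReal (‖F.1 (g * incl n u)‖ ^ 2) ∂(haarK n)
      = ∫⁻ z, edensity F.1 z * annulus n z := by
    intro g
    have h := (second_evaluation F g).symm.trans (first_evaluation F g)
    rw [mul_left_comm] at h
    exact (ENNReal.mul_right_inj (by simp) (by simpa using det_ne_zero g)).mp h
  have h1 := (key g).trans (key 1).symm
  simpa using (ENNReal.mul_right_inj massConst_ne_zero massConst_ne_top).mp h1

end Invariance

section UnitaryPrincipalSeries

/-- The pre-Hilbert space of continuous sections that underlies `π_{iλ,k}`; the norm is the `L²` norm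
over the maximal compact subgroup `U(n)`, which is invariant under left translation by `GL(n,ℂ)`. -/
def Sections (n : ℕ) [NeZero n] (lam : ℝ) (k : ℤ) : Type :=
  inducedSections n (Complex.I * lam) k

variable {n : ℕ} [NeZero n] {lam : ℝ} {k : ℤ}

instance : AddCommGroup (Sections n lam k) :=
  inferInstanceAs (AddCommGroup (inducedSections n (Complex.I * lam) k))

instance : Module ℂ (Sections n lam k) :=
  inferInstanceAs (Module ℂ (inducedSections n (Complex.I * lam) k))

/-- The underlying section of the line bundle. -/
def Sections.toSection (F : Sections n lam k) : inducedSections n (Complex.I * lam) k := F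

instance : CoeFun (Sections n lam k) (fun _ => G n → ℂ) := ⟨fun F => F.toSection.1⟩

theorem Sections.ext {F₁ F₂ : Sections n lam k} (h : ∀ g, F₁ g = F₂ g) : F₁ = F₂ :=
  Subtype.ext (funext h)

theorem Sections.continuous (F : Sections n lam k) : Continuous F.toSection.1 := F.toSection.2.1

theorem Sections.map_mul (F : Sections n lam k) (g : G n) (p : parabolic n) :
    F (g * p.1) = (chi (Complex.I * lam) k p)⁻¹ * (rhoChar p : ℂ)⁻¹ * F g := F.toSection.2.2 g p

theorem continuous_section (F : Sections n lam k) : Continuous fun u : K n => F (incl n u) :=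
  F.continuous.comp (continuous_incl n)

theorem integrable_inner (F₁ F₂ : Sections n lam k) :
    Integrable (fun u : K n => conj (F₁ (incl n u)) * F₂ (incl n u)) (haarK n) :=
  (Continuous.mul (Complex.continuous_conj.comp (continuous_section F₁))
    (continuous_section F₂)).integrable_of_hasCompactSupport
      (HasCompactSupport.of_compactSpace _)

/-- The inner product `⟨F₁, F₂⟩ = ∫_{U(n)} conj (F₁ u) F₂ u du` on sections. -/
instance sectionsCore : InnerProductSpace.Core ℂ (Sections n lam k) where
  inner F₁ F₂ := ∫ u, conj (F₁ (incl n u)) * F₂ (incl n u) ∂(haarK n)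
  conj_inner_symm F₁ F₂ := by
    rw [← integral_conj]
    refine integral_congr_ae (Filter.Eventually.of_forall fun u => ?_)
    simp [mul_comm]
  re_inner_nonneg F := by
    have h : ∀ u, conj (F (incl n u)) * F (incl n u) = ((‖F (incl n u)‖ ^ 2 : ℝ) : ℂ) := by
      intro u
      rw [Complex.conj_mul', Complex.ofReal_pow]
    simp only [h]
    rw [integral_complex_ofReal]
    exact integral_nonneg fun u => by positivity
  add_left F₁ F₂ F₃ := by
    rw [← integral_add (integrable_inner F₁ F₃) (integrable_inner F₂ F₃)]
    refine integral_congr_ae (Filter.Eventually.of_forall fun u => ?_)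
    change conj (F₁ (incl n u) + F₂ (incl n u)) * F₃ (incl n u) = _
    rw [map_add, add_mul]
  smul_left F₁ F₂ c := by
    rw [← integral_const_mul]
    refine integral_congr_ae (Filter.Eventually.of_forall fun u => ?_)
    change conj (c * F₁ (incl n u)) * F₂ (incl n u) = _
    rw [map_mul, mul_assoc]
  definite F hF := by
    have h : ∀ u, conj (F (incl n u)) * F (incl n u) = ((‖F (incl n u)‖ ^ 2 : ℝ) : ℂ) := by
      intro u
      rw [Complex.conj_mul', Complex.ofReal_pow]
    simp only [h] at hF
    rw [integral_complex_ofReal, Complex.ofReal_eq_zero] at hF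
    have hc : Continuous fun u : K n => ‖F (incl n u)‖ ^ 2 := (continuous_section F).norm.pow 2
    have h0 : ∀ u : K n, F (incl n u) = 0 := by
      intro u
      have h1 := (hc.integral_pos_of_hasCompactSupport_nonneg_nonzero (μ := haarK n) (x := u)
        (HasCompactSupport.of_compactSpace _) (fun u => by positivity)).mt hF.not_gt
      simpa using h1
    refine Sections.ext fun g => ?_
    obtain ⟨u, p, rfl⟩ := exists_unitary_mul_parabolic g
    rw [F.map_mul, h0 u, mul_zero]
    rfl

instance : NormedAddCommGroup (Sections n lam k) :=
  InnerProductSpace.Core.toNormedAddCommGroup (𝕜 := ℂ)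

instance : InnerProductSpace ℂ (Sections n lam k) :=
  InnerProductSpace.ofCore sectionsCore.toCore

theorem inner_sections (F₁ F₂ : Sections n lam k) :
    inner ℂ F₁ F₂ = ∫ u, conj (F₁ (incl n u)) * F₂ (incl n u) ∂(haarK n) := rfl

theorem norm_sq_sections (F : Sections n lam k) :
    ‖F‖ ^ 2 = ∫ u, ‖F (incl n u)‖ ^ 2 ∂(haarK n) := by
  have h : ∀ u, conj (F (incl n u)) * F (incl n u) = ((‖F (incl n u)‖ ^ 2 : ℝ) : ℂ) := by
    intro u
    rw [Complex.conj_mul', Complex.ofReal_pow]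
  rw [← inner_self_eq_norm_sq (𝕜 := ℂ), inner_sections]
  simp only [h]
  rw [integral_complex_ofReal]
  rfl

/-- Left translation `(g F)(x) = F(g⁻¹ x)` of sections. -/
def translate (g : G n) : Sections n lam k →ₗ[ℂ] Sections n lam k where
  toFun F := (⟨fun x => F (g⁻¹ * x), F.continuous.comp (continuous_const.mul continuous_id),
    fun x p => by simp only [← mul_assoc, F.map_mul]⟩ : inducedSections n (Complex.I * lam) k)
  map_add' _ _ := rfl
  map_smul' _ _ := rfl

theorem translate_apply (g : G n) (F : Sections n lam k) (x : G n) :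
    translate g F x = F (g⁻¹ * x) := rfl

theorem norm_translate (g : G n) (F : Sections n lam k) : ‖translate g F‖ = ‖F‖ := by
  have h := lintegral_translate F.toSection g⁻¹
  have h2 : ‖translate g F‖ ^ 2 = ‖F‖ ^ 2 := by
    rw [norm_sq_sections, norm_sq_sections,
      integral_eq_lintegral_of_nonneg_ae (Filter.Eventually.of_forall fun u => sq_nonneg _)
        (((continuous_section (translate g F)).norm.pow 2).aestronglyMeasurable),
      integral_eq_lintegral_of_nonneg_ae (Filter.Eventually.of_forall fun u => sq_nonneg _)
        (((continuous_section F).norm.pow 2).aestronglyMeasurable)]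
    exact congrArg ENNReal.toReal h
  exact (pow_left_inj₀ (norm_nonneg _) (norm_nonneg _) two_ne_zero).mp h2

theorem translate_mul (g h : G n) (F : Sections n lam k) :
    translate (g * h) F = translate g (translate h F) := by
  refine Sections.ext fun x => ?_
  simp only [translate_apply]
  rw [_root_.mul_inv_rev, mul_assoc]

theorem translate_one (F : Sections n lam k) : translate 1 F = F := by
  refine Sections.ext fun x => ?_
  rw [translate_apply, inv_one, one_mul]

/-- The Hilbert space of the unitary principal series representation `π_{iλ,k}`, the completion of
the space of continuous sections. -/
abbrev PrincipalSeriesSpace (n : ℕ) [NeZero n] (lam : ℝ) (k : ℤ) : Type :=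
  UniformSpace.Completion (Sections n lam k)

theorem isometry_translate (g : G n) : Isometry (translate (lam := lam) (k := k) g) :=
  AddMonoidHomClass.isometry_of_norm _ (norm_translate g)

/-- The operator `π_{iλ,k}(g)` on the Hilbert space, the continuous extension of the left
translation by `g`. -/
def translateCompletion (g : G n) :
    PrincipalSeriesSpace n lam k → PrincipalSeriesSpace n lam k :=
  UniformSpace.Completion.map (translate g)

theorem translateCompletion_coe (g : G n) (F : Sections n lam k) :
    translateCompletion g (F : PrincipalSeriesSpace n lam k) =
      (translate g F : Sections n lam k) :=
  UniformSpace.Completion.map_coe (isometry_translate g).uniformContinuous F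

theorem continuous_translateCompletion (g : G n) :
    Continuous (translateCompletion (lam := lam) (k := k) g) :=
  UniformSpace.Completion.continuous_map

theorem translateCompletion_mul (g h : G n) (v : PrincipalSeriesSpace n lam k) :
    translateCompletion (g * h) v = translateCompletion g (translateCompletion h v) := by
  induction v using UniformSpace.Completion.induction_on with
  | hp =>
    exact isClosed_eq (continuous_translateCompletion _)
      ((continuous_translateCompletion _).comp (continuous_translateCompletion _))
  | ih F => simp only [translateCompletion_coe, translate_mul]

theorem translateCompletion_one (v : PrincipalSeriesSpace n lam k) :
    translateCompletion 1 v = v := by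
  induction v using UniformSpace.Completion.induction_on with
  | hp => exact isClosed_eq (continuous_translateCompletion _) continuous_id
  | ih F => simp only [translateCompletion_coe, translate_one]

/-- `π_{iλ,k}(g)` as a unitary operator. -/
def translateUnitary (g : G n) :
    PrincipalSeriesSpace n lam k ≃ₗᵢ[ℂ] PrincipalSeriesSpace n lam k where
  toFun := translateCompletion g
  invFun := translateCompletion g⁻¹
  left_inv v := by rw [← translateCompletion_mul, inv_mul_cancel, translateCompletion_one]
  right_inv v := by rw [← translateCompletion_mul, mul_inv_cancel, translateCompletion_one]
  map_add' v w := by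
    induction v, w using UniformSpace.Completion.induction_on₂ with
    | hp =>
      exact isClosed_eq ((continuous_translateCompletion _).comp continuous_add)
        (((continuous_translateCompletion _).comp continuous_fst).add
          ((continuous_translateCompletion _).comp continuous_snd))
    | ih F₁ F₂ =>
      rw [← UniformSpace.Completion.coe_add, translateCompletion_coe, translateCompletion_coe,
        translateCompletion_coe, map_add, UniformSpace.Completion.coe_add]
  map_smul' c v := by
    induction v using UniformSpace.Completion.induction_on with
    | hp =>
      exact isClosed_eq ((continuous_translateCompletion _).comp (continuous_const_smul c))
        ((continuous_translateCompletion _).const_smul c)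
    | ih F =>
      rw [← UniformSpace.Completion.coe_smul, translateCompletion_coe, translateCompletion_coe,
        map_smul, UniformSpace.Completion.coe_smul, RingHom.id_apply]
  norm_map' v := by
    change ‖translateCompletion g v‖ = ‖v‖
    induction v using UniformSpace.Completion.induction_on with
    | hp => exact isClosed_eq (continuous_translateCompletion _).norm continuous_norm
    | ih F => rw [translateCompletion_coe, UniformSpace.Completion.norm_coe, norm_translate,
        UniformSpace.Completion.norm_coe]

/-- The unitary principal series representation `π_{iλ,k} = Ind_P^G(χ_{iλ,k})` (normalized
parabolic induction) of `G = GL(n,ℂ)`. -/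
def principalSeries (n : ℕ) [NeZero n] (lam : ℝ) (k : ℤ) :
    G n →* (PrincipalSeriesSpace n lam k ≃ₗᵢ[ℂ] PrincipalSeriesSpace n lam k) where
  toFun g := translateUnitary g
  map_one' := by
    ext v
    exact translateCompletion_one v
  map_mul' g h := by
    ext v
    exact translateCompletion_mul g h v

/-- The restriction of `π_{iλ,k}` to `U(n)`, as a linear representation. -/
def principalSeriesRestrict (n : ℕ) [NeZero n] (lam : ℝ) (k : ℤ) :
    Representation ℂ (K n) (PrincipalSeriesSpace n lam k) where
  toFun u := (principalSeries n lam k (incl n u)).toLinearEquiv.toLinearMap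
  map_one' := by
    rw [map_one, map_one]
    rfl
  map_mul' u v := by
    rw [map_mul, map_mul]
    rfl

end UnitaryPrincipalSeries

section Harmonics

open scoped Laplacian

variable {n : ℕ}

/-- The space of functions on `ℂⁿ` that are polynomial in `z` and its complex conjugate,
homogeneous of degree `α` in `z` and homogeneous of degree `β` in the conjugate variable: the linear
span of the products `p(z) * conj (q(z))` with homogeneous polynomials `p`, `q` of degrees `α`,
`β`. -/
def bihomogeneous (n α β : ℕ) : Submodule ℂ (Cn n → ℂ) :=
  Submodule.span ℂ {f | ∃ p q : MvPolynomial (Fin n) ℂ, p.IsHomogeneous α ∧ q.IsHomogeneous β ∧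
    f = fun z : Cn n => MvPolynomial.eval (fun i => z i) p *
      conj (MvPolynomial.eval (fun i => z i) q)}

theorem contDiff_eval (p : MvPolynomial (Fin n) ℂ) :
    ContDiff ℝ 2 fun z : Cn n => MvPolynomial.eval (fun i => z i) p := by
  induction p using MvPolynomial.induction_on with
  | C a => simpa using contDiff_const
  | add p q hp hq => simpa using hp.add hq
  | mul_X p i hp =>
    simp only [map_mul, MvPolynomial.eval_X]
    refine hp.mul ?_
    exact (EuclideanSpace.proj (𝕜 := ℂ) i : Cn n →L[ℂ] ℂ).contDiff.restrict_scalars ℝ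

theorem contDiff_bihomogeneous {α β : ℕ} {f : Cn n → ℂ} (hf : f ∈ bihomogeneous n α β) :
    ContDiff ℝ 2 f := by
  induction hf using Submodule.span_induction with
  | mem f hf =>
    obtain ⟨p, q, -, -, rfl⟩ := hf
    exact (contDiff_eval p).mul (Complex.conjCLE.contDiff.comp (contDiff_eval q))
  | zero => exact contDiff_const
  | add f g _ _ hf hg => exact hf.add hg
  | smul c f _ hf => exact contDiff_const.smul hf

theorem eval_smul_of_isHomogeneous {p : MvPolynomial (Fin n) ℂ} {m : ℕ} (hp : p.IsHomogeneous m)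
    (c : ℂ) (z : Fin n → ℂ) :
    MvPolynomial.eval (fun i => c * z i) p = c ^ m * MvPolynomial.eval z p := by
  rw [MvPolynomial.eval_eq, MvPolynomial.eval_eq, Finset.mul_sum]
  refine Finset.sum_congr rfl fun d hd => ?_
  have hdeg : ∑ i ∈ d.support, d i = m := by
    rw [← hp (MvPolynomial.mem_support_iff.mp hd)]
    simp [Finsupp.weight_apply, Finsupp.sum]
  simp only [mul_pow]
  rw [Finset.prod_mul_distrib, Finset.prod_pow_eq_pow_sum, hdeg]
  ring

theorem bihomogeneous_smul {α β : ℕ} {f : Cn n → ℂ} (hf : f ∈ bihomogeneous n α β) (c : ℂ)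
    (z : Cn n) : f (c • z) = c ^ α * conj c ^ β * f z := by
  induction hf using Submodule.span_induction with
  | mem f hf =>
    obtain ⟨p, q, hp, hq, rfl⟩ := hf
    simp only [PiLp.smul_apply, smul_eq_mul]
    rw [eval_smul_of_isHomogeneous hp, eval_smul_of_isHomogeneous hq, map_mul, map_pow]
    ring
  | zero => simp
  | add f g _ _ hf hg => simp only [Pi.add_apply, hf, hg]; ring
  | smul a f _ hf => simp only [Pi.smul_apply, smul_eq_mul, hf]; ring

theorem bihomogeneous_comp_act {α β : ℕ} {f : Cn n → ℂ} (hf : f ∈ bihomogeneous n α β)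
    (A : Matrix (Fin n) (Fin n) ℂ) : (fun z => f (act A z)) ∈ bihomogeneous n α β := by
  induction hf using Submodule.span_induction with
  | mem f hf =>
    obtain ⟨p, q, hp, hq, rfl⟩ := hf
    let L : Fin n → MvPolynomial (Fin n) ℂ := fun i =>
      ∑ j, MvPolynomial.C (A i j) * MvPolynomial.X j
    have hL : ∀ i, (L i).IsHomogeneous 1 := by
      intro i
      refine MvPolynomial.IsHomogeneous.sum _ _ _ fun j _ => ?_
      simpa using (MvPolynomial.isHomogeneous_C _ (A i j)).mul (MvPolynomial.isHomogeneous_X ℂ j)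
    have hev : ∀ (r : MvPolynomial (Fin n) ℂ) (z : Cn n),
        MvPolynomial.eval (fun i => z i) (MvPolynomial.aeval L r) =
          MvPolynomial.eval (fun i => act A z i) r := by
      intro r z
      induction r using MvPolynomial.induction_on with
      | C a => simp
      | add r s hr hs => simp only [map_add, hr, hs]
      | mul_X r i hr =>
        simp only [map_mul, hr, MvPolynomial.aeval_X, MvPolynomial.eval_X]
        congr 1
        simp [act_apply, L]
    refine Submodule.subset_span ⟨MvPolynomial.aeval L p, MvPolynomial.aeval L q, ?_, ?_, ?_⟩
    · simpa using hp.aeval L hL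
    · simpa using hq.aeval L hL
    · funext z
      rw [hev, hev]
  | zero => exact Submodule.zero_mem _
  | add f g _ _ hf hg => exact Submodule.add_mem _ hf hg
  | smul a f _ hf => exact Submodule.smul_mem _ a hf

/-- A unitary matrix as a real linear isometry of `ℂⁿ = ℝ²ⁿ`. -/
def actIso (u : K n) : Cn n ≃ₗᵢ[ℝ] Cn n where
  toFun := act u.1
  invFun := act (u⁻¹ : K n).1
  left_inv z := by
    rw [← act_mul, ← Submonoid.coe_mul, inv_mul_cancel, Submonoid.coe_one, act_one]
  right_inv z := by
    rw [← act_mul, ← Submonoid.coe_mul, mul_inv_cancel, Submonoid.coe_one, act_one]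
  map_add' := map_add _
  map_smul' c z := by
    ext i
    simp [act_apply, Finset.mul_sum]
  norm_map' := norm_act_unitary u

theorem laplacian_comp_unitary {f : Cn n → ℂ} (hf : ContDiff ℝ 2 f) (u : K n) (z : Cn n) :
    Δ (fun w => f (act u.1 w)) z = Δ f (act u.1 z) := by
  let b := stdOrthonormalBasis ℝ (Cn n)
  have h1 := InnerProductSpace.laplacian_eq_iteratedFDeriv_orthonormalBasis
    (fun w => f (act u.1 w)) b
  have h2 := InnerProductSpace.laplacian_eq_iteratedFDeriv_orthonormalBasis f (b.map (actIso u))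
  rw [h1, h2]
  refine Finset.sum_congr rfl fun i _ => ?_
  have h3 := ((actIso u).toContinuousLinearEquiv : Cn n →L[ℝ] Cn n).iteratedFDeriv_comp_right
    hf z (i := 2) le_rfl
  have h4 : (f ∘ ((actIso u).toContinuousLinearEquiv : Cn n →L[ℝ] Cn n)) =
    fun w => f (act u.1 w) := rfl
  rw [h4] at h3
  rw [h3, ContinuousMultilinearMap.compContinuousLinearMap_apply]
  have h5 : ((actIso u).toContinuousLinearEquiv : Cn n →L[ℝ] Cn n) z = act u.1 z := rfl
  rw [h5]
  congr 1
  funext j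
  fin_cases j <;> rfl

/-- The space `H^{α,β}(ℂⁿ)`: harmonic polynomials on `ℂⁿ = ℝ²ⁿ` that are homogeneous of degree `α`
in `z` and homogeneous of degree `β` in the conjugate variable. -/
def harmonics (n α β : ℕ) : Submodule ℂ (Cn n → ℂ) where
  carrier := {f | f ∈ bihomogeneous n α β ∧ ∀ z, Δ f z = 0}
  add_mem' := by
    rintro f g ⟨hf, hf'⟩ ⟨hg, hg'⟩
    refine ⟨Submodule.add_mem _ hf hg, fun z => ?_⟩
    rw [(contDiff_bihomogeneous hf).contDiffAt.laplacian_add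
      (contDiff_bihomogeneous hg).contDiffAt, hf', hg', add_zero]
  zero_mem' := by
    refine ⟨Submodule.zero_mem _, fun z => ?_⟩
    have : (0 : Cn n → ℂ) = fun _ => 0 := rfl
    rw [this]
    simp
  smul_mem' := by
    rintro c f ⟨hf, hf'⟩
    refine ⟨Submodule.smul_mem _ c hf, fun z => ?_⟩
    rw [InnerProductSpace.laplacian_smul c (contDiff_bihomogeneous hf).contDiffAt, hf', smul_zero]

/-- `H^{α,β}(ℂⁿ)` as a type, to carry the inner product of `L²` of the unit sphere. -/
def Harmonics (n : ℕ) [NeZero n] (α β : ℕ) : Type := harmonics n α β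

variable [NeZero n] {α β : ℕ}

instance : AddCommGroup (Harmonics n α β) := inferInstanceAs (AddCommGroup (harmonics n α β))

instance : Module ℂ (Harmonics n α β) := inferInstanceAs (Module ℂ (harmonics n α β))

/-- The underlying element of the space of harmonic polynomials. -/
def Harmonics.toPoly (f : Harmonics n α β) : harmonics n α β := f

instance : CoeFun (Harmonics n α β) (fun _ => Cn n → ℂ) := ⟨fun f => f.toPoly.1⟩

theorem Harmonics.ext {f g : Harmonics n α β} (h : ∀ z, f z = g z) : f = g :=
  Subtype.ext (funext h)

theorem continuous_orbit (f : Harmonics n α β) :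
    Continuous fun u : K n => f (act u.1 (e0 n)) := by
  have h : Continuous fun u : K n => act u.1 (e0 n) := by
    have h : Continuous fun u : K n => u.1 *ᵥ (e0 n : Fin n → ℂ) :=
      Continuous.matrix_mulVec continuous_subtype_val continuous_const
    exact (PiLp.continuous_toLp 2 _).comp h
  exact (contDiff_bihomogeneous f.toPoly.2.1).continuous.comp h

theorem integrable_harmonics (f g : Harmonics n α β) :
    Integrable (fun u : K n => conj (f (act u.1 (e0 n))) * g (act u.1 (e0 n))) (haarK n) :=
  (Continuous.mul (Complex.continuous_conj.comp (continuous_orbit f))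
    (continuous_orbit g)).integrable_of_hasCompactSupport (HasCompactSupport.of_compactSpace _)

/-- The inner product of `L²(S^{2n-1})` on `H^{α,β}(ℂⁿ)`, where the sphere
`S^{2n-1} = U(n) e₁ = U(n) / U(n-1)` carries its `U(n)`-invariant probability measure. -/
instance harmonicsCore : InnerProductSpace.Core ℂ (Harmonics n α β) where
  inner f g := ∫ u, conj (f (act u.1 (e0 n))) * g (act u.1 (e0 n)) ∂(haarK n)
  conj_inner_symm f g := by
    rw [← integral_conj]
    refine integral_congr_ae (Filter.Eventually.of_forall fun u => ?_)
    simp [mul_comm]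
  re_inner_nonneg f := by
    have h : ∀ u : K n, conj (f (act u.1 (e0 n))) * f (act u.1 (e0 n)) =
        ((‖f (act u.1 (e0 n))‖ ^ 2 : ℝ) : ℂ) := by
      intro u
      rw [Complex.conj_mul', Complex.ofReal_pow]
    simp only [h]
    rw [integral_complex_ofReal]
    exact integral_nonneg fun u => by positivity
  add_left f₁ f₂ f₃ := by
    rw [← integral_add (integrable_harmonics f₁ f₃) (integrable_harmonics f₂ f₃)]
    refine integral_congr_ae (Filter.Eventually.of_forall fun u => ?_)
    change conj (f₁ (act u.1 (e0 n)) + f₂ (act u.1 (e0 n))) * f₃ (act u.1 (e0 n)) = _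
    rw [map_add, add_mul]
  smul_left f g c := by
    rw [← integral_const_mul]
    refine integral_congr_ae (Filter.Eventually.of_forall fun u => ?_)
    change conj (c * f (act u.1 (e0 n))) * g (act u.1 (e0 n)) = _
    rw [map_mul, mul_assoc]
  definite f hf := by
    have h : ∀ u : K n, conj (f (act u.1 (e0 n))) * f (act u.1 (e0 n)) =
        ((‖f (act u.1 (e0 n))‖ ^ 2 : ℝ) : ℂ) := by
      intro u
      rw [Complex.conj_mul', Complex.ofReal_pow]
    simp only [h] at hf
    rw [integral_complex_ofReal, Complex.ofReal_eq_zero] at hf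
    have hc : Continuous fun u : K n => ‖f (act u.1 (e0 n))‖ ^ 2 := (continuous_orbit f).norm.pow 2
    have h0 : ∀ u : K n, f (act u.1 (e0 n)) = 0 := by
      intro u
      have h1 := (hc.integral_pos_of_hasCompactSupport_nonneg_nonzero (μ := haarK n) (x := u)
        (HasCompactSupport.of_compactSpace _) (fun u => by positivity)).mt hf.not_gt
      simpa using h1
    refine Harmonics.ext fun z => ?_
    have h1 : ∃ (c : ℂ) (u : K n), z = c • act u.1 (e0 n) := by
      by_cases hz : z = 0
      · exact ⟨0, 1, by simp [hz]⟩
      · obtain ⟨v, hv⟩ := exists_unitary (w := ((‖z‖⁻¹ : ℝ) : ℂ) • z) (by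
          rw [norm_smul]; simp [hz])
        refine ⟨(‖z‖ : ℂ), v, ?_⟩
        rw [hv, smul_smul]; simp [hz]
    obtain ⟨c, u, rfl⟩ := h1
    rw [bihomogeneous_smul f.toPoly.2.1, h0 u, mul_zero]
    rfl

instance : NormedAddCommGroup (Harmonics n α β) :=
  InnerProductSpace.Core.toNormedAddCommGroup (𝕜 := ℂ)

instance : InnerProductSpace ℂ (Harmonics n α β) :=
  InnerProductSpace.ofCore harmonicsCore.toCore

/-- The representation of `U(n)` on `H^{α,β}(ℂⁿ)` by `(u f)(z) = f(u⁻¹ z)`. -/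
def harmonicsRep (n : ℕ) [NeZero n] (α β : ℕ) :
    Representation ℂ (K n) (Harmonics n α β) where
  toFun u :=
    { toFun := fun f => (⟨fun z => f (act (u⁻¹ : K n).1 z),
        bihomogeneous_comp_act f.toPoly.2.1 _, fun z => by
          rw [laplacian_comp_unitary (contDiff_bihomogeneous f.toPoly.2.1), f.toPoly.2.2]⟩ :
        harmonics n α β)
      map_add' := fun _ _ => rfl
      map_smul' := fun _ _ => rfl }
  map_one' := by
    refine LinearMap.ext fun f => Harmonics.ext fun z => ?_
    change f (act ((1 : K n)⁻¹ : K n).1 z) = f z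
    rw [inv_one, Submonoid.coe_one, act_one]
  map_mul' u v := by
    refine LinearMap.ext fun f => Harmonics.ext fun z => ?_
    change f (act ((u * v)⁻¹ : K n).1 z) = f (act (v⁻¹ : K n).1 (act (u⁻¹ : K n).1 z))
    rw [_root_.mul_inv_rev, Submonoid.coe_mul, act_mul]

end Harmonics

end GLBranching

end

/-! Restricted to `U(n)`, a section is right covariant under the intersection of `P` with `U(n)`,
which is `U(1) × U(n-1)`. It is therefore a continuous function `φ` on the sphere `U(n) e₁` with
`φ(c z) = c^(-k) φ(z)` for `|c| = 1`, and `λ` plays no role. An element `f` of `H^{α,β}` satisfies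
`f(c z) = c^(α-β) f(z)` on the sphere, which explains the condition `α - β = -k`. Each such `f`
extends to a section on the whole group (`harmonicSection`), isometrically and equivariantly.

Density. By Stone–Weierstrass, polynomials in `z` and `conj z` approximate `φ` uniformly. Averaging
over the circle, in practice over enough roots of unity, keeps only bidegrees with `α - β = -k` and
does not worsen the approximation. Every bihomogeneous polynomial is a sum of powers of `|z|²` times
harmonic ones (`bihomogeneousPoly_le_harmonicSpan`), and `|z|² = 1` on the sphere.

Irreducibility. In a non-zero invariant subspace of `H^{α,β}`, the vector that represents evaluation
at `e₁` is non-zero and fixed by the stabilizer of `e₁` (`exists_zonal_mem`). A zonal polynomial is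
a combination of `|z|^(2i) z₁^(α-i) conj z₁^(β-i)`. Harmonicity is then a two-term recursion for the
coefficients, so the zonal harmonics form a space of dimension at most one (`zonal_dependent`). An
invariant subspace and its orthogonal complement cannot both be non-zero.

Inequivalence. The circle acting on the first coordinate has the weight `α` on `z₁^α conj z_j^β`,
while no such weight exceeds `α'` on `H^{α',β'}`. Hence `α ≠ α'` excludes non-zero intertwiners
(`intertwining_eq_zero`). The embedded spaces are therefore orthogonal, and with density they form a
Hilbert sum. Multiplicity one follows from Schur's lemma applied to the components of an
intertwiner. -/

noncomputable section

open MeasureTheory Matrix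
open scoped ComplexConjugate ENNReal Laplacian

namespace GLBranching

/-! ### Polynomials in `z` and its complex conjugate -/

section RealPolynomials

open MvPolynomial

variable {n : ℕ}

/-- Polynomials in `n` variables `z` and `n` further variables that stand for the conjugates. -/
abbrev RealPoly (n : ℕ) : Type := MvPolynomial (Fin n ⊕ Fin n) ℂ

/-- The values `z`, `conj z` of the variables at a point of `ℂⁿ`. -/
def realPoint (z : Cn n) : Fin n ⊕ Fin n → ℂ := Sum.elim (fun i => z i) (fun i => conj (z i))

/-- Evaluation of a polynomial in `z` and its complex conjugate. -/
def realEval (P : RealPoly n) (z : Cn n) : ℂ := MvPolynomial.eval (realPoint z) P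

@[simp] theorem realEval_add (P Q : RealPoly n) (z : Cn n) :
    realEval (P + Q) z = realEval P z + realEval Q z := map_add _ _ _

@[simp] theorem realEval_neg (P : RealPoly n) (z : Cn n) :
    realEval (-P) z = -realEval P z := map_neg _ _

@[simp] theorem realEval_mul (P Q : RealPoly n) (z : Cn n) :
    realEval (P * Q) z = realEval P z * realEval Q z := map_mul _ _ _

@[simp] theorem realEval_pow (P : RealPoly n) (s : ℕ) (z : Cn n) :
    realEval (P ^ s) z = realEval P z ^ s := map_pow _ _ _

@[simp] theorem realEval_C (c : ℂ) (z : Cn n) : realEval (C c : RealPoly n) z = c := by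
  simp [realEval]

@[simp] theorem realEval_one (z : Cn n) : realEval (1 : RealPoly n) z = 1 := map_one _

@[simp] theorem realEval_zero (z : Cn n) : realEval (0 : RealPoly n) z = 0 := map_zero _

@[simp] theorem realEval_smul (c : ℂ) (P : RealPoly n) (z : Cn n) :
    realEval (c • P) z = c * realEval P z := by
  simp [realEval]

@[simp] theorem realEval_sum {ι : Type*} (s : Finset ι) (P : ι → RealPoly n) (z : Cn n) :
    realEval (∑ i ∈ s, P i) z = ∑ i ∈ s, realEval (P i) z := map_sum _ _ _

@[simp] theorem realEval_X_inl (i : Fin n) (z : Cn n) :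
    realEval (X (Sum.inl i)) z = z i := by simp [realEval, realPoint]

@[simp] theorem realEval_X_inr (i : Fin n) (z : Cn n) :
    realEval (X (Sum.inr i)) z = conj (z i) := by simp [realEval, realPoint]

theorem realEval_monomial (d : Fin n ⊕ Fin n →₀ ℕ) (c : ℂ) (z : Cn n) :
    realEval (monomial d c) z =
      c * ((∏ i, z i ^ d (Sum.inl i)) * ∏ i, conj (z i) ^ d (Sum.inr i)) := by
  rw [realEval, eval_monomial, Finsupp.prod_fintype _ _ (fun i => pow_zero _),
    Fintype.prod_sum_type]
  rfl

theorem coe_realEval_C (c : ℂ) : realEval (C c : RealPoly n) = fun _ => c :=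
  funext (realEval_C c)

theorem coe_realEval_add (P Q : RealPoly n) : realEval (P + Q) = realEval P + realEval Q :=
  funext (realEval_add P Q)

theorem coe_realEval_mul (P Q : RealPoly n) : realEval (P * Q) = realEval P * realEval Q :=
  funext (realEval_mul P Q)

theorem coe_realEval_X_inl (i : Fin n) :
    realEval (X (Sum.inl i)) = (EuclideanSpace.proj (𝕜 := ℂ) i : Cn n →L[ℂ] ℂ).restrictScalars ℝ :=
  funext (realEval_X_inl i)

theorem coe_realEval_X_inr (i : Fin n) :
    realEval (X (Sum.inr i)) = (Complex.conjCLE : ℂ →L[ℝ] ℂ).comp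
      ((EuclideanSpace.proj (𝕜 := ℂ) i : Cn n →L[ℂ] ℂ).restrictScalars ℝ) :=
  funext (realEval_X_inr i)

/-- The derivative of a polynomial in `z` and its conjugate along a vector of `ℂⁿ = ℝ²ⁿ`. -/
def dirDeriv (v : Cn n) (P : RealPoly n) : RealPoly n :=
  ∑ i, (C (v i) * pderiv (Sum.inl i) P + C (conj (v i)) * pderiv (Sum.inr i) P)

/-- Both sides obey the Leibniz rule in `P`, so constants and variables suffice. The derivative is
existentially quantified so that differentiability and the formula pass through the induction
together. -/
theorem hasFDerivAt_realEval (P : RealPoly n) (z : Cn n) :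
    ∃ D : Cn n →L[ℝ] ℂ, HasFDerivAt (realEval P) D z ∧
      ∀ v, D v = realEval (dirDeriv v P) z := by
  induction P using MvPolynomial.induction_on with
  | C a =>
    refine ⟨0, ?_, fun v => by simp [dirDeriv]⟩
    rw [coe_realEval_C]
    exact hasFDerivAt_const a z
  | add P Q hP hQ =>
    obtain ⟨D₁, h₁, h₁'⟩ := hP
    obtain ⟨D₂, h₂, h₂'⟩ := hQ
    refine ⟨D₁ + D₂, ?_, fun v => ?_⟩
    · rw [coe_realEval_add]
      exact h₁.add h₂
    · rw [_root_.add_apply, h₁', h₂', ← realEval_add]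
      congr 1
      simp only [dirDeriv, map_add, ← Finset.sum_add_distrib]
      exact Finset.sum_congr rfl fun i _ => by ring
  | mul_X P j hP =>
    obtain ⟨D, h, h'⟩ := hP
    have hX : ∃ D' : Cn n →L[ℝ] ℂ, HasFDerivAt (realEval (X j : RealPoly n)) D' z ∧
        ∀ v, D' v = realEval (dirDeriv v (X j)) z := by
      rcases j with j | j
      · refine ⟨((EuclideanSpace.proj (𝕜 := ℂ) j : Cn n →L[ℂ] ℂ).restrictScalars ℝ), ?_,
          fun v => ?_⟩
        · rw [coe_realEval_X_inl]
          exact ContinuousLinearMap.hasFDerivAt _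
        · simp [dirDeriv, pderiv_X, Pi.single_apply, Finset.sum_ite_eq]
      · refine ⟨(Complex.conjCLE : ℂ →L[ℝ] ℂ).comp
          ((EuclideanSpace.proj (𝕜 := ℂ) j : Cn n →L[ℂ] ℂ).restrictScalars ℝ), ?_,
          fun v => ?_⟩
        · rw [coe_realEval_X_inr]
          exact ContinuousLinearMap.hasFDerivAt _
        · simp [dirDeriv, pderiv_X, Pi.single_apply, Finset.sum_ite_eq]
    obtain ⟨D', g, g'⟩ := hX
    refine ⟨realEval P z • D' + realEval (X j) z • D, ?_, fun v => ?_⟩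
    · rw [coe_realEval_mul]
      exact h.mul g
    · rw [_root_.add_apply, _root_.smul_apply, _root_.smul_apply, g', h']
      simp only [smul_eq_mul]
      rw [← realEval_mul, ← realEval_mul, ← realEval_add]
      congr 1
      simp only [dirDeriv, Derivation.leibniz, smul_eq_mul, Finset.mul_sum,
        ← Finset.sum_add_distrib]
      exact Finset.sum_congr rfl fun i _ => by ring

theorem fderiv_realEval (P : RealPoly n) (z v : Cn n) :
    fderiv ℝ (realEval P) z v = realEval (dirDeriv v P) z := by
  obtain ⟨D, h, h'⟩ := hasFDerivAt_realEval P z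
  rw [h.fderiv, h']

theorem contDiff_realEval (P : RealPoly n) : ContDiff ℝ 2 (realEval P) := by
  induction P using MvPolynomial.induction_on with
  | C a =>
    rw [coe_realEval_C]
    exact contDiff_const
  | add P Q hP hQ =>
    rw [coe_realEval_add]
    exact hP.add hQ
  | mul_X P j hP =>
    rw [coe_realEval_mul]
    refine hP.mul ?_
    rcases j with j | j
    · rw [coe_realEval_X_inl]
      exact ContinuousLinearMap.contDiff _
    · rw [coe_realEval_X_inr]
      exact ContinuousLinearMap.contDiff _

theorem continuous_realEval (P : RealPoly n) : Continuous (realEval P) :=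
  (contDiff_realEval P).continuous

theorem fderiv_fderiv_realEval (P : RealPoly n) (z v w : Cn n) :
    fderiv ℝ (fderiv ℝ (realEval P)) z v w = realEval (dirDeriv v (dirDeriv w P)) z := by
  have hd : DifferentiableAt ℝ (fderiv ℝ (realEval P)) z :=
    (((contDiff_realEval P).fderiv_right (m := 1) (by norm_num)).differentiable
      (by norm_num)).differentiableAt
  have h1 : fderiv ℝ (fun x => fderiv ℝ (realEval P) x w) z v =
      fderiv ℝ (fderiv ℝ (realEval P)) z v w := by
    rw [fderiv_clm_apply hd (differentiableAt_const w)]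
    simp
  rw [← h1]
  simp only [fderiv_realEval]

/-- A quarter of the Laplacian, on polynomials in `z` and its conjugate. -/
def polyLaplacian : RealPoly n →ₗ[ℂ] RealPoly n :=
  ∑ i, (pderiv (Sum.inl i)).toLinearMap ∘ₗ (pderiv (Sum.inr i)).toLinearMap

theorem polyLaplacian_apply (P : RealPoly n) :
    polyLaplacian P = ∑ i, pderiv (Sum.inl i) (pderiv (Sum.inr i) P) := by
  simp [polyLaplacian]

theorem dirDeriv_single (i : Fin n) (c : ℂ) (P : RealPoly n) :
    dirDeriv (PiLp.single 2 i c : Cn n) P =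
      C c * pderiv (Sum.inl i) P + C (conj c) * pderiv (Sum.inr i) P := by
  rw [dirDeriv, Finset.sum_eq_single i]
  · simp
  · intro j _ hj
    simp [hj]
  · simp

/-- The commutator of two derivations is a derivation, and this one vanishes on the variables. -/
theorem pderiv_pderiv_comm (i j : Fin n ⊕ Fin n) (P : RealPoly n) :
    pderiv i (pderiv j P) = pderiv j (pderiv i P) := by
  have h : ⁅pderiv (R := ℂ) i, pderiv (R := ℂ) j⁆ = (0 : Derivation ℂ (RealPoly n) (RealPoly n)) := by
    refine derivation_ext fun k => ?_
    rw [Derivation.commutator_apply]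
    simp only [pderiv_X, Pi.single_apply, Derivation.zero_apply]
    split_ifs <;> simp
  have h' := DFunLike.congr_fun h P
  rw [Derivation.commutator_apply, Derivation.zero_apply, sub_eq_zero] at h'
  exact h'

/-- In each coordinate the real orthonormal basis `1, i` gives the operators `∂ + ∂̄` and `i∂ -
i∂̄`. The sum of their squares is `4 ∂∂̄`. The harmonicity condition thus becomes algebraic. -/
theorem laplacian_realEval (P : RealPoly n) (z : Cn n) :
    Δ (realEval P) z = 4 * realEval (polyLaplacian P) z := by
  rw [InnerProductSpace.laplacian_eq_iteratedFDeriv_orthonormalBasis (realEval P)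
    (Pi.orthonormalBasis (fun _ : Fin n => Complex.orthonormalBasisOneI))]
  simp only [Fintype.sum_sigma, iteratedFDeriv_two_apply, Fin.sum_univ_two,
    Pi.orthonormalBasis_apply, Complex.coe_orthonormalBasisOneI, Matrix.cons_val_zero,
    Matrix.cons_val_one]
  rw [polyLaplacian_apply, realEval_sum, Finset.mul_sum]
  refine Finset.sum_congr rfl fun i _ => ?_
  rw [fderiv_fderiv_realEval, fderiv_fderiv_realEval]
  simp only [dirDeriv_single, map_add, Derivation.leibniz, pderiv_C, smul_eq_mul, map_one,
    Derivation.map_one_eq_zero, Complex.conj_I]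
  have hcomm : pderiv (Sum.inr i) (pderiv (Sum.inl i) P) =
      pderiv (Sum.inl i) (pderiv (Sum.inr i) P) := pderiv_pderiv_comm _ _ _
  rw [hcomm]
  simp only [realEval_add, realEval_mul, realEval_C, realEval_zero, realEval_one,
    map_neg, realEval_neg]
  have hI : Complex.I * Complex.I = -1 := Complex.I_mul_I
  linear_combination (realEval (pderiv (Sum.inl i) (pderiv (Sum.inl i) P)) z
    - 2 * realEval (pderiv (Sum.inl i) (pderiv (Sum.inr i) P)) z
    + realEval (pderiv (Sum.inr i) (pderiv (Sum.inr i) P)) z) * hI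

end RealPolynomials

/-! ### Bihomogeneous polynomials and their decomposition into powers of `|z|²` times harmonics. -/

section Bihomogeneous

open MvPolynomial

variable {n : ℕ} {α β : ℕ}

variable (n) in
/-- Polynomials of degree `α` in `z` and of degree `β` in the conjugate variables. -/
def bihomogeneousPoly (α β : ℕ) : Submodule ℂ (RealPoly n) :=
  weightedHomogeneousSubmodule ℂ (Sum.elim 1 0 : Fin n ⊕ Fin n → ℕ) α ⊓
    weightedHomogeneousSubmodule ℂ (Sum.elim 0 1 : Fin n ⊕ Fin n → ℕ) β

theorem mul_mem_bihomogeneousPoly {P Q : RealPoly n} {α' β' : ℕ}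
    (hP : P ∈ bihomogeneousPoly n α β) (hQ : Q ∈ bihomogeneousPoly n α' β') :
    P * Q ∈ bihomogeneousPoly n (α + α') (β + β') :=
  ⟨IsWeightedHomogeneous.mul hP.1 hQ.1, IsWeightedHomogeneous.mul hP.2 hQ.2⟩

theorem X_inl_mem_bihomogeneousPoly (i : Fin n) :
    (X (Sum.inl i) : RealPoly n) ∈ bihomogeneousPoly n 1 0 :=
  ⟨isWeightedHomogeneous_X _ _ _, isWeightedHomogeneous_X _ _ _⟩

theorem X_inr_mem_bihomogeneousPoly (i : Fin n) :
    (X (Sum.inr i) : RealPoly n) ∈ bihomogeneousPoly n 0 1 :=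
  ⟨isWeightedHomogeneous_X _ _ _, isWeightedHomogeneous_X _ _ _⟩

theorem pow_mem_bihomogeneousPoly {P : RealPoly n} (hP : P ∈ bihomogeneousPoly n α β) (s : ℕ) :
    P ^ s ∈ bihomogeneousPoly n (s * α) (s * β) :=
  ⟨by simpa using IsWeightedHomogeneous.pow hP.1 s, by simpa using IsWeightedHomogeneous.pow hP.2 s⟩

theorem monomial_mem_bihomogeneousPoly (d : Fin n ⊕ Fin n →₀ ℕ) (c : ℂ) :
    monomial d c ∈ bihomogeneousPoly n (∑ i, d (Sum.inl i)) (∑ i, d (Sum.inr i)) := by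
  constructor
  · refine isWeightedHomogeneous_monomial _ _ _ ?_
    simp [Finsupp.weight_apply, Finsupp.sum_fintype]
  · refine isWeightedHomogeneous_monomial _ _ _ ?_
    simp [Finsupp.weight_apply, Finsupp.sum_fintype]

theorem degree_of_mem_support {P : RealPoly n} (hP : P ∈ bihomogeneousPoly n α β)
    {d : Fin n ⊕ Fin n →₀ ℕ} (hd : d ∈ P.support) :
    ∑ i, d (Sum.inl i) = α ∧ ∑ i, d (Sum.inr i) = β := by
  have h1 := hP.1 (mem_support_iff.mp hd)
  have h2 := hP.2 (mem_support_iff.mp hd)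
  simp only [Finsupp.weight_apply] at h1 h2
  rw [Finsupp.sum_fintype _ _ (by simp), Fintype.sum_sum_type] at h1 h2
  simp only [Sum.elim_inl, Sum.elim_inr, Pi.one_apply, Pi.zero_apply, smul_eq_mul, mul_one,
    mul_zero, Finset.sum_const_zero, add_zero, zero_add] at h1 h2
  exact ⟨h1, h2⟩

/-- Induction over bihomogeneous polynomials, from monomials. -/
theorem bihomogeneousPoly_induction {p : RealPoly n → Prop}
    (hmon : ∀ (d : Fin n ⊕ Fin n →₀ ℕ) (c : ℂ), ∑ i, d (Sum.inl i) = α → ∑ i, d (Sum.inr i) = β →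
      p (monomial d c))
    (h0 : p 0) (hadd : ∀ P Q, p P → p Q → p (P + Q))
    {P : RealPoly n} (hP : P ∈ bihomogeneousPoly n α β) : p P := by
  rw [P.as_sum]
  refine Finset.sum_induction _ p hadd h0 fun d hd => ?_
  obtain ⟨h1, h2⟩ := degree_of_mem_support hP hd
  exact hmon d _ h1 h2

theorem realEval_mem_bihomogeneous {P : RealPoly n} (hP : P ∈ bihomogeneousPoly n α β) :
    realEval P ∈ bihomogeneous n α β := by
  refine bihomogeneousPoly_induction (p := fun P => realEval P ∈ bihomogeneous n α β)
    (fun d c h1 h2 => ?_) ?_ (fun P Q hP hQ => ?_) hP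
  · refine Submodule.subset_span ⟨C c * ∏ i, X i ^ d (Sum.inl i), ∏ i, X i ^ d (Sum.inr i),
      ?_, ?_, ?_⟩
    · have h := (isHomogeneous_C (Fin n) c).mul (IsHomogeneous.prod Finset.univ
        (fun i : Fin n => (X i : MvPolynomial (Fin n) ℂ) ^ d (Sum.inl i)) _
        fun i _ => isHomogeneous_X_pow (R := ℂ) i (d (Sum.inl i)))
      rwa [h1, zero_add] at h
    · have h := IsHomogeneous.prod Finset.univ
        (fun i : Fin n => (X i : MvPolynomial (Fin n) ℂ) ^ d (Sum.inr i)) _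
        fun i _ => isHomogeneous_X_pow (R := ℂ) i (d (Sum.inr i))
      rwa [h2] at h
    · funext z
      rw [realEval_monomial]
      simp [mul_assoc]
  · have : realEval (0 : RealPoly n) = 0 := funext realEval_zero
    rw [this]
    exact Submodule.zero_mem _
  · rw [coe_realEval_add]
    exact Submodule.add_mem _ hP hQ

theorem exists_realEval_of_isHomogeneous {p : MvPolynomial (Fin n) ℂ} (hp : p.IsHomogeneous α) :
    ∃ P ∈ bihomogeneousPoly n α 0, ∀ z : Cn n, realEval P z = MvPolynomial.eval (fun i => z i) p := by
  refine ⟨∑ d ∈ p.support, monomial (Finsupp.mapDomain Sum.inl d) (coeff d p),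
    Submodule.sum_mem _ fun d hd => ?_, fun z => ?_⟩
  · have h := monomial_mem_bihomogeneousPoly (Finsupp.mapDomain (Sum.inl : Fin n → Fin n ⊕ Fin n) d)
      (coeff d p)
    have hdeg : ∑ i, d i = α := by
      rw [← hp (mem_support_iff.mp hd)]
      simp [Finsupp.weight_apply, Finsupp.sum_fintype]
    have hr : ∀ i : Fin n, Finsupp.mapDomain (Sum.inl : Fin n → Fin n ⊕ Fin n) d (Sum.inr i) = 0 :=
      fun i => Finsupp.mapDomain_of_notMem_range _ _ (by simp)
    simpa [Finsupp.mapDomain_apply Sum.inl_injective, hr, hdeg] using h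
  · have hr : ∀ (d : Fin n →₀ ℕ) (i : Fin n),
        Finsupp.mapDomain (Sum.inl : Fin n → Fin n ⊕ Fin n) d (Sum.inr i) = 0 :=
      fun d i => Finsupp.mapDomain_of_notMem_range _ _ (by simp)
    rw [realEval_sum, MvPolynomial.eval_eq']
    refine Finset.sum_congr rfl fun d _ => ?_
    rw [realEval_monomial]
    simp [Finsupp.mapDomain_apply Sum.inl_injective, hr]

/-- The polynomial whose values are the complex conjugates of those of a given one. -/
def conjPoly (P : RealPoly n) : RealPoly n :=
  rename (Equiv.sumComm _ _) (MvPolynomial.map (starRingEnd ℂ) P)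

theorem realEval_conjPoly (P : RealPoly n) (z : Cn n) :
    realEval (conjPoly P) z = conj (realEval P z) := by
  rw [realEval, conjPoly, eval_rename, eval_map, realEval, ← MvPolynomial.eval₂_id,
    MvPolynomial.hom_eval₂]
  congr 1
  funext i
  rcases i with i | i <;> simp [realPoint]

theorem conjPoly_mem {P : RealPoly n} (hP : P ∈ bihomogeneousPoly n α β) :
    conjPoly P ∈ bihomogeneousPoly n β α := by
  refine bihomogeneousPoly_induction (p := fun P => conjPoly P ∈ bihomogeneousPoly n β α)
    (fun d c h1 h2 => ?_) ?_ (fun P Q hP hQ => ?_) hP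
  · have h := monomial_mem_bihomogeneousPoly (Finsupp.mapDomain (Equiv.sumComm _ _) d) (conj c)
    have e1 : ∀ i : Fin n, Finsupp.mapDomain (Equiv.sumComm (Fin n) (Fin n)) d (Sum.inl i) =
      d (Sum.inr i) := fun i =>
        Finsupp.mapDomain_apply (Equiv.sumComm (Fin n) (Fin n)).injective d (Sum.inr i)
    have e2 : ∀ i : Fin n, Finsupp.mapDomain (Equiv.sumComm (Fin n) (Fin n)) d (Sum.inr i) =
      d (Sum.inl i) := fun i =>
        Finsupp.mapDomain_apply (Equiv.sumComm (Fin n) (Fin n)).injective d (Sum.inl i)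
    simp only [e1, e2, h1, h2] at h
    rw [conjPoly, map_monomial, rename_monomial]
    exact h
  · simp [conjPoly]
  · have : conjPoly (P + Q) = conjPoly P + conjPoly Q := by simp [conjPoly]
    rw [this]
    exact Submodule.add_mem _ hP hQ

/-- Together with `realEval_mem_bihomogeneous` this identifies the function space with the values of
formal polynomials, so that monomials and partial derivatives become available. The conjugate factor
is handled by `conjPoly`, which swaps the two kinds of variables. -/
theorem exists_realEval {f : Cn n → ℂ} (hf : f ∈ bihomogeneous n α β) :
    ∃ P ∈ bihomogeneousPoly n α β, realEval P = f := by
  induction hf using Submodule.span_induction with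
  | mem f hf =>
    obtain ⟨p, q, hp, hq, rfl⟩ := hf
    obtain ⟨P, hP, hP'⟩ := exists_realEval_of_isHomogeneous hp
    obtain ⟨Q, hQ, hQ'⟩ := exists_realEval_of_isHomogeneous hq
    refine ⟨P * conjPoly Q, ?_, ?_⟩
    · simpa using mul_mem_bihomogeneousPoly hP (conjPoly_mem hQ)
    · funext z
      rw [realEval_mul, realEval_conjPoly, hP', hQ']
  | zero => exact ⟨0, Submodule.zero_mem _, funext realEval_zero⟩
  | add f g _ _ hf hg =>
    obtain ⟨P, hP, rfl⟩ := hf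
    obtain ⟨Q, hQ, rfl⟩ := hg
    exact ⟨P + Q, Submodule.add_mem _ hP hQ, coe_realEval_add P Q⟩
  | smul c f _ hf =>
    obtain ⟨P, hP, rfl⟩ := hf
    exact ⟨c • P, Submodule.smul_mem _ c hP, funext (realEval_smul c P)⟩

variable (n) in
/-- The polynomial `|z|²`. -/
def normSqPoly : RealPoly n := ∑ i, X (Sum.inl i) * X (Sum.inr i)

theorem realEval_normSqPoly (z : Cn n) : realEval (normSqPoly n) z = (‖z‖ : ℂ) ^ 2 := by
  rw [normSqPoly, realEval_sum, ← Complex.ofReal_pow, EuclideanSpace.norm_sq_eq,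
    Complex.ofReal_sum]
  refine Finset.sum_congr rfl fun i _ => ?_
  rw [realEval_mul, realEval_X_inl, realEval_X_inr, Complex.mul_conj', Complex.ofReal_pow]

theorem normSqPoly_mem : normSqPoly n ∈ bihomogeneousPoly n 1 1 :=
  Submodule.sum_mem _ fun i _ =>
    mul_mem_bihomogeneousPoly (X_inl_mem_bihomogeneousPoly i) (X_inr_mem_bihomogeneousPoly i)

theorem pderiv_inl_normSqPoly (i : Fin n) :
    pderiv (Sum.inl i) (normSqPoly n) = X (Sum.inr i) := by
  rw [normSqPoly, map_sum, Finset.sum_eq_single i]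
  · simp [Derivation.leibniz, pderiv_X]
  · intro j _ hj
    simp [Derivation.leibniz, pderiv_X, hj]
  · simp

theorem pderiv_inr_normSqPoly (i : Fin n) :
    pderiv (Sum.inr i) (normSqPoly n) = X (Sum.inl i) := by
  rw [normSqPoly, map_sum, Finset.sum_eq_single i]
  · simp [Derivation.leibniz, pderiv_X]
  · intro j _ hj
    simp [Derivation.leibniz, pderiv_X, hj]
  · simp

/-- In the Leibniz expansion, `∂∂̄|z|²` contributes `n` and the two cross terms are the Euler
operators in `z` and in `conj z`, which contribute `α` and `β`. -/
theorem polyLaplacian_normSqPoly_mul {Q : RealPoly n} (hQ : Q ∈ bihomogeneousPoly n α β) :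
    polyLaplacian (normSqPoly n * Q) =
      normSqPoly n * polyLaplacian Q + ((n + α + β : ℕ) : ℂ) • Q := by
  have hα := IsWeightedHomogeneous.sum_weight_X_mul_pderiv (w := Sum.elim 1 0) hQ.1
  have hβ := IsWeightedHomogeneous.sum_weight_X_mul_pderiv (w := Sum.elim 0 1) hQ.2
  simp only [Fintype.sum_sum_type, Sum.elim_inl, Sum.elim_inr, Pi.one_apply, Pi.zero_apply,
    one_smul, zero_smul, Finset.sum_const_zero, add_zero, zero_add] at hα hβ
  have key : ∀ i : Fin n, pderiv (Sum.inl i) (pderiv (Sum.inr i) (normSqPoly n * Q)) =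
      normSqPoly n * pderiv (Sum.inl i) (pderiv (Sum.inr i) Q) +
        X (Sum.inr i) * pderiv (Sum.inr i) Q + (Q + X (Sum.inl i) * pderiv (Sum.inl i) Q) := by
    intro i
    simp only [Derivation.leibniz, smul_eq_mul, map_add, pderiv_inl_normSqPoly,
      pderiv_inr_normSqPoly, pderiv_X_self]
    ring
  rw [polyLaplacian_apply, polyLaplacian_apply]
  simp only [key, Finset.sum_add_distrib, ← Finset.mul_sum, hα, hβ]
  simp only [Finset.sum_const, Finset.card_univ, Fintype.card_fin, Nat.cast_smul_eq_nsmul,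
    add_smul]
  abel

/-- Each further factor `|z|²` acts on a polynomial whose two degrees have both grown by one. The
constant is the sum of `n + α + β + 2j` over `0 ≤ j ≤ s`. -/
theorem polyLaplacian_normSqPoly_pow_mul {Q : RealPoly n} (hQ : Q ∈ bihomogeneousPoly n α β)
    (s : ℕ) :
    polyLaplacian (normSqPoly n ^ (s + 1) * Q) = normSqPoly n ^ (s + 1) * polyLaplacian Q +
      (((s + 1) * (n + s + α + β) : ℕ) : ℂ) • (normSqPoly n ^ s * Q) := by
  induction s with
  | zero =>
    have := polyLaplacian_normSqPoly_mul hQ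
    simpa using this
  | succ s ih =>
    have hm : normSqPoly n ^ (s + 1) * Q ∈ bihomogeneousPoly n (s + 1 + α) (s + 1 + β) := by
      simpa using mul_mem_bihomogeneousPoly (pow_mem_bihomogeneousPoly normSqPoly_mem (s + 1)) hQ
    have h := polyLaplacian_normSqPoly_mul hm
    rw [ih] at h
    rw [pow_succ' _ (s + 1), mul_assoc, h]
    simp only [smul_eq_C_mul]
    push_cast
    simp only [map_add, map_mul, map_one, map_natCast]
    ring

theorem polyLaplacian_mem {P : RealPoly n} (hP : P ∈ bihomogeneousPoly n (α + 1) (β + 1)) :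
    polyLaplacian P ∈ bihomogeneousPoly n α β := by
  rw [polyLaplacian_apply]
  refine Submodule.sum_mem _ fun i _ => ⟨?_, ?_⟩
  · exact IsWeightedHomogeneous.pderiv (IsWeightedHomogeneous.pderiv hP.1 rfl) rfl
  · exact IsWeightedHomogeneous.pderiv (IsWeightedHomogeneous.pderiv hP.2 rfl) rfl

/-- One of the two kinds of variables does not occur, and each term of the Laplacian differentiates
once in each kind. These are the base cases of the decomposition. -/
theorem polyLaplacian_eq_zero {P : RealPoly n} (hP : P ∈ bihomogeneousPoly n α β)
    (h : α = 0 ∨ β = 0) : polyLaplacian P = 0 := by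
  rw [polyLaplacian_apply]
  refine Finset.sum_eq_zero fun i _ => ?_
  have hvar : ∀ j ∈ P.vars, ∃ d ∈ P.support, d j ≠ 0 := by
    intro j hj
    obtain ⟨d, hd, hd'⟩ := (mem_vars_iff_mem_support j).mp hj
    exact ⟨d, hd, Finsupp.mem_support_iff.mp hd'⟩
  rcases h with rfl | rfl
  · rw [pderiv_pderiv_comm, pderiv_eq_zero_of_notMem_vars (i := Sum.inl i), map_zero]
    intro hi
    obtain ⟨d, hd, hd'⟩ := hvar _ hi
    exact hd' (Finset.sum_eq_zero_iff.mp (degree_of_mem_support hP hd).1 i (Finset.mem_univ i))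
  · rw [pderiv_eq_zero_of_notMem_vars (i := Sum.inr i), map_zero]
    intro hi
    obtain ⟨d, hd, hd'⟩ := hvar _ hi
    exact hd' (Finset.sum_eq_zero_iff.mp (degree_of_mem_support hP hd).2 i (Finset.mem_univ i))

theorem realEval_mem_harmonics {P : RealPoly n} (hP : P ∈ bihomogeneousPoly n α β)
    (h : polyLaplacian P = 0) : realEval P ∈ harmonics n α β :=
  ⟨realEval_mem_bihomogeneous hP, fun z => by rw [laplacian_realEval, h]; simp⟩

variable (n) in
/-- The span of the products of powers of `|z|²` with harmonic polynomials, in bidegree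
`(α, β)`. -/
def harmonicSpan (α β : ℕ) : Submodule ℂ (RealPoly n) :=
  Submodule.span ℂ {P | ∃ (s α' β' : ℕ) (H : RealPoly n), H ∈ bihomogeneousPoly n α' β' ∧
    polyLaplacian H = 0 ∧ α' + s = α ∧ β' + s = β ∧ P = normSqPoly n ^ s * H}

theorem harmonicSpan_le : harmonicSpan n α β ≤ bihomogeneousPoly n α β := by
  refine Submodule.span_le.mpr ?_
  rintro _ ⟨s, α', β', H, hH, -, rfl, rfl, rfl⟩
  have := mul_mem_bihomogeneousPoly (pow_mem_bihomogeneousPoly normSqPoly_mem s) hH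
  simpa [add_comm] using this

/-- On `|z|^(2s) H` with `H` harmonic, multiplication by `|z|²` inverts the Laplacian up to a
constant, and `n > 0` keeps this constant non-zero even for `s = 0` and constant `H`. -/
theorem exists_polyLaplacian_eq (hn : 0 < n) {P : RealPoly n} (hP : P ∈ harmonicSpan n α β) :
    ∃ Q ∈ harmonicSpan n (α + 1) (β + 1), polyLaplacian Q = P := by
  induction hP using Submodule.span_induction with
  | mem P hP =>
    obtain ⟨s, α', β', H, hH, hH0, rfl, rfl, rfl⟩ := hP
    have h := polyLaplacian_normSqPoly_pow_mul hH s
    rw [hH0, mul_zero, zero_add] at h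
    have hne : (((s + 1) * (n + s + α' + β') : ℕ) : ℂ) ≠ 0 :=
      Nat.cast_ne_zero.mpr (Nat.mul_ne_zero (by omega) (by omega))
    refine ⟨(((s + 1) * (n + s + α' + β') : ℕ) : ℂ)⁻¹ • (normSqPoly n ^ (s + 1) * H),
      Submodule.smul_mem _ _ (Submodule.subset_span
        ⟨s + 1, α', β', H, hH, hH0, by ring, by ring, rfl⟩), ?_⟩
    rw [map_smul, h, smul_smul, inv_mul_cancel₀ hne, one_smul]
  | zero => exact ⟨0, Submodule.zero_mem _, map_zero _⟩
  | add P Q _ _ hP hQ =>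
    obtain ⟨P', hP', rfl⟩ := hP
    obtain ⟨Q', hQ', rfl⟩ := hQ
    exact ⟨P' + Q', Submodule.add_mem _ hP' hQ', map_add _ _ _⟩
  | smul c P _ hP =>
    obtain ⟨P', hP', rfl⟩ := hP
    exact ⟨c • P', Submodule.smul_mem _ c hP', map_smul _ _ _⟩

/-- The canonical decomposition of polynomials into products of powers of `|z|²` with harmonic
polynomials. -/
theorem bihomogeneousPoly_le_harmonicSpan (hn : 0 < n) (α β : ℕ) :
    bihomogeneousPoly n α β ≤ harmonicSpan n α β := by
  induction α generalizing β with
  | zero =>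
    intro P hP
    exact Submodule.subset_span
      ⟨0, 0, β, P, hP, polyLaplacian_eq_zero hP (Or.inl rfl), rfl, rfl, by simp⟩
  | succ α ih =>
    intro P hP
    cases β with
    | zero =>
      exact Submodule.subset_span
        ⟨0, α + 1, 0, P, hP, polyLaplacian_eq_zero hP (Or.inr rfl), rfl, rfl, by simp⟩
    | succ β =>
      -- The Laplacian of `P` has lower bidegree and so lies in the span by induction. A preimage
      -- `Q` inside the span has the same Laplacian as `P`, which makes `P - Q` harmonic.
      obtain ⟨Q, hQ, hQ'⟩ := exists_polyLaplacian_eq hn (ih β (polyLaplacian_mem hP))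
      rw [← sub_add_cancel P Q]
      refine Submodule.add_mem _ (Submodule.subset_span ⟨0, α + 1, β + 1, P - Q,
        Submodule.sub_mem _ hP (harmonicSpan_le hQ), ?_, rfl, rfl, by simp⟩) hQ
      rw [map_sub, hQ', sub_self]

end Bihomogeneous

/-- A geometric sum with ratio `ζ^m ≠ 1`. It replaces integration over the circle: for polynomials
only finitely many weights occur, so a large enough `N` isolates one of them exactly. -/
theorem sum_rootOfUnity_zpow {N : ℕ} {ζ : ℂ} (hζ : IsPrimitiveRoot ζ N) {m : ℤ} (hm : m ≠ 0)
    (hmN : |m| < N) : ∑ s ∈ Finset.range N, (ζ ^ s) ^ m = 0 := by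
  have h1 : ζ ^ m ≠ 1 := by
    intro h
    rw [hζ.zpow_eq_one_iff_dvd] at h
    exact hm (Int.eq_zero_of_abs_lt_dvd h hmN)
  have h2 : (ζ ^ m) ^ N = 1 := by
    rw [← zpow_natCast, ← _root_.zpow_mul, mul_comm, _root_.zpow_mul,
    zpow_natCast, hζ.pow_eq_one, _root_.one_zpow]
  have h3 := mul_neg_geom_sum (ζ ^ m) N
  rw [h2, sub_self] at h3
  have h4 := (mul_eq_zero.mp h3).resolve_left (sub_ne_zero.mpr h1.symm)
  rw [← h4]
  refine Finset.sum_congr rfl fun s _ => ?_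
  rw [← zpow_natCast ζ, ← zpow_natCast (ζ ^ m), ← _root_.zpow_mul, ← _root_.zpow_mul,
    mul_comm]

theorem pow_mul_conj_pow {w : ℂ} (hw : ‖w‖ = 1) (a b : ℕ) :
    w ^ a * conj w ^ b = w ^ ((a : ℤ) - b) := by
  have h0 : w ≠ 0 := by
    rintro rfl
    simp at hw
  have h1 : conj w = w⁻¹ := by
    rw [Complex.inv_def, Complex.normSq_eq_norm_sq, hw]
    simp
  rw [h1, inv_pow, zpow_sub₀ h0, zpow_natCast, zpow_natCast, div_eq_mul_inv]

/-! ### Zonal polynomials and the uniqueness of the zonal harmonic. -/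

section Zonal

open MvPolynomial

variable {n : ℕ} [NeZero n] {α β : ℕ}

/-- The stabilizer of `e₁` in `U(n)` acts transitively on the unit sphere of the orthogonal
complement of `e₁`. -/
theorem exists_unitary_fixing {j : Fin n} (hj : j ≠ 0) {w : Cn n} (hw : ‖w‖ = 1) (hw0 : w 0 = 0) :
    ∃ u : K n, act u.1 (e0 n) = e0 n ∧ act u.1 (EuclideanSpace.single j 1) = w := by
  classical
  let v : Fin n → Cn n := fun i => if i = 0 then e0 n else w
  have hin : inner ℂ (e0 n) w = 0 := by
    simp [e0, EuclideanSpace.inner_single_left, hw0]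
  have hin' : inner ℂ w (e0 n) = 0 := by
    rw [← inner_conj_symm, hin, map_zero]
  have ho : Orthonormal ℂ (Set.domRestrict {(0 : Fin n), j} v) := by
    rw [orthonormal_iff_ite]
    rintro ⟨a, ha⟩ ⟨b, hb⟩
    simp only [Set.mem_insert_iff, Set.mem_singleton_iff] at ha hb
    rcases ha with rfl | rfl <;> rcases hb with rfl | rfl <;>
      simp [Set.domRestrict, v, inner_self_eq_norm_sq_to_K, hw, norm_e0, hj, hj.symm, hin, hin']
  obtain ⟨b, hb⟩ := ho.exists_orthonormalBasis_extension_of_card_eq (by simp)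
  let u : Matrix (Fin n) (Fin n) ℂ := (EuclideanSpace.basisFun (Fin n) ℂ).toBasis.toMatrix b
  have hu : ∀ i, act u (EuclideanSpace.single i 1) = b i := by
    intro i
    ext l
    rw [act_apply]
    simp [u, Module.Basis.toMatrix_apply]
  refine ⟨⟨u, OrthonormalBasis.toMatrix_orthonormalBasis_mem_unitary _ _⟩, ?_, ?_⟩
  · exact (hu 0).trans ((hb 0 (by simp)).trans (by simp [v]))
  · exact (hu j).trans ((hb j (by simp)).trans (by simp [v, hj]))

/-- The point `(x, 0, …, t, …, 0)`. -/
def planePoint (j : Fin n) (x t : ℂ) : Cn n := x • e0 n + t • EuclideanSpace.single j 1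

theorem planePoint_zero {j : Fin n} (hj : j ≠ 0) (x t : ℂ) : planePoint j x t 0 = x := by
  simp [planePoint, e0, hj.symm]

theorem planePoint_self {j : Fin n} (hj : j ≠ 0) (x t : ℂ) : planePoint j x t j = t := by
  simp [planePoint, e0, hj]

theorem planePoint_of_ne {i j : Fin n} (h0 : i ≠ 0) (hj : i ≠ j) (x t : ℂ) :
    planePoint j x t i = 0 := by
  simp [planePoint, e0, h0, hj]

theorem norm_planePoint_sq {j : Fin n} (hj : j ≠ 0) (x t : ℂ) :
    ‖planePoint j x t‖ ^ 2 = ‖x‖ ^ 2 + ‖t‖ ^ 2 := by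
  rw [EuclideanSpace.norm_sq_eq, Finset.sum_eq_add (0 : Fin n) j hj.symm, planePoint_zero hj,
    planePoint_self hj]
  · intro i _ hi
    simp [planePoint_of_ne hi.1 hi.2]
  · simp
  · simp

/-- A function on `ℂⁿ` is zonal if it is invariant under the stabilizer of `e₁` in `U(n)`. -/
def IsZonal (f : Cn n → ℂ) : Prop :=
  ∀ u : K n, act u.1 (e0 n) = e0 n → ∀ z, f (act u.1 z) = f z

/-- The stabilizer of `e₁` contains an element that multiplies the `j`-th basis vector by the phase
`c`. -/
theorem IsZonal.planePoint_mul {f : Cn n → ℂ} (hf : IsZonal f) {j : Fin n} (hj : j ≠ 0) {c : ℂ}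
    (hc : ‖c‖ = 1) (x t : ℂ) : f (planePoint j x (c * t)) = f (planePoint j x t) := by
  obtain ⟨u, h1, h2⟩ := exists_unitary_fixing hj (w := c • EuclideanSpace.single j 1)
    (by simp [norm_smul, hc]) (by simp [hj.symm])
  have : act u.1 (planePoint j x t) = planePoint j x (c * t) := by
    rw [planePoint, map_add, map_smul, map_smul, h1, h2, smul_smul, mul_comm t]
    rfl
  rw [← this, hf u h1]

/-- The component of `z` orthogonal to `e₁` can be rotated onto the `j`-th axis without moving `e₁`.
A zonal function is thus determined by its values on one plane. -/
theorem IsZonal.eq_planePoint {f : Cn n → ℂ} (hf : IsZonal f) {j : Fin n} (hj : j ≠ 0)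
    (z : Cn n) : f z = f (planePoint j (z 0) ‖z - z 0 • e0 n‖) := by
  set w := z - z 0 • e0 n with hw
  have hw0 : w 0 = 0 := by simp [hw, e0]
  have hz : z = z 0 • e0 n + w := by rw [hw]; abel
  by_cases h : w = 0
  · rw [h, norm_zero, planePoint, Complex.ofReal_zero, zero_smul, add_zero]
    conv_lhs => rw [hz, h, add_zero]
  · obtain ⟨u, h1, h2⟩ := exists_unitary_fixing hj (w := ((‖w‖⁻¹ : ℝ) : ℂ) • w)
      (by rw [norm_smul]; simp [h]) (by simp [hw0])
    have : act u.1 (planePoint j (z 0) ‖w‖) = z := by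
      rw [planePoint, map_add, map_smul, map_smul, h1, h2, smul_smul]
      conv_rhs => rw [hz]
      simp [h]
    rw [← hf u h1 (planePoint j (z 0) ‖w‖), this]

theorem norm_sub_sq_zonal (z : Cn n) : ‖z - z 0 • e0 n‖ ^ 2 = ‖z‖ ^ 2 - ‖z 0‖ ^ 2 := by
  have h : inner ℂ (z - z 0 • e0 n) (z 0 • e0 n) = 0 := by
    simp [e0, EuclideanSpace.inner_single_right]
  have h2 := norm_add_sq_eq_norm_sq_add_norm_sq_of_inner_eq_zero (𝕜 := ℂ) _ _ h
  rw [sub_add_cancel, norm_smul, norm_e0, mul_one] at h2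
  nlinarith

/-- A monomial either contains a coordinate that vanishes on the plane, or involves only the
coordinates `0` and `j`. The alternative records the reason as well as the value, because the value
`0` alone does not tell the cases apart. -/
theorem prod_planePoint {j : Fin n} (hj : j ≠ 0) (x t : ℂ) (a : Fin n → ℕ) :
    ∏ i, planePoint j x t i ^ a i = 0 ∧ (∃ i, i ≠ 0 ∧ i ≠ j ∧ a i ≠ 0) ∨
    ∏ i, planePoint j x t i ^ a i = x ^ a 0 * t ^ a j ∧ ∑ i, a i = a 0 + a j := by
  by_cases h : ∃ i, i ≠ 0 ∧ i ≠ j ∧ a i ≠ 0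
  · obtain ⟨i, h0, h1, h2⟩ := h
    refine Or.inl ⟨Finset.prod_eq_zero (Finset.mem_univ i) ?_, i, h0, h1, h2⟩
    rw [planePoint_of_ne h0 h1, zero_pow h2]
  · push Not at h
    refine Or.inr ⟨?_, ?_⟩
    · rw [Finset.prod_eq_mul (0 : Fin n) j hj.symm, planePoint_zero hj, planePoint_self hj]
      · intro i _ hi
        rw [h i hi.1 hi.2, pow_zero]
      · simp
      · simp
    · rw [Finset.sum_eq_add (0 : Fin n) j hj.symm]
      · intro i _ hi
        rw [h i hi.1 hi.2]
      · simp
      · simp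

/-- The functions `x^(α - i) conj x^(β - i) |t|^(2i)`. -/
def planeMonomial (α β i : ℕ) (q : ℂ × ℂ) : ℂ :=
  q.1 ^ (α - i) * conj q.1 ^ (β - i) * ((‖q.2‖ ^ 2 : ℝ) : ℂ) ^ i

/-- Averaging over the rotations of `t` kills `t^a conj t^b` unless `a = b`, since `|a - b| ≤ α + β
< N`. The surviving monomials are powers of `|t|²` times a monomial in `x` and `conj x` with
prescribed degrees. -/
theorem average_planePoint_mem {j : Fin n} (hj : j ≠ 0) {N : ℕ} {ζ : ℂ} (hζ : IsPrimitiveRoot ζ N)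
    (hN : α + β < N) {P : RealPoly n} (hP : P ∈ bihomogeneousPoly n α β) :
    (fun q : ℂ × ℂ => ∑ s ∈ Finset.range N, realEval P (planePoint j q.1 (ζ ^ s * q.2))) ∈
      Submodule.span ℂ (planeMonomial α β '' (Finset.range (min α β + 1) : Set ℕ)) := by
  have hζ1 : ‖ζ‖ = 1 := hζ.norm'_eq_one (by omega)
  refine bihomogeneousPoly_induction (p := fun P => (fun q : ℂ × ℂ =>
    ∑ s ∈ Finset.range N, realEval P (planePoint j q.1 (ζ ^ s * q.2))) ∈ _)
    (fun d c h1 h2 => ?_) ?_ (fun P Q hP hQ => ?_) hP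
  · by_cases hd : (∃ i, i ≠ 0 ∧ i ≠ j ∧ d (Sum.inl i) ≠ 0) ∨ ∃ i, i ≠ 0 ∧ i ≠ j ∧ d (Sum.inr i) ≠ 0
    · convert Submodule.zero_mem _ using 1
      funext q
      refine Finset.sum_eq_zero fun s _ => ?_
      rw [realEval_monomial]
      rcases hd with ⟨i, hi0, hij, hi⟩ | ⟨i, hi0, hij, hi⟩
      · rw [Finset.prod_eq_zero (Finset.mem_univ i)
          (by rw [planePoint_of_ne hi0 hij, zero_pow hi])]
        simp
      · rw [Finset.prod_eq_zero (f := fun i => conj (planePoint j q.1 (ζ ^ s * q.2) i) ^ _)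
          (Finset.mem_univ i) (by rw [planePoint_of_ne hi0 hij, map_zero, zero_pow hi])]
        simp
    · rw [not_or] at hd
      have hl : ∀ x t : ℂ, ∏ i, planePoint j x t i ^ d (Sum.inl i) =
          x ^ d (Sum.inl 0) * t ^ d (Sum.inl j) := fun x t =>
        ((prod_planePoint hj x t (fun i => d (Sum.inl i))).resolve_left fun h => hd.1 h.2).1
      have hr : ∀ x t : ℂ, ∏ i, conj (planePoint j x t i) ^ d (Sum.inr i) =
          conj x ^ d (Sum.inr 0) * conj t ^ d (Sum.inr j) := fun x t => by
        have := ((prod_planePoint hj x t (fun i => d (Sum.inr i))).resolve_left fun h => hd.2 h.2).1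
        have h3 := congrArg (starRingEnd ℂ) this
        simpa only [map_prod, map_mul, map_pow] using h3
      -- Only the degree identity is needed here, and it does not depend on the point, so `0, 0`
      -- serves.
      have hla := ((prod_planePoint hj 0 0 (fun i => d (Sum.inl i))).resolve_left
        fun h => hd.1 h.2).2
      have hra := ((prod_planePoint hj 0 0 (fun i => d (Sum.inr i))).resolve_left
        fun h => hd.2 h.2).2
      rw [h1] at hla
      rw [h2] at hra
      set a := d (Sum.inl j)
      set b := d (Sum.inr j)
      have hsum : ∀ q : ℂ × ℂ, ∑ s ∈ Finset.range N,
          realEval (monomial d c) (planePoint j q.1 (ζ ^ s * q.2)) =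
          c * (q.1 ^ d (Sum.inl 0) * conj q.1 ^ d (Sum.inr 0)) * (q.2 ^ a * conj q.2 ^ b) *
            ∑ s ∈ Finset.range N, (ζ ^ s) ^ ((a : ℤ) - b) := by
        intro q
        rw [Finset.mul_sum]
        refine Finset.sum_congr rfl fun s _ => ?_
        rw [realEval_monomial, hl, hr, ← pow_mul_conj_pow (by rw [norm_pow, hζ1, one_pow]),
          map_mul, mul_pow, mul_pow]
        ring
      simp only [hsum]
      by_cases hab : a = b
      · have hmem : planeMonomial α β a ∈
            Submodule.span ℂ (planeMonomial α β '' (Finset.range (min α β + 1) : Set ℕ)) := by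
          refine Submodule.subset_span ⟨a, ?_, rfl⟩
          rw [Finset.coe_range, Set.mem_Iio]
          omega
        convert Submodule.smul_mem _ (c * N) hmem using 1
        funext q
        have e1 : d (Sum.inl 0) = α - a := by omega
        have e2 : d (Sum.inr 0) = β - a := by omega
        have e3 : q.2 ^ a * conj q.2 ^ a = ((‖q.2‖ ^ 2 : ℝ) : ℂ) ^ a := by
          rw [← mul_pow, Complex.mul_conj', Complex.ofReal_pow]
        rw [← hab, sub_self]
        simp only [zpow_zero, Finset.sum_const, Finset.card_range, nsmul_eq_mul, mul_one,
          Pi.smul_apply, smul_eq_mul, planeMonomial, e1, e2, e3]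
        ring
      · rw [sum_rootOfUnity_zpow hζ (by omega) (by rw [abs_lt]; constructor <;> omega)]
        simp only [mul_zero]
        exact Submodule.zero_mem _
  · simp only [realEval_zero, Finset.sum_const_zero]
    exact Submodule.zero_mem _
  · simp only [realEval_add, Finset.sum_add_distrib]
    exact Submodule.add_mem _ hP hQ

/-- The zonal polynomials `z₁^(α - i) conj z₁^(β - i) |z|^(2i)`. -/
def zonalPoly (n : ℕ) [NeZero n] (α β i : ℕ) : RealPoly n :=
  normSqPoly n ^ i * (X (Sum.inl 0) ^ (α - i) * X (Sum.inr 0) ^ (β - i))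

theorem realEval_zonalPoly (i : ℕ) (z : Cn n) : realEval (zonalPoly n α β i) z =
    ((‖z‖ ^ 2 : ℝ) : ℂ) ^ i * (z 0 ^ (α - i) * conj (z 0) ^ (β - i)) := by
  simp [zonalPoly, realEval_normSqPoly]

/-- On the plane a zonal polynomial equals its own average over rotations of `t`, hence is a
combination of the functions `planeMonomial`. Substituting `x = z₁` and `|t|² = |z|² - |z₁|²` gives
the result on all of `ℂⁿ`. -/
theorem exists_zonalPoly (hn : 2 ≤ n) {f : Cn n → ℂ} (hf : f ∈ bihomogeneous n α β)
    (hz : IsZonal f) : ∃ b : ℕ → ℂ,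
      f = realEval (∑ i ∈ Finset.range (min α β + 1), b i • zonalPoly n α β i) := by
  obtain ⟨P, hP, rfl⟩ := exists_realEval hf
  have hj : (⟨1, hn⟩ : Fin n) ≠ 0 := by
    intro h
    have := congrArg Fin.val h
    simp at this
  set j : Fin n := ⟨1, hn⟩
  have hN : α + β + 1 ≠ 0 := by omega
  have hζ := Complex.isPrimitiveRoot_exp (α + β + 1) hN
  set ζ := Complex.exp (2 * Real.pi * Complex.I / (α + β + 1 : ℕ))
  have hζ1 : ‖ζ‖ = 1 := hζ.norm'_eq_one hN
  have hmem := average_planePoint_mem hj hζ (Nat.lt_succ_self _) hP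
  let T : (ℂ × ℂ → ℂ) →ₗ[ℂ] (Cn n → ℂ) :=
    LinearMap.funLeft ℂ ℂ (fun z : Cn n => (z 0, (‖z - z 0 • e0 n‖ : ℂ)))
  let g : ℕ → Cn n → ℂ := fun i => realEval (zonalPoly n α β i)
  have hT : Submodule.map T (Submodule.span ℂ
      (planeMonomial α β '' (Finset.range (min α β + 1) : Set ℕ))) ≤
      Submodule.span ℂ (g '' (Finset.range (min α β + 1) : Set ℕ)) := by
    rw [Submodule.map_span, Submodule.span_le]
    rintro _ ⟨_, ⟨i, hi, rfl⟩, rfl⟩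
    have hi' : i ≤ min α β := by
      rw [Finset.coe_range, Set.mem_Iio] at hi
      omega
    -- The binomial expansion of `(|z|² - z₁ conj z₁)^i`; each factor `z₁ conj z₁` raises both
    -- exponents of the monomial in `z₁` by one.
    have : T (planeMonomial α β i) =
        ∑ l ∈ Finset.range (i + 1), ((-1) ^ (i - l) * (i.choose l : ℂ)) • g l := by
      funext z
      have e1 : (((‖z - z 0 • e0 n‖ : ℝ) ^ 2 : ℝ) : ℂ) =
          ((‖z‖ ^ 2 : ℝ) : ℂ) + -(z 0 * conj (z 0)) := by
        rw [norm_sub_sq_zonal, Complex.mul_conj']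
        push_cast
        ring
      change z 0 ^ (α - i) * conj (z 0) ^ (β - i) *
        ((‖((‖z - z 0 • e0 n‖ : ℝ) : ℂ)‖ ^ 2 : ℝ) : ℂ) ^ i = _
      rw [Complex.norm_real, norm_norm, e1, add_pow, Finset.mul_sum, Finset.sum_apply]
      refine Finset.sum_congr rfl fun l hl => ?_
      rw [Finset.mem_range] at hl
      simp only [Pi.smul_apply, smul_eq_mul, g, realEval_zonalPoly]
      have e2 : α - l = (α - i) + (i - l) := by omega
      have e3 : β - l = (β - i) + (i - l) := by omega
      rw [e2, e3, pow_add, pow_add, neg_pow, mul_pow]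
      ring
    rw [this]
    refine Submodule.sum_mem _ fun l hl => Submodule.smul_mem _ _ (Submodule.subset_span ⟨l, ?_, rfl⟩)
    rw [Finset.mem_range] at hl
    rw [Finset.coe_range, Set.mem_Iio]
    omega
  have hmem2 := hT (Submodule.mem_map_of_mem hmem)
  have hfin : ((α + β + 1 : ℕ) : ℂ) • realEval P ∈
      Submodule.span ℂ (g '' (Finset.range (min α β + 1) : Set ℕ)) := by
    convert hmem2 using 1
    funext z
    change _ = ∑ s ∈ Finset.range (α + β + 1),
      realEval P (planePoint j (z 0) (ζ ^ s * (‖z - z 0 • e0 n‖ : ℂ)))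
    -- Zonality makes all `α + β + 1` terms of the average equal to the value at `z`.
    have e1 : ∀ s : ℕ, realEval P (planePoint j (z 0) (ζ ^ s * (‖z - z 0 • e0 n‖ : ℂ))) =
        realEval P z := fun s => by
      rw [hz.planePoint_mul hj (by rw [norm_pow, hζ1, one_pow]), ← hz.eq_planePoint hj z]
    simp only [e1, Finset.sum_const, Finset.card_range, nsmul_eq_mul, Pi.smul_apply, smul_eq_mul]
  have hP' := Submodule.smul_mem _ ((α + β + 1 : ℕ) : ℂ)⁻¹ hfin
  rw [smul_smul, inv_mul_cancel₀ (Nat.cast_ne_zero.mpr hN), one_smul] at hP'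
  obtain ⟨b, hb⟩ := (Submodule.mem_span_image_finset_iff_exists_fun ℂ).mp hP'
  refine ⟨fun i => if h : i ∈ Finset.range (min α β + 1) then b ⟨i, h⟩ else 0, ?_⟩
  rw [← hb]
  funext z
  rw [realEval_sum, ← Finset.sum_coe_sort (Finset.range (min α β + 1)), Finset.sum_apply]
  refine Finset.sum_congr rfl fun i _ => ?_
  rw [realEval_smul]
  beta_reduce
  rw [dif_pos i.2]
  rfl

theorem polyLaplacian_X_pow_mul (a b : ℕ) :
    polyLaplacian (X (Sum.inl 0) ^ a * X (Sum.inr 0) ^ b : RealPoly n) =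
      ((a * b : ℕ) : ℂ) • (X (Sum.inl 0) ^ (a - 1) * X (Sum.inr 0) ^ (b - 1)) := by
  rw [polyLaplacian_apply, Finset.sum_eq_single 0]
  · simp only [Derivation.leibniz, Derivation.leibniz_pow, pderiv_X, smul_eq_mul, nsmul_eq_mul,
      Pi.single_apply, reduceCtorEq, if_true, if_false, mul_zero, add_zero,
      Derivation.map_natCast, mul_one, zero_add, smul_eq_C_mul]
    push_cast
    simp only [map_mul, map_natCast]
    ring
  · intro i _ hi
    have : ((Sum.inr 0 : Fin n ⊕ Fin n) = Sum.inr i) = False := by simpa using hi.symm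
    simp [Derivation.leibniz, Derivation.leibniz_pow, pderiv_X, this]
  · simp

/-- On the slice `z₁ = 1` the Laplacian depends only on `|z|²`, which turns harmonicity into an
identity of polynomials in one variable. The truncated `i - 1` at `i = 0` is harmless because its
coefficient has the factor `i`. -/
theorem realEval_polyLaplacian_zonalPoly {i : ℕ} (hα : i ≤ α) (hβ : i ≤ β) {z : Cn n}
    (hz : z 0 = 1) : realEval (polyLaplacian (zonalPoly n α β i)) z =
      (((α - i) * (β - i) : ℕ) : ℂ) * ((‖z‖ ^ 2 : ℝ) : ℂ) ^ i +
        ((i * (n + (α + β) - (i + 1)) : ℕ) : ℂ) * ((‖z‖ ^ 2 : ℝ) : ℂ) ^ (i - 1) := by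
  cases i with
  | zero =>
    rw [zonalPoly, pow_zero, one_mul, polyLaplacian_X_pow_mul]
    simp [hz]
  | succ s =>
    have hm : (X (Sum.inl 0) ^ (α - (s + 1)) * X (Sum.inr 0) ^ (β - (s + 1)) : RealPoly n) ∈
        bihomogeneousPoly n (α - (s + 1)) (β - (s + 1)) := by
      simpa using mul_mem_bihomogeneousPoly
        (pow_mem_bihomogeneousPoly (X_inl_mem_bihomogeneousPoly (n := n) 0) (α - (s + 1)))
        (pow_mem_bihomogeneousPoly (X_inr_mem_bihomogeneousPoly (n := n) 0) (β - (s + 1)))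
    have e : n + s + (α - (s + 1)) + (β - (s + 1)) = n + (α + β) - (s + 1 + 1) := by
      omega
    rw [zonalPoly, polyLaplacian_normSqPoly_pow_mul hm, polyLaplacian_X_pow_mul, e]
    simp [hz, realEval_normSqPoly]

/-- A harmonic polynomial in the span of the zonal polynomials vanishes if its first coefficient
does. -/
theorem zonal_coeff_eq_zero (hn : 2 ≤ n) (b : ℕ → ℂ)
    (hL : ∀ z : Cn n, Δ (realEval (∑ i ∈ Finset.range (min α β + 1), b i • zonalPoly n α β i)) z = 0)
    (hb : b 0 = 0) : ∀ i ≤ min α β, b i = 0 := by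
  have hj : (⟨1, hn⟩ : Fin n) ≠ 0 := by
    intro h
    have := congrArg Fin.val h
    simp at this
  set m := min α β with hm
  -- A quarter of the Laplacian on the slice `z₁ = 1`, as a polynomial in `|z|²`. The second sum is
  -- shifted by one, so that the coefficient of `X^i` relates `b i` and `b (i + 1)`.
  let q : Polynomial ℂ :=
    ∑ i ∈ Finset.range (m + 1),
      Polynomial.C (b i * (((α - i) * (β - i) : ℕ) : ℂ)) * Polynomial.X ^ i +
    ∑ i ∈ Finset.range m,
      Polynomial.C (b (i + 1) * (((i + 1) * (n + (α + β) - (i + 2)) : ℕ) : ℂ)) * Polynomial.X ^ i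
  have hroot : ∀ t : ℝ, 0 ≤ t → q.IsRoot ((1 + t ^ 2 : ℝ) : ℂ) := by
    intro t ht
    let z : Cn n := planePoint ⟨1, hn⟩ 1 t
    have hz0 : z 0 = 1 := planePoint_zero hj 1 t
    have hz : ‖z‖ ^ 2 = 1 + t ^ 2 := by
      rw [norm_planePoint_sq hj]
      simp
    have h := hL z
    rw [laplacian_realEval] at h
    replace h := (mul_eq_zero.mp h).resolve_left (by norm_num)
    rw [map_sum, realEval_sum] at h
    have h2 : ∀ i ∈ Finset.range (m + 1), realEval (polyLaplacian (b i • zonalPoly n α β i)) z =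
        b i * (((α - i) * (β - i) : ℕ) : ℂ) * ((1 + t ^ 2 : ℝ) : ℂ) ^ i +
        b i * ((i * (n + (α + β) - (i + 1)) : ℕ) : ℂ) * ((1 + t ^ 2 : ℝ) : ℂ) ^ (i - 1) := by
      intro i hi
      rw [Finset.mem_range] at hi
      rw [map_smul, realEval_smul, realEval_polyLaplacian_zonalPoly (by omega) (by omega) hz0, hz]
      ring
    rw [Finset.sum_congr rfl h2, Finset.sum_add_distrib, Finset.sum_range_succ' (n := m)
      (f := fun i => b i * ((i * (n + (α + β) - (i + 1)) : ℕ) : ℂ) * _ ^ (i - 1))] at h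
    simp only [zero_mul, Nat.cast_zero, mul_zero, add_zero, Nat.add_sub_cancel] at h
    rw [Polynomial.IsRoot.def, Polynomial.eval_add, Polynomial.eval_finsetSum,
      Polynomial.eval_finsetSum]
    simp only [Polynomial.eval_mul, Polynomial.eval_C, Polynomial.eval_pow, Polynomial.eval_X]
    exact h
  have hq : q = 0 := by
    refine Polynomial.eq_zero_of_infinite_isRoot q ?_
    -- The points `(1, t, 0, …)` of the slice have `|z|² = 1 + t²`, which takes infinitely many
    -- values.
    refine Set.Infinite.mono (s := (fun t : ℝ => ((1 + t ^ 2 : ℝ) : ℂ)) '' Set.Ici 0) ?_ ?_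
    · rintro _ ⟨t, ht, rfl⟩
      exact hroot t ht
    · refine Set.Infinite.image ?_ (Set.Ici_infinite 0)
      intro s hs t ht h
      have h1 : 1 + s ^ 2 = 1 + t ^ 2 := Complex.ofReal_injective h
      exact (pow_left_inj₀ hs ht two_ne_zero).mp (by linarith)
  intro i
  induction i with
  | zero => exact fun _ => hb
  | succ i ih =>
    intro hi
    have hc : q.coeff i = 0 := by rw [hq, Polynomial.coeff_zero]
    simp only [q, Polynomial.coeff_add, Polynomial.finsetSum_coeff,
      Polynomial.coeff_C_mul_X_pow, Finset.sum_ite_eq, Finset.mem_range] at hc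
    -- The recursion reads `(α-i)(β-i) b i + (i+1)(n+α+β-i-2) b (i+1) = 0`. For `i < min α β` the
    -- factor of `b (i+1)` is non-zero, so `b i = 0` propagates.
    rw [if_pos (by omega), if_pos (by omega), ih (by omega), zero_mul, zero_add] at hc
    refine (mul_eq_zero.mp hc).resolve_right (Nat.cast_ne_zero.mpr (Nat.mul_ne_zero (by omega) ?_))
    omega

/-- The zonal harmonics of a given bidegree form a space of dimension at most one. -/
theorem zonal_dependent (hn : 2 ≤ n) {f g : Cn n → ℂ} (hf : f ∈ harmonics n α β)
    (hg : g ∈ harmonics n α β) (hfz : IsZonal f) (hgz : IsZonal g) :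
    ∃ s t : ℂ, (s ≠ 0 ∨ t ≠ 0) ∧ s • f + t • g = 0 := by
  obtain ⟨b, hb⟩ := exists_zonalPoly hn hf.1 hfz
  obtain ⟨c, hc⟩ := exists_zonalPoly hn hg.1 hgz
  -- A zonal harmonic is determined by its coefficient of index `0`, so any combination that cancels
  -- this coefficient vanishes.
  have main : ∀ s t : ℂ, s * b 0 + t * c 0 = 0 → s • f + t • g = 0 := by
    intro s t h
    have e : s • f + t • g = realEval (∑ i ∈ Finset.range (min α β + 1),
        (s * b i + t * c i) • zonalPoly n α β i) := by
      rw [hb, hc]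
      funext z
      simp only [Pi.add_apply, Pi.smul_apply, smul_eq_mul, realEval_sum, realEval_smul,
        Finset.mul_sum, ← Finset.sum_add_distrib]
      exact Finset.sum_congr rfl fun i _ => by ring
    have hmem : s • f + t • g ∈ harmonics n α β :=
      Submodule.add_mem _ (Submodule.smul_mem _ s hf) (Submodule.smul_mem _ t hg)
    have h0 := zonal_coeff_eq_zero hn (α := α) (β := β) (fun i => s * b i + t * c i)
      (by rw [← e]; exact hmem.2) h
    rw [e]
    funext z
    rw [realEval_sum]
    refine Finset.sum_eq_zero fun i hi => ?_
    rw [Finset.mem_range] at hi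
    rw [h0 i (by omega), zero_smul, realEval_zero]
  by_cases h : b 0 = 0
  · exact ⟨1, 0, Or.inl one_ne_zero, main 1 0 (by simp [h])⟩
  · exact ⟨c 0, -b 0, Or.inr (neg_ne_zero.mpr h), main _ _ (by ring)⟩

end Zonal

/-! ### Irreducibility and pairwise inequivalence of the spaces `H^{α,β}`. -/

section HarmonicsRep

open MvPolynomial

/-- Evaluation of polynomials in `z` and its conjugate as a linear map. -/
def realEvalLinear (n : ℕ) : RealPoly n →ₗ[ℂ] (Cn n → ℂ) where
  toFun := realEval
  map_add' := coe_realEval_add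
  map_smul' c P := funext (realEval_smul c P)

/-- This bounds the total degree and so gives finite dimension, on which completeness, orthogonal
complements and Schur's lemma rely. -/
theorem bihomogeneous_le_map {n α β : ℕ} : bihomogeneous n α β ≤
    Submodule.map (realEvalLinear n) (restrictTotalDegree (Fin n ⊕ Fin n) ℂ (α + β)) := by
  intro f hf
  obtain ⟨P, hP, rfl⟩ := exists_realEval hf
  refine ⟨P, ?_, rfl⟩
  refine (mem_restrictTotalDegree _ _ _).mpr (Finset.sup_le fun d hd => ?_)
  obtain ⟨h1, h2⟩ := degree_of_mem_support hP hd
  rw [Finsupp.sum_fintype _ _ (fun _ => rfl), Fintype.sum_sum_type, h1, h2]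

variable {n : ℕ} [NeZero n] {α β : ℕ}

theorem Harmonics.add_apply (f g : Harmonics n α β) (z : Cn n) : (f + g) z = f z + g z := rfl

theorem Harmonics.smul_apply (c : ℂ) (f : Harmonics n α β) (z : Cn n) : (c • f) z = c * f z := rfl

theorem Harmonics.zero_apply (z : Cn n) : (0 : Harmonics n α β) z = 0 := rfl

theorem harmonicsRep_apply (u : K n) (f : Harmonics n α β) (z : Cn n) :
    harmonicsRep n α β u f z = f (act (u⁻¹ : K n).1 z) := rfl

theorem inner_harmonics (f g : Harmonics n α β) :
    inner ℂ f g = ∫ u, conj (f (act u.1 (e0 n))) * g (act u.1 (e0 n)) ∂(haarK n) := rfl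

/-- Left invariance of the Haar measure of `U(n)`. -/
theorem inner_harmonicsRep (u : K n) (f g : Harmonics n α β) :
    inner ℂ (harmonicsRep n α β u f) (harmonicsRep n α β u g) = inner ℂ f g := by
  rw [inner_harmonics, inner_harmonics,
    ← integral_mul_left_eq_self (fun v : K n => conj (f (act v.1 (e0 n))) * g (act v.1 (e0 n))) u⁻¹]
  refine integral_congr_ae (Filter.Eventually.of_forall fun v => ?_)
  simp only [harmonicsRep_apply, Submonoid.coe_mul, act_mul]

theorem inner_harmonicsRep_left (u : K n) (f g : Harmonics n α β) :
    inner ℂ (harmonicsRep n α β u f) g = inner ℂ f (harmonicsRep n α β u⁻¹ g) := by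
  rw [← inner_harmonicsRep u f, ← Module.End.mul_apply, ← map_mul, mul_inv_cancel, map_one,
    Module.End.one_apply]

instance finiteDimensional_harmonics : FiniteDimensional ℂ (Harmonics n α β) := by
  have : FiniteDimensional ℂ (bihomogeneous n α β) :=
    Submodule.finiteDimensional_of_le bihomogeneous_le_map
  have h : harmonics n α β ≤ bihomogeneous n α β := fun f hf => hf.1
  exact (Submodule.finiteDimensional_of_le h : FiniteDimensional ℂ (harmonics n α β))

instance completeSpace_harmonics : CompleteSpace (Harmonics n α β) :=
  FiniteDimensional.complete ℂ _

/-- Evaluation at `e₁`. -/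
def evalE0 (n α β : ℕ) [NeZero n] : Harmonics n α β →ₗ[ℂ] ℂ where
  toFun f := f (e0 n)
  map_add' _ _ := rfl
  map_smul' _ _ := rfl

theorem exists_act_e0_ne_zero {f : Harmonics n α β} (hf : f ≠ 0) :
    ∃ u : K n, f (act u.1 (e0 n)) ≠ 0 := by
  by_contra! h
  refine hf (inner_self_eq_zero (𝕜 := ℂ).mp ?_)
  rw [inner_harmonics]
  simp [h]

/-- A non-zero invariant subspace contains a zonal harmonic that does not vanish at `e₁`. -/
theorem exists_zonal_mem {V : Submodule ℂ (Harmonics n α β)}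
    (hV : ∀ u, ∀ f ∈ V, harmonicsRep n α β u f ∈ V) (hV0 : V ≠ ⊥) :
    ∃ v ∈ V, v ≠ 0 ∧ IsZonal v := by
  obtain ⟨f, hf, hf0⟩ := V.ne_bot_iff.mp hV0
  obtain ⟨u, hu⟩ := exists_act_e0_ne_zero hf0
  -- The zonal vector is the Riesz representative of evaluation at `e₁` on `V`. It is non-zero
  -- because `V` contains a translate of `f` that does not vanish at `e₁`.
  let l : V →L[ℂ] ℂ := LinearMap.toContinuousLinearMap ((evalE0 n α β).domRestrict V)
  let v : V := (InnerProductSpace.toDual ℂ V).symm l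
  have hv : ∀ g ∈ V, inner ℂ (v : Harmonics n α β) g = g (e0 n) := by
    intro g hg
    exact InnerProductSpace.toDual_symm_apply (x := (⟨g, hg⟩ : V)) (y := l)
  refine ⟨v, v.2, ?_, ?_⟩
  · intro h
    have := hv _ (hV u⁻¹ f hf)
    rw [h, inner_zero_left, harmonicsRep_apply, inv_inv] at this
    exact hu this.symm
  · intro w hw z
    -- Evaluation at `e₁` is invariant under the stabilizer of `e₁`, hence so is its representative:
    -- the difference lies in `V` and is orthogonal to `V`.
    have hw' : harmonicsRep n α β w⁻¹ v = v := by
      rw [← sub_eq_zero, ← inner_self_eq_zero (𝕜 := ℂ)]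
      have hmem : harmonicsRep n α β w⁻¹ v - v ∈ V := V.sub_mem (hV _ _ v.2) v.2
      have h3 : ∀ g ∈ V, inner ℂ (harmonicsRep n α β w⁻¹ v - (v : Harmonics n α β)) g = 0 := by
        intro g hg
        rw [inner_sub_left, inner_harmonicsRep_left, hv _ hg, hv _ (hV _ _ hg), inv_inv,
          harmonicsRep_apply, sub_eq_zero]
        conv_lhs => rw [← hw]
        rw [← act_mul, ← Submonoid.coe_mul, inv_mul_cancel, Submonoid.coe_one, act_one]
      exact h3 _ hmem
    have h4 : harmonicsRep n α β w⁻¹ v z = (v : Harmonics n α β) z := by rw [hw']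
    rwa [harmonicsRep_apply, inv_inv] at h4

/-- The harmonic polynomial `z₁^α conj z_j^β`. -/
def extremal (j : Fin n) (α β : ℕ) : RealPoly n := X (Sum.inl 0) ^ α * X (Sum.inr j) ^ β

theorem extremal_mem (j : Fin n) : extremal j α β ∈ bihomogeneousPoly n α β := by
  simpa [extremal] using mul_mem_bihomogeneousPoly
    (pow_mem_bihomogeneousPoly (X_inl_mem_bihomogeneousPoly (n := n) 0) α)
    (pow_mem_bihomogeneousPoly (X_inr_mem_bihomogeneousPoly (n := n) j) β)

theorem polyLaplacian_extremal {j : Fin n} (hj : j ≠ 0) :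
    polyLaplacian (extremal j α β) = 0 := by
  rw [polyLaplacian_apply]
  refine Finset.sum_eq_zero fun i _ => ?_
  by_cases hi : i = 0
  · subst hi
    simp [extremal, Derivation.leibniz, Derivation.leibniz_pow, pderiv_X, hj]
  · rw [pderiv_pderiv_comm]
    simp [extremal, Derivation.leibniz, Derivation.leibniz_pow, pderiv_X, Ne.symm hi]

/-- The harmonic polynomial `z₁^α conj z_j^β` as an element of `H^{α,β}`. -/
def extremalHarmonic {j : Fin n} (hj : j ≠ 0) (α β : ℕ) : Harmonics n α β :=
  (⟨realEval (extremal j α β), realEval_mem_harmonics (extremal_mem j) (polyLaplacian_extremal hj)⟩ :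
    harmonics n α β)

theorem extremalHarmonic_apply {j : Fin n} (hj : j ≠ 0) (z : Cn n) :
    extremalHarmonic hj α β z = z 0 ^ α * conj (z j) ^ β := by
  change realEval (extremal j α β) z = _
  simp [extremal]

theorem extremalHarmonic_ne_zero {j : Fin n} (hj : j ≠ 0) : extremalHarmonic hj α β ≠ 0 := by
  intro h
  have h1 := extremalHarmonic_apply (α := α) (β := β) hj (planePoint j 1 1)
  rw [h, planePoint_zero hj, planePoint_self hj] at h1
  simp [Harmonics.zero_apply] at h1

theorem exists_ne_zero_fin (hn : 2 ≤ n) : ∃ j : Fin n, j ≠ 0 :=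
  ⟨⟨1, hn⟩, fun h => by simpa using congrArg Fin.val h⟩

theorem nontrivial_harmonics (hn : 2 ≤ n) (α β : ℕ) : Nontrivial (Harmonics n α β) := by
  obtain ⟨j, hj⟩ := exists_ne_zero_fin hn
  exact ⟨_, _, extremalHarmonic_ne_zero (α := α) (β := β) hj⟩

/-- The representation of `U(n)` on `H^{α,β}(ℂⁿ)` is irreducible. -/
theorem isIrreducible_harmonicsRep (hn : 2 ≤ n) (α β : ℕ) :
    (harmonicsRep n α β).IsIrreducible := by
  have := nontrivial_harmonics hn α β
  have hnt : Nontrivial (Subrepresentation (harmonicsRep n α β)) := by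
    refine ⟨⊥, ⊤, fun h => ?_⟩
    have h2 := congrArg Subrepresentation.toSubmodule h
    exact bot_ne_top (α := Submodule ℂ (Harmonics n α β)) h2
  refine ⟨fun W => ?_⟩
  by_contra! hW
  have hV0 : W.toSubmodule ≠ ⊥ := fun h => hW.1 (Subrepresentation.toSubmodule_injective h)
  -- If `W` is proper, then `W` and its orthogonal complement each contain a non-zero zonal
  -- harmonic. The two are orthogonal and yet linearly dependent, a contradiction.
  have hV1 : W.toSubmoduleᗮ ≠ ⊥ := by
    intro h
    rw [Submodule.orthogonal_eq_bot_iff] at h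
    exact hW.2 (Subrepresentation.toSubmodule_injective h)
  obtain ⟨v, hv, hv0, hvz⟩ := exists_zonal_mem (fun u f hf => W.apply_mem_toSubmodule u hf) hV0
  obtain ⟨w, hw, hw0, hwz⟩ := exists_zonal_mem (V := W.toSubmoduleᗮ) (fun u f hf => by
    rw [Submodule.mem_orthogonal'] at hf ⊢
    intro g hg
    rw [inner_harmonicsRep_left]
    exact hf _ (W.apply_mem_toSubmodule _ hg)) hV1
  obtain ⟨s, t, hst, h⟩ := zonal_dependent hn v.toPoly.2 w.toPoly.2 hvz hwz
  have h' : s • v + t • w = 0 := Harmonics.ext fun z => congrFun h z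
  have horth : inner ℂ v w = 0 := hw v hv
  have horth' : inner ℂ w v = 0 := by rw [← inner_conj_symm, horth, map_zero]
  rcases hst with hs | ht
  · have h1 : inner ℂ v (s • v + t • w) = 0 := by rw [h', inner_zero_right]
    rw [inner_add_right, inner_smul_right, inner_smul_right, horth, mul_zero, add_zero] at h1
    exact hv0 (inner_self_eq_zero.mp ((mul_eq_zero.mp h1).resolve_left hs))
  · have h1 : inner ℂ w (s • v + t • w) = 0 := by rw [h', inner_zero_right]
    rw [inner_add_right, inner_smul_right, inner_smul_right, horth', mul_zero, zero_add] at h1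
    exact hw0 (inner_self_eq_zero.mp ((mul_eq_zero.mp h1).resolve_left ht))

/-- The unitary matrix `diag(w, 1, …, 1)`. -/
def diagUnitary {w : ℂ} (hw : ‖w‖ = 1) : K n :=
  ⟨Matrix.diagonal (Function.update 1 0 w), by
    rw [Matrix.mem_unitaryGroup_iff, Matrix.star_eq_conjTranspose, Matrix.diagonal_conjTranspose,
      Matrix.diagonal_mul_diagonal, ← Matrix.diagonal_one]
    congr 1
    funext i
    by_cases hi : i = 0
    · subst hi
      simp [Complex.mul_conj', hw]
    · simp [hi]⟩

theorem act_diagUnitary {w : ℂ} (hw : ‖w‖ = 1) (z : Cn n) (i : Fin n) :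
    act (diagUnitary (n := n) hw).1 z i = (if i = 0 then w else 1) * z i := by
  rw [act_apply]
  simp [diagUnitary, Matrix.diagonal_apply, Function.update_apply]

/-- The weights of the first coordinate circle on polynomials of degree `α` in `z` are at most
`α`. -/
theorem eq_zero_of_weight {f : Cn n → ℂ} (hf : f ∈ bihomogeneous n α β) {m : ℕ} (hm : α < m)
    (h : ∀ (w : ℂ) (hw : ‖w‖ = 1) (z : Cn n),
      f (act (diagUnitary (n := n) hw).1 z) = w ^ m * f z) : f = 0 := by
  obtain ⟨P, hP, rfl⟩ := exists_realEval hf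
  -- After projection to the weight `m`, a monomial carries the exponent `d - d' - m` with `d ≤ α <
  -- m` and `d' ≤ β`. This is negative and at least `-(m + β)`, so `m + β + 1` roots of unity
  -- annihilate every monomial.
  have hN : m + β + 1 ≠ 0 := by omega
  have hζ := Complex.isPrimitiveRoot_exp (m + β + 1) hN
  set ζ := Complex.exp (2 * Real.pi * Complex.I / (m + β + 1 : ℕ))
  have hζ1 : ∀ s : ℕ, ‖ζ ^ s‖ = 1 := fun s => by rw [norm_pow, hζ.norm'_eq_one hN, one_pow]
  have key : ∀ z : Cn n, ∑ s ∈ Finset.range (m + β + 1),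
      conj (ζ ^ s) ^ m * realEval P (act (diagUnitary (n := n) (hζ1 s)).1 z) = 0 := by
    intro z
    refine bihomogeneousPoly_induction (p := fun P => ∑ s ∈ Finset.range (m + β + 1),
      conj (ζ ^ s) ^ m * realEval P (act (diagUnitary (n := n) (hζ1 s)).1 z) = 0)
      (fun d c h1 h2 => ?_) ?_ (fun P Q hP hQ => ?_) hP
    · have hl : d (Sum.inl 0) ≤ α := by
        rw [← h1]
        exact Finset.single_le_sum (f := fun i => d (Sum.inl i)) (fun _ _ => Nat.zero_le _)
          (Finset.mem_univ 0)
      have hr : d (Sum.inr 0) ≤ β := by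
        rw [← h2]
        exact Finset.single_le_sum (f := fun i => d (Sum.inr i)) (fun _ _ => Nat.zero_le _)
          (Finset.mem_univ 0)
      have e : ∀ s ∈ Finset.range (m + β + 1), conj (ζ ^ s) ^ m *
          realEval (monomial d c) (act (diagUnitary (n := n) (hζ1 s)).1 z) =
          (ζ ^ s) ^ ((d (Sum.inl 0) : ℤ) - (d (Sum.inr 0) + m : ℕ)) *
            realEval (monomial d c) z := by
        intro s _
        rw [← pow_mul_conj_pow (hζ1 s), realEval_monomial, realEval_monomial]
        simp only [act_diagUnitary, map_mul, mul_pow, Finset.prod_mul_distrib, apply_ite conj,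
          map_one, ite_pow, one_pow, Finset.prod_ite_eq', Finset.mem_univ, if_true, pow_add]
        ring
      rw [Finset.sum_congr rfl e, ← Finset.sum_mul, sum_rootOfUnity_zpow hζ (by omega)
        (by rw [abs_lt]; constructor <;> omega), zero_mul]
    · simp
    · simp only [realEval_add, mul_add, Finset.sum_add_distrib, hP, hQ, add_zero]
  funext z
  -- If `f` has weight `m`, the projection multiplies it by the number of roots of unity, while
  -- `key` says that the result is zero.
  have hk := key z
  have e : ∀ s ∈ Finset.range (m + β + 1),
      conj (ζ ^ s) ^ m * realEval P (act (diagUnitary (n := n) (hζ1 s)).1 z) = realEval P z := by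
    intro s _
    rw [h _ (hζ1 s), ← mul_assoc, ← mul_pow, Complex.conj_mul', hζ1 s]
    simp
  rw [Finset.sum_congr rfl e, Finset.sum_const, Finset.card_range, nsmul_eq_mul] at hk
  exact (mul_eq_zero.mp hk).resolve_left (Nat.cast_ne_zero.mpr hN)

variable {α' β' : ℕ}

/-- By irreducibility `T` is injective or zero. An injective `T` would carry `z₁^α conj z_j^β` to a
non-zero vector of weight `α` for the circle in the first coordinate, which exceeds every weight
possible in degree `α'`. -/
theorem intertwining_eq_zero_of_lt (hn : 2 ≤ n) (h : α' < α)
    (T : Representation.IntertwiningMap (harmonicsRep n α β) (harmonicsRep n α' β')) : T = 0 := by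
  have := isIrreducible_harmonicsRep hn α β
  refine (Representation.IsIrreducible.injective_or_eq_zero T).resolve_left fun hinj => ?_
  obtain ⟨j, hj⟩ := exists_ne_zero_fin hn
  refine extremalHarmonic_ne_zero (α := α) (β := β) hj (hinj ?_)
  rw [map_zero]
  have h0 := eq_zero_of_weight (T (extremalHarmonic hj α β)).toPoly.2.1 h (fun w hw z => ?_)
  · exact Harmonics.ext fun z => congrFun h0 z
  · have h1 : harmonicsRep n α β (diagUnitary hw)⁻¹ (extremalHarmonic hj α β) =
        w ^ α • extremalHarmonic hj α β := by
      refine Harmonics.ext fun z => ?_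
      rw [harmonicsRep_apply, inv_inv, Harmonics.smul_apply, extremalHarmonic_apply,
        extremalHarmonic_apply, act_diagUnitary, act_diagUnitary]
      simp [hj]
      ring
    have h2 := T.isIntertwining _ _ (diagUnitary hw)⁻¹ (extremalHarmonic hj α β)
    rw [h1, map_smul] at h2
    have h3 := congrArg (fun f : Harmonics n α' β' => f z) h2
    simp only [harmonicsRep_apply, inv_inv, Harmonics.smul_apply] at h3
    exact h3.symm

/-- The representations on harmonic polynomials of different degrees are not isomorphic. -/
theorem intertwining_eq_zero (hn : 2 ≤ n) (h : α ≠ α')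
    (T : Representation.IntertwiningMap (harmonicsRep n α β) (harmonicsRep n α' β')) : T = 0 := by
  rcases lt_or_gt_of_ne h with h | h
  · have := isIrreducible_harmonicsRep hn α β
    have := isIrreducible_harmonicsRep hn α' β'
    refine (Representation.IsIrreducible.bijective_or_eq_zero T).resolve_left fun hb => ?_
    obtain ⟨j, hj⟩ := exists_ne_zero_fin hn
    -- The weight argument needs the larger degree at the source, so for `α < α'` it is applied to
    -- the inverse of the isomorphism.
    have h0 := intertwining_eq_zero_of_lt hn h (T.ofBijective hb).symm.toIntertwiningMap
    refine extremalHarmonic_ne_zero (α := α') (β := β') hj ?_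
    have h1 := (T.ofBijective hb).apply_symm_apply (extremalHarmonic hj α' β')
    have h2 : (T.ofBijective hb).symm (extremalHarmonic hj α' β') = 0 :=
      DFunLike.congr_fun h0 (extremalHarmonic hj α' β')
    rw [h2, map_zero] at h1
    exact h1.symm
  · exact intertwining_eq_zero_of_lt hn h T

end HarmonicsRep

/-! ### Harmonic polynomials as sections of the line bundle. -/

section Embedding

theorem norm_det_unitary {n : ℕ} (u : K n) : ‖u.1.det‖ = 1 :=
  CStarRing.norm_of_mem_unitary (Matrix.det_of_mem_unitary u.2)

variable {n : ℕ} [NeZero n] {lam : ℝ} {k : ℤ} {α β : ℕ}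

/-- A harmonic polynomial as an element of `H^{α,β}`. -/
def Harmonics.mk (f : Cn n → ℂ) (hf : f ∈ harmonics n α β) : Harmonics n α β :=
  (⟨f, hf⟩ : harmonics n α β)

theorem Harmonics.mk_apply (f : Cn n → ℂ) (hf : f ∈ harmonics n α β) (z : Cn n) :
    Harmonics.mk f hf z = f z := rfl

theorem act_parabolic_e0 (p : parabolic n) : act p.1.1 (e0 n) = topEntry p • e0 n := by
  ext i
  rw [act_e0]
  by_cases hi : i = 0
  · subst hi
    simp [e0, topEntry]
  · rw [p.2 i hi]
    simp [e0, hi]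

/-- The separation into modulus and phase matches the shape of `chi`: the phase must reproduce the
character, and the modulus is cancelled in `harmonicSection`. -/
theorem pow_mul_conj_pow_eq {w : ℂ} (hw : w ≠ 0) (a b : ℕ) :
    w ^ a * conj w ^ b = (‖w‖ : ℂ) ^ (a + b) * (w / (‖w‖ : ℂ)) ^ ((a : ℤ) - b) := by
  have h0 : (‖w‖ : ℂ) ≠ 0 := by simpa using hw
  have h1 : ‖w / (‖w‖ : ℂ)‖ = 1 := by simp [hw]
  rw [← pow_mul_conj_pow h1, map_div₀, Complex.conj_ofReal, pow_add, div_pow, div_pow]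
  field_simp

theorem continuous_act_e0 : Continuous fun g : G n => act g.1 (e0 n) := by
  have h : Continuous fun g : G n => g.1 *ᵥ (e0 n : Fin n → ℂ) :=
    Continuous.matrix_mulVec Units.continuous_val continuous_const
  exact (PiLp.continuous_toLp 2 _).comp h

/-- The section of the line bundle that extends the restriction of a harmonic polynomial to the
unit sphere. -/
def harmonicSection (lam : ℝ) (k : ℤ) (hk : (α : ℤ) - β = -k) (f : Harmonics n α β) :
    Sections n lam k :=
  -- Replacing `g` by `g p` multiplies `g e₁` by `w`. The factors `|det g|` and `|g e₁|^(-n)` yield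
  -- `δ_P(p)^(-1/2) = |det p| / |w|^n`, and `|g e₁|^(-iλ)` yields the modulus part of `χ(p)⁻¹`. The
  -- exponent `-(α+β)` removes the modulus of `w` contributed by `f`, leaving the phase to the power
  -- `α - β = -k`.
  (⟨fun g => (‖g.1.det‖ : ℂ) *
      (‖act g.1 (e0 n)‖ : ℂ) ^ (-(Complex.I * lam) - n - (α + β : ℕ)) * f (act g.1 (e0 n)), by
    constructor
    · refine Continuous.mul (Continuous.mul ?_ (Continuous.cpow ?_ continuous_const ?_)) ?_
      · exact Complex.continuous_ofReal.comp (Units.continuous_val.matrix_det.norm)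
      · exact Complex.continuous_ofReal.comp continuous_act_e0.norm
      · intro g
        exact Complex.ofReal_mem_slitPlane.mpr (norm_pos_iff.mpr (act_e0_ne_zero g))
      · exact (contDiff_bihomogeneous f.toPoly.2.1).continuous.comp continuous_act_e0
    · intro g p
      have hw := topEntry_ne_zero p
      have hw' : (‖topEntry p‖ : ℂ) ≠ 0 := by simpa using hw
      have hd := det_ne_zero p.1
      have hd' : (‖p.1.1.det‖ : ℂ) ≠ 0 := by simpa using hd
      have hu : (topEntry p / (‖topEntry p‖ : ℂ)) ≠ 0 := div_ne_zero hw hw'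
      have hc : (‖topEntry p‖ : ℂ) ^ (Complex.I * lam) ≠ 0 := by
        rw [Ne, Complex.cpow_eq_zero_iff]
        exact fun h => hw' h.1
      beta_reduce
      rw [Units.val_mul, act_mul, act_parabolic_e0, map_smul, Matrix.det_mul, norm_mul, norm_smul,
        bihomogeneous_smul f.toPoly.2.1, pow_mul_conj_pow_eq hw, hk, rhoChar_eq, chi,
        Complex.ofReal_mul, Complex.ofReal_mul,
        Complex.mul_cpow_ofReal_nonneg (norm_nonneg _) (norm_nonneg _),
        Complex.cpow_sub _ _ hw', Complex.cpow_sub _ _ hw', Complex.cpow_neg, Complex.cpow_natCast,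
        Complex.cpow_natCast, _root_.zpow_neg]
      push_cast
      field_simp⟩ : inducedSections n (Complex.I * lam) k)

theorem harmonicSection_apply (hk : (α : ℤ) - β = -k) (f : Harmonics n α β) (g : G n) :
    harmonicSection lam k hk f g = (‖g.1.det‖ : ℂ) *
      (‖act g.1 (e0 n)‖ : ℂ) ^ (-(Complex.I * lam) - n - (α + β : ℕ)) * f (act g.1 (e0 n)) := rfl

theorem norm_act_e0_unitary (u : K n) : ‖act u.1 (e0 n)‖ = 1 := by
  rw [norm_act_unitary, norm_e0]

theorem harmonicSection_incl (hk : (α : ℤ) - β = -k) (f : Harmonics n α β) (u : K n) :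
    harmonicSection lam k hk f (incl n u) = f (act u.1 (e0 n)) := by
  rw [harmonicSection_apply, incl_coe, norm_det_unitary, norm_act_e0_unitary]
  simp

theorem Sections.add_apply (F₁ F₂ : Sections n lam k) (g : G n) : (F₁ + F₂) g = F₁ g + F₂ g := rfl

theorem Sections.sub_apply (F₁ F₂ : Sections n lam k) (g : G n) : (F₁ - F₂) g = F₁ g - F₂ g := rfl

theorem Sections.smul_apply (c : ℂ) (F : Sections n lam k) (g : G n) : (c • F) g = c * F g := rfl

/-- The embedding of `H^{α,β}` into the sections of the line bundle. -/
def harmonicSectionIsometry (lam : ℝ) (k : ℤ) (hk : (α : ℤ) - β = -k) :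
    Harmonics n α β →ₗᵢ[ℂ] Sections n lam k :=
  LinearMap.isometryOfInner
    { toFun := harmonicSection lam k hk
      map_add' := fun f₁ f₂ => Sections.ext fun g => by
        rw [Sections.add_apply]
        simp only [harmonicSection_apply, Harmonics.add_apply]
        ring
      map_smul' := fun c f => Sections.ext fun g => by
        rw [Sections.smul_apply]
        simp only [harmonicSection_apply, Harmonics.smul_apply, RingHom.id_apply]
        ring }
    (fun f₁ f₂ => by
      rw [inner_sections, inner_harmonics]
      simp only [LinearMap.coe_mk, AddHom.coe_mk, harmonicSection_incl])

/-- The two scalar factors depend only on `|det g|` and `|g e₁|`, which left multiplication by a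
unitary matrix preserves. -/
theorem translate_harmonicSection (hk : (α : ℤ) - β = -k) (u : K n) (f : Harmonics n α β) :
    translate (incl n u) (harmonicSection lam k hk f) =
      harmonicSection lam k hk (harmonicsRep n α β u f) := by
  refine Sections.ext fun g => ?_
  have h1 : ((incl n u)⁻¹ : G n).1 = (u⁻¹ : K n).1 := by
    rw [← map_inv, incl_coe]
  rw [translate_apply, harmonicSection_apply, harmonicSection_apply, harmonicsRep_apply,
    Units.val_mul, h1, act_mul, norm_act_unitary, Matrix.det_mul, norm_mul, norm_det_unitary,
    one_mul]

/-- The embedding of `H^{α,β}` into the principal series. -/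
def harmonicEmbedding (lam : ℝ) (k : ℤ) (hk : (α : ℤ) - β = -k) :
    Harmonics n α β →ₗᵢ[ℂ] PrincipalSeriesSpace n lam k :=
  UniformSpace.Completion.toComplₗᵢ.comp (harmonicSectionIsometry lam k hk)

theorem harmonicEmbedding_apply (hk : (α : ℤ) - β = -k) (f : Harmonics n α β) :
    harmonicEmbedding lam k hk f =
      ((harmonicSection lam k hk f : Sections n lam k) : PrincipalSeriesSpace n lam k) := rfl

theorem principalSeries_harmonicEmbedding (hk : (α : ℤ) - β = -k) (u : K n) (f : Harmonics n α β) :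
    principalSeries n lam k (incl n u) (harmonicEmbedding lam k hk f) =
      harmonicEmbedding lam k hk (harmonicsRep n α β u f) := by
  rw [harmonicEmbedding_apply, harmonicEmbedding_apply, ← translate_harmonicSection]
  exact translateCompletion_coe _ _

end Embedding

/-! ### Density of the harmonic sections. -/

section Density

/-- The unit sphere of `ℂⁿ`. -/
abbrev unitSphere (n : ℕ) : Type := Metric.sphere (0 : Cn n) 1

/-- The restrictions to the unit sphere of polynomials in `z` and its conjugate. -/
def spherePolynomials (n : ℕ) : StarSubalgebra ℂ C(unitSphere n, ℂ) where
  carrier := {φ | ∃ P : RealPoly n, ∀ z, φ z = realEval P z.1}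
  mul_mem' := by
    rintro φ ψ ⟨P, hP⟩ ⟨Q, hQ⟩
    exact ⟨P * Q, fun z => by rw [ContinuousMap.mul_apply, hP, hQ, realEval_mul]⟩
  add_mem' := by
    rintro φ ψ ⟨P, hP⟩ ⟨Q, hQ⟩
    exact ⟨P + Q, fun z => by rw [ContinuousMap.add_apply, hP, hQ, realEval_add]⟩
  algebraMap_mem' c := ⟨MvPolynomial.C c, fun z => by
    simp [Algebra.algebraMap_eq_smul_one]⟩
  star_mem' := by
    rintro φ ⟨P, hP⟩
    exact ⟨conjPoly P, fun z => by rw [ContinuousMap.star_apply, hP, realEval_conjPoly]; rfl⟩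

theorem separatesPoints_spherePolynomials {n : ℕ} : (spherePolynomials n).SeparatesPoints := by
  intro x y hxy
  have : ∃ i, x.1 i ≠ y.1 i := by
    by_contra! h
    exact hxy (Subtype.ext (PiLp.ext h))
  obtain ⟨i, hi⟩ := this
  refine ⟨_, ⟨⟨fun z => realEval (MvPolynomial.X (Sum.inl i)) z.1,
    (continuous_realEval _).comp continuous_subtype_val⟩, ⟨_, fun z => rfl⟩, rfl⟩, ?_⟩
  simpa using hi

variable {n : ℕ} [NeZero n] {lam : ℝ} {k : ℤ}

/-- The two unitary matrices differ by an element of `P` with upper left entry `c` and determinant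
of modulus one, so only the phase part of the character remains. For `c = 1` this lets `F` descend
to the sphere; for general `c` it is the covariance under the circle. -/
theorem section_incl_eq (F : Sections n lam k) {u v : K n} {c : ℂ} (hc : ‖c‖ = 1)
    (h : act u.1 (e0 n) = c • act v.1 (e0 n)) : F (incl n u) = (c ^ k)⁻¹ * F (incl n v) := by
  obtain ⟨p, hp, hpc⟩ := exists_parabolic (g := incl n v) (g' := incl n u) h
  have hdet : ‖p.1.1.det‖ = 1 := by
    have h1 := congrArg (fun g : G n => ‖g.1.det‖) hp
    simp only [Units.val_mul, Matrix.det_mul, norm_mul, incl_coe, norm_det_unitary, one_mul] at h1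
    exact h1.symm
  rw [hp, F.map_mul, rhoChar_eq, chi, hpc, hc, hdet]
  simp

/-- The orbit map of `e₁`. -/
def orbitMap (n : ℕ) [NeZero n] (u : K n) : unitSphere n :=
  ⟨act u.1 (e0 n), by simp [norm_act_e0_unitary]⟩

theorem isQuotientMap_orbitMap : Topology.IsQuotientMap (orbitMap n) := by
  have hc : Continuous (orbitMap n) :=
    Continuous.subtype_mk (continuous_act_e0.comp (continuous_incl n)) _
  refine IsClosedMap.isQuotientMap hc.isClosedMap hc fun z => ?_
  obtain ⟨u, hu⟩ := exists_unitary (w := z.1) (by simp)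
  exact ⟨u, Subtype.ext hu⟩

/-- The restriction of `F` to `U(n)` descends to a continuous function on the sphere, where
Stone–Weierstrass applies. -/
theorem exists_realEval_approx (F : Sections n lam k) {ε : ℝ} (hε : 0 < ε) :
    ∃ P : RealPoly n, ∀ u : K n, ‖F (incl n u) - realEval P (act u.1 (e0 n))‖ ≤ ε := by
  -- This right inverse need not be continuous. Continuity of the descended function comes from the
  -- quotient topology.
  obtain ⟨s, hs⟩ := (isQuotientMap_orbitMap (n := n)).surjective.hasRightInverse
  have hF : ∀ u : K n, F (incl n (s (orbitMap n u))) = F (incl n u) := by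
    intro u
    have h1 : act (s (orbitMap n u)).1 (e0 n) = (1 : ℂ) • act u.1 (e0 n) := by
      rw [one_smul]
      exact congrArg Subtype.val (hs (orbitMap n u))
    rw [section_incl_eq F norm_one h1]
    simp
  let h : C(unitSphere n, ℂ) := ⟨fun z => F (incl n (s z)), by
    rw [isQuotientMap_orbitMap.continuous_iff]
    exact (continuous_section F).congr fun u => (hF u).symm⟩
  have hmem : h ∈ (spherePolynomials n).topologicalClosure := by
    rw [ContinuousMap.starSubalgebra_topologicalClosure_eq_top_of_separatesPoints _
      separatesPoints_spherePolynomials]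
    trivial
  obtain ⟨φ, ⟨P, hP⟩, hφ⟩ := Metric.mem_closure_iff.mp hmem ε hε
  refine ⟨P, fun u => ?_⟩
  have h1 : dist (h (orbitMap n u)) (φ (orbitMap n u)) ≤ ε :=
    (ContinuousMap.dist_apply_le_dist _).trans hφ.le
  rw [hP, dist_eq_norm] at h1
  have h2 : h (orbitMap n u) = F (incl n u) := hF u
  rwa [h2] at h1

variable (n lam k) in
/-- The span of the sections that come from harmonic polynomials. -/
def harmonicSections : Submodule ℂ (Sections n lam k) :=
  Submodule.span ℂ {F | ∃ (α β : ℕ) (hk : (α : ℤ) - β = -k) (f : Harmonics n α β),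
    F = harmonicSection lam k hk f}

/-- The powers of `|z|²` equal one on the sphere, and removing them does not change the difference
of the two degrees. -/
theorem exists_harmonicSections_of_mem {a b : ℕ} (hk : (a : ℤ) - b = -k) {P : RealPoly n}
    (hP : P ∈ harmonicSpan n a b) :
    ∃ F ∈ harmonicSections n lam k, ∀ u : K n, F (incl n u) = realEval P (act u.1 (e0 n)) := by
  induction hP using Submodule.span_induction with
  | mem P hP =>
    obtain ⟨s, α, β, H, hH, hH0, rfl, rfl, rfl⟩ := hP
    have hk' : (α : ℤ) - β = -k := by
      rw [← hk]
      push_cast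
      ring
    refine ⟨harmonicSection lam k hk' (Harmonics.mk (realEval H) (realEval_mem_harmonics hH hH0)),
      Submodule.subset_span ⟨α, β, hk', _, rfl⟩, fun u => ?_⟩
    rw [harmonicSection_incl, realEval_mul, realEval_pow, realEval_normSqPoly, norm_act_e0_unitary]
    simp only [Complex.ofReal_one, one_pow, one_mul, Harmonics.mk_apply]
  | zero => exact ⟨0, Submodule.zero_mem _, fun u => by rw [realEval_zero]; rfl⟩
  | add P Q _ _ hP hQ =>
    obtain ⟨F₁, h₁, h₁'⟩ := hP
    obtain ⟨F₂, h₂, h₂'⟩ := hQ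
    exact ⟨F₁ + F₂, Submodule.add_mem _ h₁ h₂, fun u => by
      rw [Sections.add_apply, h₁', h₂', realEval_add]⟩
  | smul c P _ hP =>
    obtain ⟨F, h, h'⟩ := hP
    exact ⟨c • F, Submodule.smul_mem _ c h, fun u => by
      rw [Sections.smul_apply, h', realEval_smul]⟩

/-- Averages of polynomials over sufficiently many roots of unity project to the sections that
come from harmonic polynomials. -/
theorem exists_average (P : RealPoly n) : ∃ F ∈ harmonicSections n lam k, ∃ N₀ : ℕ, ∀ N ≥ N₀,
    N ≠ 0 → ∀ ζ : ℂ, IsPrimitiveRoot ζ N → ∀ u : K n,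
      ∑ s ∈ Finset.range N, (ζ ^ s) ^ k * realEval P (ζ ^ s • act u.1 (e0 n)) =
        N * F (incl n u) := by
  induction P using MvPolynomial.induction_on' with
  | monomial d c =>
    set P : RealPoly n := MvPolynomial.monomial d c
    set a := ∑ i, d (Sum.inl i)
    set b := ∑ i, d (Sum.inr i)
    have hP : P ∈ bihomogeneousPoly n a b := monomial_mem_bihomogeneousPoly d c
    -- A monomial of bidegree `(a, b)` has the weight `a - b` under phases, so the average either
    -- reproduces it, when `a - b = -k`, or kills it.
    have key : ∀ N : ℕ, N ≠ 0 → ∀ ζ : ℂ, IsPrimitiveRoot ζ N → ∀ z : Cn n,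
        ∑ s ∈ Finset.range N, (ζ ^ s) ^ k * realEval P (ζ ^ s • z) =
          (∑ s ∈ Finset.range N, (ζ ^ s) ^ (k + ((a : ℤ) - b))) * realEval P z := by
      intro N hN ζ hζ z
      rw [Finset.sum_mul]
      refine Finset.sum_congr rfl fun s _ => ?_
      have hs : ‖ζ ^ s‖ = 1 := by rw [norm_pow, hζ.norm'_eq_one hN, one_pow]
      have hs0 : ζ ^ s ≠ 0 := norm_ne_zero_iff.mp (by rw [hs]; exact one_ne_zero)
      rw [bihomogeneous_smul (realEval_mem_bihomogeneous hP), pow_mul_conj_pow hs,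
        zpow_add₀ hs0, mul_assoc]
    by_cases hab : (a : ℤ) - b = -k
    · obtain ⟨F, hF, hF'⟩ := exists_harmonicSections_of_mem (lam := lam) hab
        (bihomogeneousPoly_le_harmonicSpan (Nat.pos_of_ne_zero (NeZero.ne n)) a b hP)
      refine ⟨F, hF, 0, fun N _ hN ζ hζ u => ?_⟩
      rw [key N hN ζ hζ, hab, add_neg_cancel, hF']
      simp
    -- The bound exceeds `|k + a - b|`, as the vanishing of the sum of roots of unity requires.
    · refine ⟨0, Submodule.zero_mem _, k.natAbs + a + b + 1, fun N hN hN0 ζ hζ u => ?_⟩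
      rw [key N hN0 ζ hζ, sum_rootOfUnity_zpow hζ (by omega) (by rw [abs_lt]; constructor <;> omega),
        zero_mul]
      exact (mul_zero _).symm
  | add P Q hP hQ =>
    obtain ⟨F₁, h₁, N₁, h₁'⟩ := hP
    obtain ⟨F₂, h₂, N₂, h₂'⟩ := hQ
    refine ⟨F₁ + F₂, Submodule.add_mem _ h₁ h₂, max N₁ N₂, fun N hN hN0 ζ hζ u => ?_⟩
    simp only [realEval_add, mul_add, Finset.sum_add_distrib]
    rw [h₁' N (le_trans (le_max_left _ _) hN) hN0 ζ hζ u,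
      h₂' N (le_trans (le_max_right _ _) hN) hN0 ζ hζ u, Sections.add_apply, mul_add]

/-- `F` is its own average by covariance, and averaging unimodular multiples does not increase the
uniform distance. The average of the approximating polynomial is a harmonic section. -/
theorem exists_harmonicSections_approx (F : Sections n lam k) {ε : ℝ} (hε : 0 < ε) :
    ∃ F' ∈ harmonicSections n lam k, ‖F - F'‖ ≤ ε := by
  obtain ⟨P, hP⟩ := exists_realEval_approx F hε
  obtain ⟨F', hF', N₀, hN₀⟩ := exists_average (lam := lam) (k := k) P
  refine ⟨F', hF', ?_⟩
  have hN : N₀ + 1 ≠ 0 := by omega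
  have hζ := Complex.isPrimitiveRoot_exp (N₀ + 1) hN
  set ζ := Complex.exp (2 * Real.pi * Complex.I / (N₀ + 1 : ℕ))
  have hζ1 : ∀ s : ℕ, ‖ζ ^ s‖ = 1 := fun s => by rw [norm_pow, hζ.norm'_eq_one hN, one_pow]
  have hpt : ∀ u : K n, ‖(F - F') (incl n u)‖ ≤ ε := by
    intro u
    have hs : ∀ s ∈ Finset.range (N₀ + 1),
        ‖F (incl n u) - (ζ ^ s) ^ k * realEval P (ζ ^ s • act u.1 (e0 n))‖ ≤ ε := by
      intro s _
      -- The uniform estimate is used at the rotated point, and covariance brings the value of `F`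
      -- back to `u`.
      obtain ⟨v, hv⟩ := exists_unitary (w := ζ ^ s • act u.1 (e0 n))
        (by rw [norm_smul, hζ1, norm_act_e0_unitary, one_mul])
      have h0 : (ζ ^ s) ^ k ≠ 0 :=
        zpow_ne_zero _ (norm_ne_zero_iff.mp (by rw [hζ1]; exact one_ne_zero))
      have h1 := hP v
      rw [section_incl_eq F (hζ1 s) hv, hv] at h1
      have h2 : F (incl n u) - (ζ ^ s) ^ k * realEval P (ζ ^ s • act u.1 (e0 n)) =
          (ζ ^ s) ^ k * (((ζ ^ s) ^ k)⁻¹ * F (incl n u) -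
            realEval P (ζ ^ s • act u.1 (e0 n))) := by
        rw [mul_sub, mul_inv_cancel_left₀ h0]
      rw [h2, norm_mul, norm_zpow, hζ1, _root_.one_zpow, one_mul]
      exact h1
    have hsum : ((N₀ + 1 : ℕ) : ℂ) * (F - F') (incl n u) = ∑ s ∈ Finset.range (N₀ + 1),
        (F (incl n u) - (ζ ^ s) ^ k * realEval P (ζ ^ s • act u.1 (e0 n))) := by
      rw [Finset.sum_sub_distrib, hN₀ _ (Nat.le_succ _) hN ζ hζ u, Sections.sub_apply, mul_sub]
      simp
    have hle := norm_sum_le_of_le _ hs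
    rw [← hsum, norm_mul, Complex.norm_natCast, Finset.sum_const, Finset.card_range,
      nsmul_eq_mul] at hle
    exact le_of_mul_le_mul_left hle (by positivity)
  -- The Haar measure has total mass one, so the `L²` norm is at most the uniform norm.
  refine (pow_le_pow_iff_left₀ (norm_nonneg _) hε.le two_ne_zero).mp ?_
  rw [norm_sq_sections]
  calc ∫ u, ‖(F - F') (incl n u)‖ ^ 2 ∂(haarK n) ≤ ∫ _u : K n, ε ^ 2 ∂(haarK n) := by
        refine integral_mono_of_nonneg (Filter.Eventually.of_forall fun u => sq_nonneg _)
          (integrable_const _) (Filter.Eventually.of_forall fun u => ?_)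
        exact pow_le_pow_left₀ (norm_nonneg _) (hpt u) 2
    _ = ε ^ 2 := by simp

end Density

/-! ### The Hilbert sum decomposition and multiplicity one. -/

section Decomposition

variable {n : ℕ} [NeZero n] {lam : ℝ} {k : ℤ}

/-- The bidegrees that occur in the decomposition. -/
abbrev Bidegree (k : ℤ) : Type := {p : ℕ × ℕ // (p.1 : ℤ) - (p.2 : ℤ) = -k}

/-- Since `α - β` is fixed, `α` determines the bidegree. Comparing the degrees in `z` thus separates
all summands. -/
theorem Bidegree.fst_ne {i j : Bidegree k} (h : i ≠ j) : i.1.1 ≠ j.1.1 := by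
  intro h1
  refine h (Subtype.ext (Prod.ext h1 ?_))
  have := i.2
  have := j.2
  omega

variable (n lam k) in
/-- The family of embeddings of the spaces `H^{α,β}` into the principal series. -/
def embedding (i : Bidegree k) : Harmonics n i.1.1 i.1.2 →ₗᵢ[ℂ] PrincipalSeriesSpace n lam k :=
  harmonicEmbedding lam k i.2

theorem principalSeries_embedding (i : Bidegree k) (u : K n) (f : Harmonics n i.1.1 i.1.2) :
    principalSeries n lam k (incl n u) (embedding n lam k i f) =
      embedding n lam k i (harmonicsRep n i.1.1 i.1.2 u f) :=
  principalSeries_harmonicEmbedding i.2 u f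

theorem inner_embedding_principalSeries (i : Bidegree k) (u : K n) (f : Harmonics n i.1.1 i.1.2)
    (v : PrincipalSeriesSpace n lam k) :
    inner ℂ (embedding n lam k i f) (principalSeries n lam k (incl n u) v) =
      inner ℂ (embedding n lam k i (harmonicsRep n i.1.1 i.1.2 u⁻¹ f)) v := by
  rw [← LinearIsometryEquiv.inner_map_map (principalSeries n lam k (incl n u))
    (embedding n lam k i (harmonicsRep n i.1.1 i.1.2 u⁻¹ f)) v, principalSeries_embedding,
    ← Module.End.mul_apply, ← map_mul, mul_inv_cancel, map_one, Module.End.one_apply]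

variable (n lam k) in
/-- The orthogonal projections of one space of harmonic polynomials to another one inside the
principal series. -/
def projection (i j : Bidegree k) :
    Representation.IntertwiningMap (harmonicsRep n j.1.1 j.1.2) (harmonicsRep n i.1.1 i.1.2) where
  toLinearMap := ((ContinuousLinearMap.adjoint (embedding n lam k i).toContinuousLinearMap).comp
    (embedding n lam k j).toContinuousLinearMap : _ →L[ℂ] _).toLinearMap
  isIntertwining' u := by
    refine LinearMap.ext fun f => ext_inner_left ℂ fun g => ?_
    change inner ℂ g (ContinuousLinearMap.adjoint (embedding n lam k i).toContinuousLinearMap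
        (embedding n lam k j (harmonicsRep n _ _ u f))) =
      inner ℂ g (harmonicsRep n _ _ u (ContinuousLinearMap.adjoint
        (embedding n lam k i).toContinuousLinearMap (embedding n lam k j f)))
    have h := inner_harmonicsRep_left u⁻¹ g (ContinuousLinearMap.adjoint
        (embedding n lam k i).toContinuousLinearMap (embedding n lam k j f))
    rw [inv_inv] at h
    rw [← h, ContinuousLinearMap.adjoint_inner_right, ContinuousLinearMap.adjoint_inner_right,
      ← principalSeries_embedding]
    exact inner_embedding_principalSeries i u g _

theorem inner_projection (i j : Bidegree k) (f : Harmonics n i.1.1 i.1.2)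
    (g : Harmonics n j.1.1 j.1.2) :
    inner ℂ f (projection n lam k i j g) =
      inner ℂ (embedding n lam k i f) (embedding n lam k j g) := by
  change inner ℂ f (ContinuousLinearMap.adjoint (embedding n lam k i).toContinuousLinearMap
    (embedding n lam k j g)) = _
  rw [ContinuousLinearMap.adjoint_inner_right]
  rfl

/-- The inner products of two embedded spaces are encoded by an intertwiner between inequivalent
irreducible representations, which vanishes. No integral has to be computed. -/
theorem orthogonalFamily_embedding (hn : 2 ≤ n) :
    OrthogonalFamily ℂ (fun i : Bidegree k => Harmonics n i.1.1 i.1.2) (embedding n lam k) := by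
  intro i j hij f g
  rw [← inner_projection, intertwining_eq_zero hn (Bidegree.fst_ne hij.symm)
    (projection n lam k i j)]
  exact inner_zero_right _

theorem coe_mem_iSup_range {F : Sections n lam k} (hF : F ∈ harmonicSections n lam k) :
    (F : PrincipalSeriesSpace n lam k) ∈
      ⨆ i, LinearMap.range (embedding n lam k i).toLinearMap := by
  induction hF using Submodule.span_induction with
  | mem F hF =>
    obtain ⟨α, β, hk, f, rfl⟩ := hF
    exact Submodule.mem_iSup_of_mem (⟨(α, β), hk⟩ : Bidegree k) ⟨f, rfl⟩
  | zero => rw [UniformSpace.Completion.coe_zero]; exact Submodule.zero_mem _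
  | add F₁ F₂ _ _ h₁ h₂ => rw [UniformSpace.Completion.coe_add]; exact Submodule.add_mem _ h₁ h₂
  | smul c F _ h => rw [UniformSpace.Completion.coe_smul]; exact Submodule.smul_mem _ c h

theorem isHilbertSum_embedding (hn : 2 ≤ n) :
    IsHilbertSum ℂ (fun i : Bidegree k => Harmonics n i.1.1 i.1.2) (embedding n lam k) := by
  refine IsHilbertSum.mk (orthogonalFamily_embedding hn) ?_
  rintro v -
  induction v using UniformSpace.Completion.induction_on with
  | hp =>
    exact Submodule.isClosed_topologicalClosure
      (⨆ i, LinearMap.range (embedding n lam k i).toLinearMap)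
  | ih F =>
    refine Metric.mem_closure_iff.mpr fun ε hε => ?_
    obtain ⟨F', hF', hle⟩ := exists_harmonicSections_approx F (half_pos hε)
    refine ⟨F', coe_mem_iSup_range hF', ?_⟩
    rw [UniformSpace.Completion.dist_eq, dist_eq_norm]
    exact hle.trans_lt (half_lt_self hε)

variable (lam k) in
/-- The unitary isomorphism of the principal series with the Hilbert sum of the spaces
`H^{α,β}`. -/
def decomposition (hn : 2 ≤ n) : PrincipalSeriesSpace n lam k ≃ₗᵢ[ℂ]
    lp (fun i : Bidegree k => Harmonics n i.1.1 i.1.2) 2 :=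
  (isHilbertSum_embedding hn).linearIsometryEquiv

theorem decomposition_embedding [DecidableEq (Bidegree k)] (hn : 2 ≤ n) (i : Bidegree k)
    (f : Harmonics n i.1.1 i.1.2) :
    decomposition lam k hn (embedding n lam k i f) = lp.single 2 i f := by
  rw [← (isHilbertSum_embedding (lam := lam) (k := k) hn).linearIsometryEquiv_symm_apply_single f]
  exact LinearIsometryEquiv.apply_symm_apply _ _

/-- This describes the components of a vector by inner products with the embedded spaces, so that
equivariance of the decomposition reduces to equivariance of the embeddings and unitarity. -/
theorem inner_decomposition (hn : 2 ≤ n) (i : Bidegree k) (f : Harmonics n i.1.1 i.1.2)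
    (v : PrincipalSeriesSpace n lam k) :
    inner ℂ f (decomposition lam k hn v i) = inner ℂ (embedding n lam k i f) v := by
  classical
  rw [← LinearIsometryEquiv.inner_map_map (decomposition lam k hn), decomposition_embedding,
    lp.inner_single_left]

theorem decomposition_principalSeries (hn : 2 ≤ n) (u : K n) (v : PrincipalSeriesSpace n lam k)
    (i : Bidegree k) : decomposition lam k hn (principalSeries n lam k (incl n u) v) i =
      harmonicsRep n i.1.1 i.1.2 u (decomposition lam k hn v i) := by
  refine ext_inner_left ℂ fun f => ?_
  have h := inner_harmonicsRep_left u⁻¹ f (decomposition lam k hn v i)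
  rw [inv_inv] at h
  rw [← h, inner_decomposition, inner_decomposition, inner_embedding_principalSeries]

/-- The components of a `U(n)`-equivariant map to the principal series. -/
def component (hn : 2 ≤ n) {α β : ℕ} (T : Representation.IntertwiningMap (harmonicsRep n α β)
    (principalSeriesRestrict n lam k)) (i : Bidegree k) :
    Representation.IntertwiningMap (harmonicsRep n α β) (harmonicsRep n i.1.1 i.1.2) where
  toFun f := decomposition lam k hn (T f) i
  map_add' f g := by simp
  map_smul' c f := by simp
  isIntertwining' u := by
    refine LinearMap.ext fun f => ?_
    change decomposition lam k hn (T (harmonicsRep n α β u f)) i =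
      harmonicsRep n i.1.1 i.1.2 u (decomposition lam k hn (T f) i)
    rw [T.isIntertwining]
    exact decomposition_principalSeries hn u (T f) i

/-- The embedding of `H^{α,β}` as a `U(n)`-equivariant map. -/
def embeddingIntertwining (lam : ℝ) (i : Bidegree k) : Representation.IntertwiningMap
    (harmonicsRep n i.1.1 i.1.2) (principalSeriesRestrict n lam k) where
  toLinearMap := (embedding n lam k i).toLinearMap
  isIntertwining' u := LinearMap.ext fun f => (principalSeries_embedding i u f).symm

theorem finrank_intertwiningMap (hn : 2 ≤ n) (i : Bidegree k) :
    Module.finrank ℂ (Representation.IntertwiningMap (harmonicsRep n i.1.1 i.1.2)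
      (principalSeriesRestrict n lam k)) = 1 := by
  classical
  have := isIrreducible_harmonicsRep hn i.1.1 i.1.2
  have := nontrivial_harmonics hn i.1.1 i.1.2
  refine (finrank_eq_one_iff_of_nonzero' (embeddingIntertwining lam i) ?_).mpr fun T => ?_
  · intro h
    obtain ⟨f, hf⟩ := exists_ne (0 : Harmonics n i.1.1 i.1.2)
    have h1 : embedding n lam k i f = 0 := DFunLike.congr_fun h f
    rw [← norm_eq_zero, LinearIsometry.norm_map, norm_eq_zero] at h1
    exact hf h1
  -- Schur's lemma over `ℂ`: the component of `T` in the summand `i` is a scalar `c`. The other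
  -- components vanish by inequivalence, so `T` is `c` times the embedding.
  · obtain ⟨c, hc⟩ :=
      (Representation.IsIrreducible.algebraMap_intertwiningMap_bijective_of_isAlgClosed
        (ρ := harmonicsRep n i.1.1 i.1.2)).2 (component hn T i)
    refine ⟨c, ?_⟩
    refine DFunLike.ext _ _ fun f => (decomposition lam k hn).injective (lp.ext (funext fun j => ?_))
    change decomposition lam k hn (c • embedding n lam k i f) j = component hn T j f
    rw [map_smul, decomposition_embedding]
    by_cases hj : i = j
    · subst hj
      rw [← hc]
      simp [Algebra.algebraMap_eq_smul_one]
    · rw [intertwining_eq_zero hn (Bidegree.fst_ne hj) (component hn T j)]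
      simp [hj]

end Decomposition

end GLBranching

end

theorem theorem1p1 (n : ℕ) [NeZero n] (hn : 2 ≤ n) (lam : ℝ) (k : ℤ) :
    (∃ U : GLBranching.PrincipalSeriesSpace n lam k ≃ₗᵢ[ℂ]
        lp (fun i : {p : ℕ × ℕ // (p.1 : ℤ) - (p.2 : ℤ) = -k} =>
          GLBranching.Harmonics n i.1.1 i.1.2) 2,
      ∀ (u : GLBranching.K n) (v : GLBranching.PrincipalSeriesSpace n lam k)
        (i : {p : ℕ × ℕ // (p.1 : ℤ) - (p.2 : ℤ) = -k}),
        U (GLBranching.principalSeries n lam k (GLBranching.incl n u) v) i =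
          GLBranching.harmonicsRep n i.1.1 i.1.2 u (U v i)) ∧
    ∀ α β : ℕ, (α : ℤ) - (β : ℤ) = -k →
      (GLBranching.harmonicsRep n α β).IsIrreducible ∧
      Module.finrank ℂ (Representation.IntertwiningMap (GLBranching.harmonicsRep n α β)
        (GLBranching.principalSeriesRestrict n lam k)) = 1 :=
  ⟨⟨GLBranching.decomposition lam k hn, GLBranching.decomposition_principalSeries hn⟩,
    fun α β h => ⟨GLBranching.isIrreducible_harmonicsRep hn α β,
      GLBranching.finrank_intertwiningMap hn ⟨(α, β), h⟩⟩⟩
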